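/- Fix a number of players $n$. In a concave game $\Gamma$ each player $i\in[n]$ has a convex compact strategy set $\mathcal X_i\subset\mathbb R^{d_i}$ and a utility $u_i:\mathcal X=\mathcal X_1\times\dots\times\mathcal X_n\to[0,1]$ that is concave in her own strategy $x_i$ when the other strategies are fixed. Given feature maps $m_i:\mathcal X_i\to\mathbb R^{k_i}$, let $\Phi_{m_i}$ be the set of all maps $\phi:\mathcal X_i\to\mathcal X_i$ of the form $\phi(x)=K\,m_i(x)$ with $K\in\mathbb R^{d_i\times k_i}$. For $\varepsilon>0$, an $\varepsilon$-approximate $\Phi_m$-equilibrium is a finitely supported probability distribution $\mu$ on $\mathcal X$ with $$\mathbb E_{x\sim\mu}\bigl[u_i(\phi_i(x_i),x_{-i})-u_i(x)\bigr]\le\varepsilon\qquad\text{for all } i\in[n]\text{ and all }\phi_i\in\Phi_{m_i}.$$ Computation model: a real RAM, in which arithmetic operations and comparisons of real numbers take unit time, with oracles for each player $i$: a separation oracle for $\mathcal X_i$ (which on input $x$ either reports $x\in\mathcal X_i$ or returns a hyperplane separating $x$ from $\mathcal X_i$), an evaluation oracle for $u_i$, an oracle returning at each $x\in\mathcal X$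 a supergradient of $u_i(\cdot,x_{-i})$ at $x_i$ of Euclidean norm at most $1$, and an evaluation oracle for $m_i$. Also given are the numbers $d_i,k_i$, the precision $\varepsilon>0$, a radius $R>0$ with $B(0,1)\subseteq\mathcal X_i\subseteq B(0,R)$ for all $i$, and a bound $D\ge 0$ such that for all $i$ the coordinates of $m_i$ are at most $D$ in absolute value on $\mathcal X_i$ and every $\phi\in\Phi_{m_i}$ can be written as $\phi(x)=K\,m_i(x)$ with $\|K\|_F\le D$. A distribution is output as a list of points of $\mathcal X$ with their probabilities. Theorem. For every fixed $n$ there are an algorithm in this model and a polynomial $p$ such that, for every $n$-player concave game and all feature maps as above, with $d=\sum_i d_i$ and $k=\sum_i k_i$, the algorithm outputs an $\varepsilon$-approximate $\Phi_m$-equilibrium in time at most $p(d,k,R,D,1/\varepsilon)$. In particular, when $D\le\mathrm{poly}(d,k,R)$, the running time is $\mathrm{poly}(d,k,R,1/\varepsilon)$. -/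

import Mathlib

open scoped BigOperators

namespace PhiEq

/-! ### Concave games, deviations and equilibria -/

/-- Euclidean space `ℝ^d` with the `ℓ₂` norm. -/
abbrev Vec (d : ℕ) : Type := EuclideanSpace ℝ (Fin d)

/-- Points of `ℝ^{d_1} × ⋯ × ℝ^{d_n}`. -/
abbrev Profile {n : ℕ} (d : Fin n → ℕ) : Type := (i : Fin n) → Vec (d i)

/-- An `n`-player concave game. Utilities are total functions of which only the values on the
product `X_1 × ⋯ × X_n` of the strategy sets matter. -/
structure ConcaveGame (n : ℕ) where
  /-- dimensions of the strategy sets -/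
  d : Fin n → ℕ
  /-- strategy sets -/
  X : (i : Fin n) → Set (Vec (d i))
  /-- utilities -/
  u : Fin n → Profile d → ℝ
  convex_X : ∀ i, Convex ℝ (X i)
  compact_X : ∀ i, IsCompact (X i)
  u_mem : ∀ i, ∀ x : Profile d, (∀ j, x j ∈ X j) → u i x ∈ Set.Icc (0 : ℝ) 1
  concave_u : ∀ i, ∀ x : Profile d, (∀ j, x j ∈ X j) →
    ConcaveOn ℝ (X i) (fun y => u i (Function.update x i y))

namespace ConcaveGame

/-- The set `X_1 × ⋯ × X_n` of strategy profiles. -/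
def profiles {n : ℕ} (Γ : ConcaveGame n) : Set (Profile Γ.d) :=
  {x | ∀ i, x i ∈ Γ.X i}

end ConcaveGame

/-- A finitely supported probability distribution, given by a list of points with their
probabilities. -/
structure FinDist (α : Type*) where
  size : ℕ
  weight : Fin size → ℝ
  point : Fin size → α
  weight_nonneg : ∀ j, 0 ≤ weight j
  weight_sum : ∑ j, weight j = 1

/-- The expectation `E_{x ∼ μ} f(x)`. -/
noncomputable def FinDist.expect {α : Type*} (μ : FinDist α) (f : α → ℝ) : ℝ :=
  ∑ j, μ.weight j * f (μ.point j)

/-- `μ ∈ Δ(S)`. -/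
def FinDist.SupportedOn {α : Type*} (μ : FinDist α) (S : Set α) : Prop :=
  ∀ j, μ.point j ∈ S

/-- The matrix `K` represents `φ` on `X` through the feature map `m`: `φ(x) = K m(x)`. -/
def Represents {d k : ℕ} (X : Set (Vec d)) (m : Vec d → Fin k → ℝ)
    (K : Matrix (Fin d) (Fin k) ℝ) (φ : Vec d → Vec d) : Prop :=
  ∀ x ∈ X, ∀ c, φ x c = K.mulVec (m x) c

/-- `Φ_m`: all maps `X → X` of the form `x ↦ K m(x)` (as total functions, of which only the
restriction to `X` matters). -/
def phiSet {d k : ℕ} (X : Set (Vec d)) (m : Vec d → Fin k → ℝ) : Set (Vec d → Vec d) :=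
  {φ | Set.MapsTo φ X X ∧ ∃ K : Matrix (Fin d) (Fin k) ℝ, Represents X m K φ}

/-- `μ` is an `ε`-approximate `Φ`-equilibrium of `Γ`. -/
def IsApproxEquilibrium {n : ℕ} (Γ : ConcaveGame n)
    (Φ : (i : Fin n) → Set (Vec (Γ.d i) → Vec (Γ.d i))) (ε : ℝ)
    (μ : FinDist (Profile Γ.d)) : Prop :=
  μ.SupportedOn Γ.profiles ∧
    ∀ i, ∀ φ ∈ Φ i,
      μ.expect (fun x => Γ.u i (Function.update x i (φ (x i))) - Γ.u i x) ≤ ε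

/-- The quantitative bound `D` on the feature map `m` on `X`: its entries are at most `D` in
absolute value, and every map in `Φ_m` has a representing matrix of Frobenius norm at most `D`. -/
def FeatureBound {d k : ℕ} (X : Set (Vec d)) (m : Vec d → Fin k → ℝ) (D : ℝ) : Prop :=
  (∀ x ∈ X, ∀ j, |m x j| ≤ D) ∧
    ∀ φ ∈ phiSet X m, ∃ K : Matrix (Fin d) (Fin k) ℝ,
      Represents X m K φ ∧ ∑ c, ∑ j, K c j ^ 2 ≤ D ^ 2

/-! ### Black-box access -/

/-- The oracles available to an algorithm. -/
structure Oracles {n : ℕ} (d k : Fin n → ℕ) where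
  /-- separation oracle: `none` means "inside", `some (a, b)` is the hyperplane `⟪a, z⟫ = b` -/
  sep : (i : Fin n) → Vec (d i) → Option (Vec (d i) × ℝ)
  /-- utility evaluation -/
  util : Fin n → Profile d → ℝ
  /-- supergradient of player `i`'s utility with respect to her own strategy -/
  grad : (i : Fin n) → Profile d → Vec (d i)
  /-- feature map evaluation -/
  feat : (i : Fin n) → Vec (d i) → Fin (k i) → ℝ

/-- The promises on the oracles. Answers to utility, supergradient and feature queries at points
outside the strategy sets are arbitrary. -/
structure Oracles.Correct {n : ℕ} (Γ : ConcaveGame n) {k : Fin n → ℕ}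
    (m : (i : Fin n) → Vec (Γ.d i) → Fin (k i) → ℝ) (O : Oracles Γ.d k) : Prop where
  sep_mem : ∀ i, ∀ x ∈ Γ.X i, O.sep i x = none
  sep_not_mem : ∀ i, ∀ x ∉ Γ.X i, ∃ a b, O.sep i x = some (a, b) ∧
    b < inner ℝ a x ∧ ∀ z ∈ Γ.X i, inner ℝ a z ≤ b
  util_eq : ∀ i, ∀ x ∈ Γ.profiles, O.util i x = Γ.u i x
  grad_norm : ∀ i, ∀ x ∈ Γ.profiles, ‖O.grad i x‖ ≤ 1
  grad_super : ∀ i, ∀ x ∈ Γ.profiles, ∀ y ∈ Γ.X i,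
    Γ.u i (Function.update x i y) ≤ Γ.u i x + inner ℝ (O.grad i x) (y - x i)
  feat_eq : ∀ i, ∀ x ∈ Γ.X i, O.feat i x = m i x

/-! ### The real RAM -/

/-- Memory: an array of natural numbers (for control and addressing) and an array of reals. -/
structure Mem where
  nat : ℕ → ℕ
  real : ℕ → ℝ

/-- Natural-number expressions; `mem a` is the content of the natural-number cell at address `a`. -/
inductive NExp : Type
  | const : ℕ → NExp
  | mem : NExp → NExp
  | add : NExp → NExp → NExp
  | sub : NExp → NExp → NExp
  | mul : NExp → NExp → NExp

namespace NExp

def eval (s : Mem) : NExp → ℕ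
  | const c => c
  | mem a => s.nat (a.eval s)
  | add a b => a.eval s + b.eval s
  | sub a b => a.eval s - b.eval s
  | mul a b => a.eval s * b.eval s

/-- Number of unit-time operations. -/
def cost : NExp → ℕ
  | const _ => 1
  | mem a => a.cost + 1
  | add a b => a.cost + b.cost + 1
  | sub a b => a.cost + b.cost + 1
  | mul a b => a.cost + b.cost + 1

end NExp

/-- Real expressions; `mem a` is the content of the real cell at address `a`. The only real
constants are natural numbers. -/
inductive RExp : Type
  | ofNat : NExp → RExp
  | mem : NExp → RExp
  | add : RExp → RExp → RExp
  | sub : RExp → RExp → RExp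
  | mul : RExp → RExp → RExp
  | div : RExp → RExp → RExp

namespace RExp

noncomputable def eval (s : Mem) : RExp → ℝ
  | ofNat a => (a.eval s : ℝ)
  | mem a => s.real (a.eval s)
  | add a b => a.eval s + b.eval s
  | sub a b => a.eval s - b.eval s
  | mul a b => a.eval s * b.eval s
  | div a b => a.eval s / b.eval s

/-- Number of unit-time operations. -/
def cost : RExp → ℕ
  | ofNat a => a.cost + 1
  | mem a => a.cost + 1
  | add a b => a.cost + b.cost + 1
  | sub a b => a.cost + b.cost + 1
  | mul a b => a.cost + b.cost + 1
  | div a b => a.cost + b.cost + 1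

end RExp

/-- Tests. -/
inductive BExp : Type
  | nlt : NExp → NExp → BExp
  | rlt : RExp → RExp → BExp
  | not : BExp → BExp
  | and : BExp → BExp → BExp

namespace BExp

def holds (s : Mem) : BExp → Prop
  | nlt a b => a.eval s < b.eval s
  | rlt a b => a.eval s < b.eval s
  | not a => ¬ a.holds s
  | and a b => a.holds s ∧ b.holds s

/-- Number of unit-time operations. -/
def cost : BExp → ℕ
  | nlt a b => a.cost + b.cost + 1
  | rlt a b => a.cost + b.cost + 1
  | not a => a.cost + 1
  | and a b => a.cost + b.cost + 1

end BExp

/-- Programs for `n`-player games. In the oracle calls, `src` is the address where the query point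
is stored and `dst` the address where the answer is to be written; `sep` also reports in the
natural-number cell `flag` whether the query point is inside. -/
inductive Prog (n : ℕ) : Type
  | skip : Prog n
  | nset (dst : NExp) (e : NExp) : Prog n
  | rset (dst : NExp) (e : RExp) : Prog n
  | seq : Prog n → Prog n → Prog n
  | ite : BExp → Prog n → Prog n → Prog n
  | loop : BExp → Prog n → Prog n
  | sep (i : Fin n) (src dst flag : NExp) : Prog n
  | util (i : Fin n) (src dst : NExp) : Prog n
  | grad (i : Fin n) (src dst : NExp) : Prog n
  | feat (i : Fin n) (src dst : NExp) : Prog n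

namespace Mem

/-- The vector stored in the cells `a, …, a + d - 1`. -/
noncomputable def readVec (s : Mem) (d a : ℕ) : Vec d :=
  WithLp.toLp 2 (fun c : Fin d => s.real (a + c))

/-- Start of block `i` in the concatenation of blocks of lengths `d_1, …, d_n`. -/
def offset {n : ℕ} (d : Fin n → ℕ) (i : Fin n) : ℕ := ∑ j ∈ Finset.Iio i, d j

/-- The profile stored, blocks concatenated, in the cells `a, …, a + ∑ i, d i - 1`. -/
noncomputable def readProfile {n : ℕ} (s : Mem) (d : Fin n → ℕ) (a : ℕ) : Profile d :=
  fun i => s.readVec (d i) (a + offset d i)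

def setNat (s : Mem) (a v : ℕ) : Mem := { s with nat := Function.update s.nat a v }

def setReal (s : Mem) (a : ℕ) (v : ℝ) : Mem := { s with real := Function.update s.real a v }

/-- Write `v` into the cells `a, …, a + d - 1`. -/
def writeVec (s : Mem) {d : ℕ} (a : ℕ) (v : Fin d → ℝ) : Mem :=
  { s with real := fun b => if h : a ≤ b ∧ b < a + d then v ⟨b - a, by omega⟩ else s.real b }

/-- Record the answer of a separation oracle: inside, the flag is set to `1`; outside, it is set
to `0` and the normal vector, followed by the offset, is written at `dst`. -/
def writeSep (s : Mem) {d : ℕ} (dst flag : ℕ) : Option (Vec d × ℝ) → Mem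
  | none => s.setNat flag 1
  | some (a, b) => ((s.setNat flag 0).writeVec dst (fun c => a c)).setReal (dst + d) b

end Mem

/-- `Exec O P s t s'`: run with the oracles `O` from memory `s`, the program `P` halts in memory
`s'` after exactly `t` time units. An arithmetic operation, comparison or memory access takes one
unit; an oracle call takes one unit plus one per real number transferred. -/
inductive Exec {n : ℕ} {d k : Fin n → ℕ} (O : Oracles d k) : Prog n → Mem → ℕ → Mem → Prop
  | skip (s : Mem) : Exec O .skip s 1 s
  | nset (s : Mem) (a e : NExp) :
      Exec O (.nset a e) s (a.cost + e.cost + 1) (s.setNat (a.eval s) (e.eval s))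
  | rset (s : Mem) (a : NExp) (e : RExp) :
      Exec O (.rset a e) s (a.cost + e.cost + 1) (s.setReal (a.eval s) (e.eval s))
  | seq {P Q : Prog n} {s s' s'' : Mem} {t t' : ℕ} :
      Exec O P s t s' → Exec O Q s' t' s'' → Exec O (.seq P Q) s (t + t') s''
  | ite_true {b : BExp} {P Q : Prog n} {s s' : Mem} {t : ℕ} :
      b.holds s → Exec O P s t s' → Exec O (.ite b P Q) s (b.cost + t + 1) s'
  | ite_false {b : BExp} {P Q : Prog n} {s s' : Mem} {t : ℕ} :
      ¬ b.holds s → Exec O Q s t s' → Exec O (.ite b P Q) s (b.cost + t + 1) s'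
  | loop_done {b : BExp} {P : Prog n} {s : Mem} :
      ¬ b.holds s → Exec O (.loop b P) s (b.cost + 1) s
  | loop_step {b : BExp} {P : Prog n} {s s' s'' : Mem} {t t' : ℕ} :
      b.holds s → Exec O P s t s' → Exec O (.loop b P) s' t' s'' →
        Exec O (.loop b P) s (b.cost + t + t' + 1) s''
  | sep (s : Mem) (i : Fin n) (src dst flag : NExp) :
      Exec O (.sep i src dst flag) s
        (src.cost + dst.cost + flag.cost + (2 * d i + 1) + 1)
        (s.writeSep (dst.eval s) (flag.eval s) (O.sep i (s.readVec (d i) (src.eval s))))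
  | util (s : Mem) (i : Fin n) (src dst : NExp) :
      Exec O (.util i src dst) s (src.cost + dst.cost + (∑ j, d j + 1) + 1)
        (s.setReal (dst.eval s) (O.util i (s.readProfile d (src.eval s))))
  | grad (s : Mem) (i : Fin n) (src dst : NExp) :
      Exec O (.grad i src dst) s (src.cost + dst.cost + (∑ j, d j + d i) + 1)
        (s.writeVec (dst.eval s) (fun c => O.grad i (s.readProfile d (src.eval s)) c))
  | feat (s : Mem) (i : Fin n) (src dst : NExp) :
      Exec O (.feat i src dst) s (src.cost + dst.cost + (d i + k i) + 1)
        (s.writeVec (dst.eval s) (O.feat i (s.readVec (d i) (src.eval s))))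

/-- Initial memory: natural-number cells `0, …, 2n - 1` hold `d_1, …, d_n, k_1, …, k_n`, real
cells `0, 1, 2` hold `ε, R, D`, everything else is `0`. -/
def initMem {n : ℕ} (d k : Fin n → ℕ) (ε R D : ℝ) : Mem where
  nat a := if h : a < n then d ⟨a, h⟩ else if h : a - n < n then k ⟨a - n, h⟩ else 0
  real a := if a = 0 then ε else if a = 1 then R else if a = 2 then D else 0

/-- The memory holds the distribution `μ`: natural-number cell `0` holds the number of listed
points, and the `j`-th block of `1 + ∑ i, d i` real cells holds the probability and the
coordinates of the `j`-th point. -/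
def Outputs {n : ℕ} {d : Fin n → ℕ} (s : Mem) (μ : FinDist (Profile d)) : Prop :=
  s.nat 0 = μ.size ∧
    ∀ j : Fin μ.size,
      s.real (j * (1 + ∑ i, d i)) = μ.weight j ∧
        s.readProfile d (j * (1 + ∑ i, d i) + 1) = μ.point j

end PhiEq

/-! Every player keeps a matrix `K`, started at 0, which need not map her strategy set `X` into
itself. Fix an integer `M ≥ 3/ε`. A round iterates `x_0 = 0`, `x_{l+1} = K m(x_l)`. Suppose first
that `x_0, …, x_M` stay in `X` for all players. The round then outputs all `M^n` profiles in which
each player i independently plays her point number `ℓ_i < M`. With the opponents' points fixed, the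
gain from playing `K m(x_l)` instead of `x_l` telescopes along the trajectory, so its average is at
most `1/M` (`telescope`). The orbit average thus replaces a fixed point of the deviation `K`, and it
only remains to see that no admissible `K'` does much better than `K`. This is online gradient
ascent on matrices, with supergradients taken at `K m(x_l)` (`gradient_step`, `round_regret`).

If some `x_{l+1}` leaves `X`, a separating hyperplane `⟪a, ·⟫ = b` gives `⟪a mᵀ, K⟫ > b`, whereas
every `K'` mapping `X` into `X` has `⟪a mᵀ, K'⟫ ≤ b`. Regret is measured against `(1 - 1/M) K'`; by
concavity and `0 ∈ X` this costs only `1/M` in utility. The shrunk comparator satisfies the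
inequality with slack `b/M`, and `‖a‖ ≤ b` because `X` contains the unit ball. Hence a suitable step
along `-a mᵀ` lowers the squared distance to all shrunk comparators at once by `1/(M² B)`, where `B`
bounds `‖m‖²` (`cut_step`). Cuts therefore never hurt the regret bound, and the trajectory is
restarted after each one.

The comparator 0 shows that a cut also lowers `‖K‖²` by `1/(M² B)`, while the gradient step of a
round raises it by at most `2R + 1` (`norm_gradient_step_sq_le`). This bounds the number of cuts
polynomially (`trajVariant`, `traj_runs`). After `T = B D² M²` rounds the average gain of any
deviation is at most `5/(2M) + B M D²/(2T) = 3/M ≤ ε` (`MainInv.exists_equilibrium`), and the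
support has `T M^n` points, polynomially many for fixed `n`.

The remaining work realises this on the machine. `Runs` is a total-correctness triple with a time
bound; each program gets a bound polynomial in one size parameter `W`, and `size_le` bounds the `W`
of a run. The program never reads `R`, which enters only the time bound. -/

namespace PhiEq

/-! ### Polynomially bounded functions -/

/-- `f` is bounded by a monomial on the positive integers. -/
def IsPoly (f : ℕ → ℕ) : Prop := ∃ c e : ℕ, ∀ W, 1 ≤ W → f W ≤ c * W ^ e

namespace IsPoly

theorem const (c : ℕ) : IsPoly (fun _ => c) := ⟨c, 0, fun W _ => by simp⟩

theorem id : IsPoly (fun W => W) := ⟨1, 1, fun W _ => by simp⟩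

theorem add {f g : ℕ → ℕ} (hf : IsPoly f) (hg : IsPoly g) : IsPoly (fun W => f W + g W) := by
  obtain ⟨c, e, hf⟩ := hf
  obtain ⟨c', e', hg⟩ := hg
  refine ⟨c + c', e + e', fun W hW => ?_⟩
  have h1 : W ^ e ≤ W ^ (e + e') := Nat.pow_le_pow_right hW (by omega)
  have h2 : W ^ e' ≤ W ^ (e + e') := Nat.pow_le_pow_right hW (by omega)
  calc f W + g W ≤ c * W ^ e + c' * W ^ e' := Nat.add_le_add (hf W hW) (hg W hW)
    _ ≤ c * W ^ (e + e') + c' * W ^ (e + e') :=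
        Nat.add_le_add (Nat.mul_le_mul_left _ h1) (Nat.mul_le_mul_left _ h2)
    _ = _ := by ring

theorem mul {f g : ℕ → ℕ} (hf : IsPoly f) (hg : IsPoly g) : IsPoly (fun W => f W * g W) := by
  obtain ⟨c, e, hf⟩ := hf
  obtain ⟨c', e', hg⟩ := hg
  refine ⟨c * c', e + e', fun W hW => ?_⟩
  calc f W * g W ≤ (c * W ^ e) * (c' * W ^ e') := Nat.mul_le_mul (hf W hW) (hg W hW)
    _ = _ := by ring

end IsPoly

/-! ### Elementary facts on memories -/

namespace Mem

@[simp] theorem setNat_nat (s : Mem) (a v b : ℕ) :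
    (s.setNat a v).nat b = if b = a then v else s.nat b := by
  simp [setNat, Function.update_apply]

@[simp] theorem setNat_real (s : Mem) (a v : ℕ) : (s.setNat a v).real = s.real := rfl

@[simp] theorem setReal_nat (s : Mem) (a : ℕ) (v : ℝ) : (s.setReal a v).nat = s.nat := rfl

@[simp] theorem setReal_real (s : Mem) (a : ℕ) (v : ℝ) (b : ℕ) :
    (s.setReal a v).real b = if b = a then v else s.real b := by
  simp [setReal, Function.update_apply]

@[simp] theorem writeVec_nat (s : Mem) {d : ℕ} (a : ℕ) (v : Fin d → ℝ) :
    (s.writeVec a v).nat = s.nat := rfl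

theorem writeVec_real_of_lt (s : Mem) {d : ℕ} (a : ℕ) (v : Fin d → ℝ) (c : Fin d) :
    (s.writeVec a v).real (a + c) = v c := by
  have h : a ≤ a + (c : ℕ) ∧ a + (c : ℕ) < a + d := ⟨by omega, by omega⟩
  simp [writeVec]

theorem writeVec_real_of_notMem (s : Mem) {d : ℕ} (a : ℕ) (v : Fin d → ℝ) {b : ℕ}
    (hb : b < a ∨ a + d ≤ b) : (s.writeVec a v).real b = s.real b := by
  have h : ¬ (a ≤ b ∧ b < a + d) := by omega
  simp only [writeVec, dif_neg h]

end Mem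

/-- The memories agree on the natural-number cells below `h`. -/
def NatEq (h : ℕ) (s s' : Mem) : Prop := ∀ a < h, s'.nat a = s.nat a

theorem NatEq.refl (h : ℕ) (s : Mem) : NatEq h s s := fun _ _ => rfl

theorem NatEq.trans {h : ℕ} {s s' s'' : Mem} (h₁ : NatEq h s s') (h₂ : NatEq h s' s'') :
    NatEq h s s'' := fun a ha => (h₂ a ha).trans (h₁ a ha)

theorem NatEq.mono {h h' : ℕ} {s s' : Mem} (h₁ : NatEq h s s') (hh : h' ≤ h) : NatEq h' s s' :=
  fun a ha => h₁ a (ha.trans_le hh)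

/-- Variables of inner programs sit at higher addresses than those of outer ones, so agreement below
a threshold is all that an enclosing loop needs to know about its body. -/
theorem NatEq.setNat {h : ℕ} {s s' : Mem} (h₁ : NatEq h s s') {a v : ℕ} (ha : h ≤ a) :
    NatEq h s (s'.setNat a v) := fun b hb => by
  rw [Mem.setNat_nat, if_neg (by omega), h₁ b hb]

theorem NatEq.setReal {h : ℕ} {s s' : Mem} (h₁ : NatEq h s s') {a : ℕ} {v : ℝ} :
    NatEq h s (s'.setReal a v) := h₁

/-! ### Expressions -/

instance : Add NExp := ⟨NExp.add⟩
instance : Mul NExp := ⟨NExp.mul⟩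
instance : Add RExp := ⟨RExp.add⟩
instance : Sub RExp := ⟨RExp.sub⟩
instance : Mul RExp := ⟨RExp.mul⟩
instance : Div RExp := ⟨RExp.div⟩

/-- The natural-number variable stored in cell `a`. -/
def NExp.var (a : ℕ) : NExp := .mem (.const a)

namespace NExp

@[simp] theorem eval_const (s : Mem) (c : ℕ) : (const c).eval s = c := rfl
@[simp] theorem eval_var (s : Mem) (a : ℕ) : (var a).eval s = s.nat a := rfl
@[simp] theorem eval_add (s : Mem) (a b : NExp) : (a + b).eval s = a.eval s + b.eval s := rfl
@[simp] theorem eval_mul (s : Mem) (a b : NExp) : (a * b).eval s = a.eval s * b.eval s := rfl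
@[simp] theorem eval_sub (s : Mem) (a b : NExp) : (sub a b).eval s = a.eval s - b.eval s := rfl
@[simp] theorem cost_const (c : ℕ) : (const c).cost = 1 := rfl
@[simp] theorem cost_var (a : ℕ) : (var a).cost = 2 := rfl
@[simp] theorem cost_add (a b : NExp) : (a + b).cost = a.cost + b.cost + 1 := rfl
@[simp] theorem cost_mul (a b : NExp) : (a * b).cost = a.cost + b.cost + 1 := rfl
@[simp] theorem cost_sub (a b : NExp) : (sub a b).cost = a.cost + b.cost + 1 := rfl

/-- The sum of a list of expressions. -/
def sum : List NExp → NExp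
  | [] => const 0
  | a :: l => a + sum l

theorem eval_sum (s : Mem) (l : List NExp) : (sum l).eval s = (l.map (eval s)).sum := by
  induction l with
  | nil => rfl
  | cons a l ih => simp [sum, ih]

/-- The power `a ^ r`. -/
def pow (a : NExp) : ℕ → NExp
  | 0 => const 1
  | r + 1 => pow a r * a

@[simp] theorem eval_pow (s : Mem) (a : NExp) (r : ℕ) : (pow a r).eval s = a.eval s ^ r := by
  induction r with
  | zero => rfl
  | succ r ih => simp [pow, ih, _root_.pow_succ]

end NExp

namespace RExp

@[simp] theorem eval_ofNat (s : Mem) (a : NExp) : (ofNat a).eval s = (a.eval s : ℝ) := rfl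
@[simp] theorem eval_mem (s : Mem) (a : NExp) : (mem a).eval s = s.real (a.eval s) := rfl
@[simp] theorem eval_add (s : Mem) (a b : RExp) : (a + b).eval s = a.eval s + b.eval s := rfl
@[simp] theorem eval_sub (s : Mem) (a b : RExp) : (a - b).eval s = a.eval s - b.eval s := rfl
@[simp] theorem eval_mul (s : Mem) (a b : RExp) : (a * b).eval s = a.eval s * b.eval s := rfl
@[simp] theorem eval_div (s : Mem) (a b : RExp) : (a / b).eval s = a.eval s / b.eval s := rfl
@[simp] theorem cost_ofNat (a : NExp) : (ofNat a).cost = a.cost + 1 := rfl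
@[simp] theorem cost_mem (a : NExp) : (mem a).cost = a.cost + 1 := rfl
@[simp] theorem cost_add (a b : RExp) : (a + b).cost = a.cost + b.cost + 1 := rfl
@[simp] theorem cost_sub (a b : RExp) : (a - b).cost = a.cost + b.cost + 1 := rfl
@[simp] theorem cost_mul (a b : RExp) : (a * b).cost = a.cost + b.cost + 1 := rfl
@[simp] theorem cost_div (a b : RExp) : (a / b).cost = a.cost + b.cost + 1 := rfl

end RExp

@[simp] theorem BExp.holds_nlt (s : Mem) (a b : NExp) :
    (BExp.nlt a b).holds s ↔ a.eval s < b.eval s := Iff.rfl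

@[simp] theorem BExp.holds_rlt (s : Mem) (a b : RExp) :
    (BExp.rlt a b).holds s ↔ a.eval s < b.eval s := Iff.rfl

/-! ### Total correctness with running times -/

/-- Started in `s`, the program `P` halts within `T` steps in a memory satisfying `Q`. -/
def Runs {n : ℕ} {d k : Fin n → ℕ} (O : Oracles d k) (P : Prog n) (s : Mem) (T : ℕ)
    (Q : Mem → Prop) : Prop :=
  ∃ t r, Exec O P s t r ∧ t ≤ T ∧ Q r

/-- `for v := 0, …, e - 1 do body`. -/
def Prog.forN {n : ℕ} (v : ℕ) (e : NExp) (body : Prog n) : Prog n :=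
  .seq (.nset (.const v) (.const 0))
    (.loop (.nlt (.var v) e) (.seq body (.nset (.const v) (.var v + .const 1))))

/-- Sequential composition of a list of programs. -/
def Prog.seqs {n : ℕ} : List (Prog n) → Prog n
  | [] => .skip
  | P :: l => .seq P (seqs l)

namespace Runs

variable {n : ℕ} {d k : Fin n → ℕ} {O : Oracles d k}

theorem mono {P : Prog n} {s : Mem} {T T' : ℕ} {Q Q' : Mem → Prop} (h : Runs O P s T Q)
    (hT : T ≤ T') (hQ : ∀ s', Q s' → Q' s') : Runs O P s T' Q' := by
  obtain ⟨t, s', h₁, h₂, h₃⟩ := h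
  exact ⟨t, s', h₁, h₂.trans hT, hQ s' h₃⟩

theorem skip {s : Mem} {Q : Mem → Prop} (hQ : Q s) : Runs O .skip s 1 Q :=
  ⟨_, _, .skip s, le_rfl, hQ⟩

theorem seq {P P' : Prog n} {s : Mem} {T T' : ℕ} {Q Q' : Mem → Prop} (h : Runs O P s T Q)
    (h' : ∀ s', Q s' → Runs O P' s' T' Q') : Runs O (.seq P P') s (T + T') Q' := by
  obtain ⟨t, s', h₁, h₂, h₃⟩ := h
  obtain ⟨t', s'', h₁', h₂', h₃'⟩ := h' s' h₃
  exact ⟨_, _, .seq h₁ h₁', Nat.add_le_add h₂ h₂', h₃'⟩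

theorem nset {s : Mem} {a e : NExp} {Q : Mem → Prop} (hQ : Q (s.setNat (a.eval s) (e.eval s))) :
    Runs O (.nset a e) s (a.cost + e.cost + 1) Q :=
  ⟨_, _, .nset s a e, le_rfl, hQ⟩

theorem rset {s : Mem} {a : NExp} {e : RExp} {Q : Mem → Prop}
    (hQ : Q (s.setReal (a.eval s) (e.eval s))) :
    Runs O (.rset a e) s (a.cost + e.cost + 1) Q :=
  ⟨_, _, .rset s a e, le_rfl, hQ⟩

theorem ite {b : BExp} {P P' : Prog n} {s : Mem} {T : ℕ} {Q : Mem → Prop}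
    (h : b.holds s → Runs O P s T Q) (h' : ¬ b.holds s → Runs O P' s T Q) :
    Runs O (.ite b P P') s (b.cost + T + 1) Q := by
  by_cases hb : b.holds s
  · obtain ⟨t, s', h₁, h₂, h₃⟩ := h hb
    exact ⟨_, _, .ite_true hb h₁, by omega, h₃⟩
  · obtain ⟨t, s', h₁, h₂, h₃⟩ := h' hb
    exact ⟨_, _, .ite_false hb h₁, by omega, h₃⟩

/-- A loop whose body decreases a natural-number valued variant. -/
theorem loop {b : BExp} {P : Prog n} (I : Mem → Prop) (μ : Mem → ℕ) (T : ℕ)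
    (hb : ∀ s, I s → b.holds s → Runs O P s T (fun s' => I s' ∧ μ s' < μ s)) (s : Mem)
    (hs : I s) :
    Runs O (.loop b P) s (μ s * (T + b.cost + 1) + b.cost + 1)
      (fun s' => I s' ∧ ¬ b.holds s') := by
  induction hm : μ s using Nat.strong_induction_on generalizing s with
  | _ r ih =>
    by_cases hbs : b.holds s
    · obtain ⟨t, s', h₁, h₂, h₃, h₄⟩ := hb s hs hbs
      obtain ⟨t', s'', h₁', h₂', h₃'⟩ := ih (μ s') (hm ▸ h₄) s' h₃ rfl
      refine ⟨_, _, .loop_step hbs h₁ h₁', ?_, h₃'⟩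
      have : (μ s' + 1) * (T + b.cost + 1) ≤ r * (T + b.cost + 1) :=
        Nat.mul_le_mul_right _ (by omega)
      rw [Nat.add_mul] at this
      omega
    · exact ⟨_, _, .loop_done hbs, by omega, hs, hbs⟩

/-- The limit `e` is evaluated afresh at every test, hence `he`: the invariant must pin its value.
The invariant for `j + 1` is demanded after the counter has been increased. -/
theorem forN {v : ℕ} {e : NExp} {P : Prog n} {s : Mem} (B T : ℕ) (I : ℕ → Mem → Prop)
    (h0 : I 0 (s.setNat v 0)) (he : ∀ j s', I j s' → e.eval s' = B)
    (hP : ∀ j < B, ∀ s', I j s' → s'.nat v = j →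
      Runs O P s' T (fun s'' => s''.nat v = j ∧ I (j + 1) (s''.setNat v (j + 1)))) :
    Runs O (Prog.forN v e P) s (B * (T + e.cost + 12) + e.cost + 12) (I B) := by
  have key := Runs.loop (O := O) (b := .nlt (.var v) e)
    (P := .seq P (.nset (.const v) (.var v + .const 1)))
    (fun s' => ∃ j ≤ B, s'.nat v = j ∧ I j s') (fun s' => B - s'.nat v) (T + 6) (by
      rintro s' ⟨j, hj, hv, hI⟩ hlt
      have hB := he j s' hI
      simp only [BExp.holds_nlt, NExp.eval_var, hv, hB] at hlt
      refine (Runs.seq (hP j hlt s' hI hv) (T' := 6) ?_)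
      rintro s'' ⟨hv', hI'⟩
      refine Runs.nset ?_
      simp only [NExp.eval_const, NExp.eval_add, NExp.eval_var, hv', Mem.setNat_nat, if_true, hv]
      exact ⟨⟨j + 1, hlt, rfl, hI'⟩, by omega⟩) (s.setNat v 0)
    ⟨0, Nat.zero_le _, by simp, h0⟩
  have h2 : Runs O (Prog.forN v e P) s _ _ :=
    Runs.seq (Runs.nset (Q := fun s' => s' = s.setNat v 0) (by simp)) (by rintro _ rfl; exact key)
  refine h2.mono ?_ ?_
  · have : (BExp.nlt (.var v) e).cost = e.cost + 3 := by
      simp [BExp.cost, NExp.var, NExp.cost]; omega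
    simp only [this, Mem.setNat_nat, if_true, NExp.cost, Nat.sub_zero]
    have : B * (T + 6 + (e.cost + 3) + 1) ≤ B * (T + e.cost + 12) :=
      Nat.mul_le_mul_left _ (by omega)
    omega
  · rintro s' ⟨⟨j, hj, hv, hI⟩, hn⟩
    have hB := he j s' hI
    simp only [BExp.holds_nlt, NExp.eval_var, hv, hB] at hn
    obtain rfl : j = B := by omega
    exact hI

/-- A loop whose `c`-th pass fills the `c`-th block of `w` consecutive real cells. -/
theorem forBlocks {v : ℕ} {e : NExp} {P : Prog n} {s : Mem} {B w a T : ℕ} {f : ℕ → ℝ}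
    (he : ∀ s', NatEq v s s' → e.eval s' = B)
    (hP : ∀ c < B, ∀ s', NatEq v s s' → s'.nat v = c →
      (∀ b, b < a ∨ a + c * w ≤ b → s'.real b = s.real b) →
      Runs O P s' T (fun s'' => NatEq (v + 1) s' s'' ∧
        (∀ j < w, s''.real (a + c * w + j) = f (c * w + j)) ∧
        ∀ b, b < a + c * w ∨ a + (c + 1) * w ≤ b → s''.real b = s'.real b)) :
    Runs O (Prog.forN v e P) s (B * (T + e.cost + 12) + e.cost + 12) (fun s' => NatEq v s s' ∧
      (∀ j < B * w, s'.real (a + j) = f j) ∧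
      ∀ b, b < a ∨ a + B * w ≤ b → s'.real b = s.real b) := by
  refine Runs.forN B T (fun c s' => NatEq v s s' ∧ (∀ j < c * w, s'.real (a + j) = f j) ∧
      ∀ b, b < a ∨ a + c * w ≤ b → s'.real b = s.real b) ?_ ?_ ?_
  · exact ⟨(NatEq.refl v s).setNat le_rfl, by simp, by simp⟩
  · exact fun j s' h => he s' h.1
  · rintro c hc s' ⟨h₁, h₂, h₃⟩ hv
    refine (hP c hc s' h₁ hv h₃).mono le_rfl ?_
    rintro s'' ⟨g₁, g₂, g₃⟩
    have hw : (c + 1) * w = c * w + w := by ring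
    refine ⟨(g₁ v (by omega)).trans hv, ?_, ?_, ?_⟩
    · exact (h₁.trans (g₁.mono (by omega))).setNat le_rfl
    · intro j hj
      rw [Mem.setNat_real]
      by_cases hjc : j < c * w
      · rw [g₃ _ (by omega), h₂ j hjc]
      · have := g₂ (j - c * w) (by omega)
        rwa [show a + c * w + (j - c * w) = a + j by omega,
          show c * w + (j - c * w) = j by omega] at this
    · intro b hb
      rw [Mem.setNat_real, g₃ b (by omega), h₃ b (by omega)]

/-- A loop filling consecutive real cells. -/
theorem forStore {v : ℕ} {e dst : NExp} {ρ : RExp} {s : Mem} {B a : ℕ} {f : ℕ → ℝ}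
    (he : ∀ s', NatEq v s s' → e.eval s' = B)
    (hd : ∀ s', NatEq v s s' → dst.eval s' = a)
    (hρ : ∀ c < B, ∀ s', NatEq v s s' → s'.nat v = c →
      (∀ b, b < a ∨ a + c ≤ b → s'.real b = s.real b) → ρ.eval s' = f c) :
    Runs O (Prog.forN v e (.rset (dst + .var v) ρ)) s
      (B * (dst.cost + ρ.cost + e.cost + 20) + e.cost + 12) (fun s' => NatEq v s s' ∧
      (∀ j < B, s'.real (a + j) = f j) ∧
      ∀ b, b < a ∨ a + B ≤ b → s'.real b = s.real b) := by
  refine (Runs.forBlocks (O := O) (B := B) (w := 1) (a := a) (f := f)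
    (T := (dst + .var v).cost + ρ.cost + 1) he ?_).mono ?_ ?_
  · intro c hc s' h₁ hv h₂
    refine Runs.rset ⟨NatEq.setReal (NatEq.refl _ _), ?_, ?_⟩
    · intro j hj
      obtain rfl : j = 0 := by omega
      simp only [NExp.eval_add, hd s' h₁, NExp.eval_var, hv, mul_one, add_zero, Mem.setReal_real,
        if_true]
      exact hρ c hc s' h₁ hv (by simpa using h₂)
    · intro b hb
      simp only [NExp.eval_add, hd s' h₁, NExp.eval_var, hv, Mem.setReal_real]
      rw [if_neg (by omega)]
  · have : (dst + NExp.var v).cost = dst.cost + 3 := rfl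
    rw [this]
    have : B * (dst.cost + 3 + ρ.cost + 1 + e.cost + 12) ≤ B * (dst.cost + ρ.cost + e.cost + 20) :=
      Nat.mul_le_mul_left _ (by omega)
    omega
  · simp

/-- A loop accumulating a sum in a real cell. -/
theorem forSum {v : ℕ} {e acc : NExp} {ρ : RExp} {s : Mem} {B a : ℕ} {f : ℕ → ℝ}
    (he : ∀ s', NatEq v s s' → e.eval s' = B)
    (hd : ∀ s', NatEq v s s' → acc.eval s' = a)
    (hρ : ∀ c < B, ∀ s', NatEq v s s' → s'.nat v = c →
      (∀ b, b ≠ a → s'.real b = s.real b) → ρ.eval s' = f c) :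
    Runs O (Prog.forN v e (.rset acc (.mem acc + ρ))) s
      (B * (2 * acc.cost + ρ.cost + e.cost + 20) + e.cost + 12) (fun s' => NatEq v s s' ∧
      s'.real a = s.real a + ∑ j ∈ Finset.range B, f j ∧
      ∀ b, b ≠ a → s'.real b = s.real b) := by
  refine (Runs.forN (O := O) B (acc.cost + (RExp.mem acc + ρ).cost + 1)
    (fun c s' => NatEq v s s' ∧ s'.real a = s.real a + ∑ j ∈ Finset.range c, f j ∧
      ∀ b, b ≠ a → s'.real b = s.real b) ?_ ?_ ?_).mono ?_ (fun _ h => h)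
  · exact ⟨(NatEq.refl v s).setNat le_rfl, by simp, by simp⟩
  · exact fun j s' h => he s' h.1
  · rintro c hc s' ⟨h₁, h₂, h₃⟩ hv
    refine Runs.rset ⟨hv, ?_, ?_, ?_⟩
    · exact h₁.setReal.setNat le_rfl
    · rw [Mem.setNat_real, hd s' h₁, Mem.setReal_real, if_pos rfl, Finset.sum_range_succ]
      simp only [RExp.eval_add, RExp.eval_mem, hd s' h₁, h₂, hρ c hc s' h₁ hv h₃]
      ring
    · intro b hb
      rw [Mem.setNat_real, hd s' h₁, Mem.setReal_real, if_neg hb, h₃ b hb]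
  · have : (RExp.mem acc + ρ).cost = acc.cost + 1 + ρ.cost + 1 := rfl
    rw [this]
    have : B * (acc.cost + (acc.cost + 1 + ρ.cost + 1) + 1 + e.cost + 12) ≤
      B * (2 * acc.cost + ρ.cost + e.cost + 20) :=
      Nat.mul_le_mul_left _ (by omega)
    omega

/-- Running a list of programs one after the other. -/
theorem seqs {ι : Type*} (T : ℕ) (F : ι → Prog n) (l : List ι) (I : List ι → Mem → Prop)
    (hP : ∀ l₁ i l₂, l = l₁ ++ i :: l₂ → ∀ s, I l₁ s → Runs O (F i) s T (I (l₁ ++ [i])))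
    (s : Mem) (hs : I [] s) :
    Runs O (Prog.seqs (l.map F)) s (l.length * T + 1) (I l) := by
  -- The invariant is indexed by the prefix already executed. Loops over players take this unrolled
  -- form because the player of an oracle call is part of the program text.
  suffices H : ∀ l₂ l₁, l = l₁ ++ l₂ → ∀ s, I l₁ s →
      Runs O (Prog.seqs (l₂.map F)) s (l₂.length * T + 1) (I l) from H l [] rfl s hs
  intro l₂
  induction l₂ with
  | nil =>
    intro l₁ h s hs
    have h' : l = l₁ := by simpa using h
    rw [h']
    exact (Runs.skip hs).mono (by simp) (fun _ h => h)
  | cons i l₂ ih =>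
    intro l₁ h s hs
    refine (Runs.seq (hP l₁ i l₂ h s hs) (ih (l₁ ++ [i]) (by simp [h]))).mono ?_ (fun _ h => h)
    simp only [List.length_cons]
    have : (l₂.length + 1) * T = l₂.length * T + T := by ring
    omega

end Runs

/-! ### Matrices with the Frobenius norm -/

/-- Matrices with the Frobenius norm. -/
abbrev Mat (d k : ℕ) : Type := EuclideanSpace ℝ (Fin d × Fin k)

/-- The rank-one matrix `a mᵀ`. -/
noncomputable def outer {d k : ℕ} (a : Vec d) (m : Fin k → ℝ) : Mat d k :=
  WithLp.toLp 2 (fun p => a p.1 * m p.2)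

/-- The matrix-vector product `K m`. -/
noncomputable def app {d k : ℕ} (K : Mat d k) (m : Fin k → ℝ) : Vec d :=
  WithLp.toLp 2 (fun c => ∑ j, K (c, j) * m j)

section Matrices

variable {d k : ℕ}

/-- The adjoint of `K ↦ K m` is `a ↦ a mᵀ`. Through it, separating hyperplanes and supergradients at
points become linear functionals of matrices. -/
theorem inner_outer (a : Vec d) (m : Fin k → ℝ) (K : Mat d k) :
    inner ℝ (outer a m) K = inner ℝ a (app K m) := by
  simp only [PiLp.inner_apply, outer, app, RCLike.inner_apply, conj_trivial,
    Fintype.sum_prod_type, Finset.sum_mul]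
  exact Finset.sum_congr rfl fun c _ => Finset.sum_congr rfl fun j _ => by ring

theorem norm_outer_sq (a : Vec d) (m : Fin k → ℝ) :
    ‖outer a m‖ ^ 2 = ‖a‖ ^ 2 * ∑ j, m j ^ 2 := by
  simp only [EuclideanSpace.norm_sq_eq, outer, Real.norm_eq_abs, sq_abs, Fintype.sum_prod_type,
    mul_pow, Finset.sum_mul_sum]

theorem app_smul (r : ℝ) (K : Mat d k) (m : Fin k → ℝ) : app (r • K) m = r • app K m := by
  ext c
  simp [app, Finset.mul_sum, mul_assoc]

theorem app_sub (K K' : Mat d k) (m : Fin k → ℝ) : app (K - K') m = app K m - app K' m := by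
  ext c
  simp [app, sub_mul, Finset.sum_sub_distrib]

theorem app_zero (m : Fin k → ℝ) : app (0 : Mat d k) m = 0 := by
  ext c
  simp [app]

/-- Test the inequality at the unit vector `a / ‖a‖`. This makes the progress of a cut independent
of the scaling of the oracle's answer. -/
theorem norm_le_of_support {X : Set (Vec d)} (hX : Metric.closedBall 0 1 ⊆ X) {a : Vec d} {b : ℝ}
    (h : ∀ z ∈ X, inner ℝ a z ≤ b) : ‖a‖ ≤ b := by
  by_cases ha : a = 0
  · have := h 0 (hX (by simp))
    simpa [ha] using this
  · have hn : ‖a‖ ≠ 0 := norm_ne_zero_iff.2 ha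
    have := h (‖a‖⁻¹ • a) (hX (by simp [norm_smul, hn]))
    rw [inner_smul_right, real_inner_self_eq_norm_sq] at this
    calc ‖a‖ = ‖a‖⁻¹ * ‖a‖ ^ 2 := by field_simp
      _ ≤ b := this

/-- A cut through a violated hyperplane decreases the distance to every comparator. -/
theorem cut_step {X : Set (Vec d)} (hX : Metric.closedBall 0 1 ⊆ X) {a : Vec d} {b : ℝ}
    (h : ∀ z ∈ X, inner ℝ a z ≤ b) {K K' : Mat d k} {m : Fin k → ℝ}
    (hK : b < inner ℝ a (app K m)) (hK' : app K' m ∈ X) {M B : ℝ} (hM : 1 ≤ M) (hB : 1 ≤ B)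
    (hm : ∑ j, m j ^ 2 ≤ B) :
    ‖K + (-(b / (‖a‖ ^ 2 * (M * B)))) • outer a m - (1 - 1 / M) • K'‖ ^ 2 ≤
      ‖K - (1 - 1 / M) • K'‖ ^ 2 - 1 / (M ^ 2 * B) := by
  have hab : ‖a‖ ≤ b := norm_le_of_support hX h
  -- For `a = 0` the violated inequality would say `b < 0`, against `‖a‖ ≤ b`.
  have ha : a ≠ 0 := by
    rintro rfl
    simp at hK hab
    linarith
  have hn : 0 < ‖a‖ := norm_pos_iff.2 ha
  have hb : 0 < b := hn.trans_le hab
  -- This `r` minimises the upper bound `-2 r b/M + r² ‖a‖² B` for the change of the squared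
  -- distance.
  set r := b / (‖a‖ ^ 2 * (M * B)) with hr
  have hr0 : 0 < r := by positivity
  have e1 : K + (-r) • outer a m - (1 - 1 / M) • K' =
      (K - (1 - 1 / M) • K') - r • outer a m := by module
  have hMi : 0 ≤ 1 - 1 / M := by
    have : 1 / M ≤ 1 := by rw [div_le_one (by linarith)]; exact hM
    linarith
  -- `K` exceeds `b`, and the shrunk comparator stays below `(1 - 1/M) b`; the gap `b/M` is what the
  -- shrinking buys.
  have hin : b / M ≤ inner ℝ (outer a m) (K - (1 - 1 / M) • K') := by
    rw [inner_outer, app_sub, app_smul, inner_sub_right, inner_smul_right]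
    have h2 := mul_le_mul_of_nonneg_left (h _ hK') hMi
    have : (1 - 1 / M) * b = b - b / M := by ring
    linarith
  rw [e1, norm_sub_sq_real, inner_smul_right, norm_smul, mul_pow, norm_outer_sq,
    real_inner_comm, Real.norm_eq_abs, sq_abs]
  have h3 : r * (b / M) ≤ r * inner ℝ (outer a m) (K - (1 - 1 / M) • K') :=
    mul_le_mul_of_nonneg_left hin hr0.le
  have h4 : r ^ 2 * (‖a‖ ^ 2 * ∑ j, m j ^ 2) ≤ r ^ 2 * (‖a‖ ^ 2 * B) := by gcongr
  have h5 : r ^ 2 * (‖a‖ ^ 2 * B) = r * (b / M) := by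
    rw [hr]; field_simp
  have h6 : 1 / (M ^ 2 * B) ≤ r * (b / M) := by
    have : r * (b / M) = (b ^ 2 / ‖a‖ ^ 2) * (1 / (M ^ 2 * B)) := by rw [hr]; field_simp
    rw [this]
    -- The net decrease is `(b/‖a‖)² / (M² B)`, so `‖a‖ ≤ b` finishes.
    have h7 : 1 ≤ b ^ 2 / ‖a‖ ^ 2 := by
      rw [one_le_div (by positivity)]; gcongr
    have h8 : 0 ≤ 1 / (M ^ 2 * B) := by positivity
    nlinarith
  linarith

variable {ι : Type*} [Fintype ι]

theorem norm_sum_outer_sq_le {B : ℝ} (hB : 0 ≤ B) (g : ι → Vec d) (hg : ∀ τ, ‖g τ‖ ≤ 1)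
    (f : ι → Fin k → ℝ) (hf : ∀ τ, ∑ j, f τ j ^ 2 ≤ B) :
    ‖∑ τ, outer (g τ) (f τ)‖ ^ 2 ≤ (Fintype.card ι : ℝ) ^ 2 * B := by
  have h1 : ∀ τ, ‖outer (g τ) (f τ)‖ ≤ Real.sqrt B := fun τ => by
    apply Real.le_sqrt_of_sq_le
    rw [norm_outer_sq]
    have h0 : 0 ≤ ∑ j, f τ j ^ 2 := Finset.sum_nonneg fun j _ => sq_nonneg _
    have h2 : ‖g τ‖ ^ 2 ≤ 1 := pow_le_one₀ (norm_nonneg _) (hg τ)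
    nlinarith [hf τ]
  have h2 : ‖∑ τ, outer (g τ) (f τ)‖ ≤ Fintype.card ι * Real.sqrt B := by
    refine (norm_sum_le _ _).trans ((Finset.sum_le_sum fun τ _ => h1 τ).trans ?_)
    simp
  calc _ ≤ (Fintype.card ι * Real.sqrt B) ^ 2 := by gcongr
    _ = _ := by rw [mul_pow, Real.sq_sqrt hB]

/-- One gradient step, seen from a comparator. -/
theorem gradient_step [Nonempty ι] {M B : ℝ} (hM : 1 ≤ M) (hB : 1 ≤ B) (g : ι → Vec d)
    (hg : ∀ τ, ‖g τ‖ ≤ 1) (f : ι → Fin k → ℝ) (hf : ∀ τ, ∑ j, f τ j ^ 2 ≤ B) (K K' : Mat d k) :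
    ‖K + (1 / (B * M * Fintype.card ι)) • ∑ τ, outer (g τ) (f τ) - K'‖ ^ 2 ≤
      ‖K - K'‖ ^ 2 + 2 / (B * M * Fintype.card ι) *
        ∑ τ, inner ℝ (g τ) (app K (f τ) - app K' (f τ)) + 1 / (B * M ^ 2) := by
  have hN : (0 : ℝ) < Fintype.card ι := by exact_mod_cast Fintype.card_pos
  set N : ℝ := (Fintype.card ι : ℝ)
  have e1 : K + (1 / (B * M * N)) • ∑ τ, outer (g τ) (f τ) - K' =
      (K - K') + (1 / (B * M * N)) • ∑ τ, outer (g τ) (f τ) := by module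
  rw [e1, norm_add_sq_real, inner_smul_right, real_inner_comm, sum_inner, norm_smul, mul_pow,
    Real.norm_eq_abs, sq_abs]
  simp only [inner_outer, app_sub]
  have h1 := norm_sum_outer_sq_le (by linarith) g hg f hf
  have h2 : (1 / (B * M * N)) ^ 2 * ‖∑ τ, outer (g τ) (f τ)‖ ^ 2 ≤
      (1 / (B * M * N)) ^ 2 * (N ^ 2 * B) := by gcongr
  -- The averaged gradient has squared norm at most `B`, so the step size `1/(BM)` leaves this
  -- second-order term.
  have h3 : (1 / (B * M * N)) ^ 2 * (N ^ 2 * B) = 1 / (B * M ^ 2) := by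
    field_simp
  have h4 : 2 / (B * M * N) = 2 * (1 / (B * M * N)) := by ring
  rw [h4]
  linarith

/-- This is `gradient_step` with comparator 0. The first-order term involves only the points `K f
τ`, which lie in a ball of radius `R`, so the growth does not depend on the size of `K`. -/
theorem norm_gradient_step_sq_le [Nonempty ι] {M B R : ℝ} (hM : 1 ≤ M) (hB : 1 ≤ B) (g : ι → Vec d)
    (hg : ∀ τ, ‖g τ‖ ≤ 1) (f : ι → Fin k → ℝ) (hf : ∀ τ, ∑ j, f τ j ^ 2 ≤ B) (K : Mat d k)
    (hK : ∀ τ, ‖app K (f τ)‖ ≤ R) :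
    ‖K + (1 / (B * M * Fintype.card ι)) • ∑ τ, outer (g τ) (f τ)‖ ^ 2 ≤
      ‖K‖ ^ 2 + (2 * R + 1) := by
  have hN : (0 : ℝ) < Fintype.card ι := by exact_mod_cast Fintype.card_pos
  have hR : 0 ≤ R := (norm_nonneg _).trans (hK (Classical.arbitrary ι))
  have h := gradient_step hM hB g hg f hf K 0
  simp only [sub_zero, app_zero] at h
  refine h.trans ?_
  have h1 : ∑ τ, inner ℝ (g τ) (app K (f τ)) ≤ Fintype.card ι * R := by
    refine (Finset.sum_le_sum fun τ _ => ?_).trans_eq (by simp : ∑ _τ : ι, R = _)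
    refine (real_inner_le_norm _ _).trans ?_
    have := mul_le_mul (hg τ) (hK τ) (norm_nonneg _) zero_le_one
    linarith
  have h2 : 2 / (B * M * Fintype.card ι) * ∑ τ, inner ℝ (g τ) (app K (f τ)) ≤ 2 * R := by
    calc _ ≤ 2 / (B * M * Fintype.card ι) * (Fintype.card ι * R) := by gcongr
      _ = 2 * R / (B * M) := by field_simp
      _ ≤ 2 * R := div_le_self (by positivity) (by nlinarith)
  have h3 : 1 / (B * M ^ 2) ≤ 1 := by
    rw [div_le_one (by positivity)]
    nlinarith
  linarith

end Matrices

/-! ### Regret of a round -/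

/-- Averaging over one coordinate does not change a sum over all tuples. -/
theorem sum_sum_update {n M : ℕ} (i : Fin n) (F : (Fin n → Fin M) → ℝ) :
    ∑ ℓ : Fin n → Fin M, ∑ r : Fin M, F (Function.update ℓ i r) = M * ∑ ℓ, F ℓ := by
  have h : ∑ q : (Fin n → Fin M) × Fin M, F (Function.update q.1 i q.2) =
      ∑ q : (Fin n → Fin M) × Fin M, F q.1 := by
    -- Exchanging the entry `ℓ i` with `r` is an involution on pairs `(ℓ, r)`.
    refine Finset.sum_bij' (fun q _ => (Function.update q.1 i q.2, q.1 i))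
      (fun q _ => (Function.update q.1 i q.2, q.1 i)) ?_ ?_ ?_ ?_ ?_ <;> simp
  rw [Fintype.sum_prod_type, Fintype.sum_prod_type] at h
  rw [h]
  simp [Finset.mul_sum]

section Game

variable {n : ℕ} (Γ : ConcaveGame n)

/-- The profile picked out of the trajectories `x` by the tuple of times `ℓ`. -/
def pick {d : Fin n → ℕ} (x : (i : Fin n) → ℕ → Vec (d i)) (ℓ : Fin n → ℕ) : Profile d :=
  fun i => x i (ℓ i)

/-- Spread the sum over a fresh value `r` of coordinate `i`. For fixed `ℓ` the sum over `r`
collapses to the difference of utilities at times `M` and `0`, which is at most 1. -/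
theorem telescope {M : ℕ} (i : Fin n) (x : (i : Fin n) → ℕ → Vec (Γ.d i))
    (hx : ∀ j, ∀ l ≤ M, x j l ∈ Γ.X j) :
    M * ∑ ℓ : Fin n → Fin M, (Γ.u i (Function.update (pick x (fun j => ℓ j)) i (x i (ℓ i + 1))) -
      Γ.u i (pick x (fun j => ℓ j))) ≤ (M : ℝ) ^ n := by
  rw [← sum_sum_update i]
  have hcard : ((M : ℝ) ^ n) = ∑ _ℓ : Fin n → Fin M, (1 : ℝ) := by simp
  rw [hcard]
  refine Finset.sum_le_sum fun ℓ _ => ?_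
  have hup : ∀ (r : Fin M), pick x (fun j => (Function.update ℓ i r j : ℕ)) =
      Function.update (pick x (fun j => ℓ j)) i (x i r) := fun r => by
    funext j
    by_cases hj : j = i
    · subst hj; simp [pick]
    · simp [pick, hj]
  have hmem : ∀ l ≤ M, Γ.u i (Function.update (pick x (fun j => ℓ j)) i (x i l)) ∈
      Set.Icc (0 : ℝ) 1 := fun l hl => by
    apply Γ.u_mem
    intro j
    by_cases hj : j = i
    · subst hj; simpa using hx j l hl
    · simpa [hj, pick] using hx j (ℓ j) (by omega)
  simp only [hup, Function.update_idem, Function.update_self]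
  have := Finset.sum_range_sub
    (fun l => Γ.u i (Function.update (pick x (fun j => ℓ j)) i (x i l))) M
  rw [Finset.sum_range] at this
  rw [this]
  have h1 := (hmem M le_rfl).2
  have h2 := (hmem 0 (Nat.zero_le _)).1
  linarith

variable {Γ} {k : Fin n → ℕ} {m : (i : Fin n) → Vec (Γ.d i) → Fin (k i) → ℝ} {O : Oracles Γ.d k}

/-- The update of player `i`'s matrix in a round with trajectories `x`. -/
noncomputable def roundGradient (O : Oracles Γ.d k) (m : (i : Fin n) → Vec (Γ.d i) → Fin (k i) → ℝ)
    (x : (i : Fin n) → ℕ → Vec (Γ.d i)) (i : Fin n) (ℓ : Fin n → ℕ) : Mat (Γ.d i) (k i) :=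
  outer (O.grad i (Function.update (pick x ℓ) i (x i (ℓ i + 1)))) (m i (x i (ℓ i)))

/-- Split the gain of `φ` over `x_l` into that of `φ` over `x_{l+1} = K m(x_l)`, which is linearised
at `x_{l+1}` and paid for by the decrease of the potential, and that of `x_{l+1}` over `x_l`, which
telescopes. -/
theorem round_regret (hO : O.Correct Γ m) {M : ℕ} (hM : 1 ≤ M) {B : ℝ} (hB : 1 ≤ B) (i : Fin n)
    (h0 : (0 : Vec (Γ.d i)) ∈ Γ.X i) (hmB : ∀ y ∈ Γ.X i, ∑ j, m i y j ^ 2 ≤ B)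
    (x : (i : Fin n) → ℕ → Vec (Γ.d i)) (hx : ∀ j, ∀ l ≤ M, x j l ∈ Γ.X j)
    (K K' : Mat (Γ.d i) (k i)) (hK : ∀ l < M, x i (l + 1) = app K (m i (x i l)))
    {φ : Vec (Γ.d i) → Vec (Γ.d i)} (hφ : Set.MapsTo φ (Γ.X i) (Γ.X i))
    (hK' : ∀ y ∈ Γ.X i, φ y = app K' (m i y)) :
    ∑ ℓ : Fin n → Fin M, (Γ.u i (Function.update (pick x (fun j => ℓ j)) i (φ (x i (ℓ i)))) -
      Γ.u i (pick x (fun j => ℓ j))) ≤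
    (M : ℝ) ^ n * (5 / 2 / M) + (M : ℝ) ^ n * B * M / 2 * (‖K - (1 - 1 / (M : ℝ)) • K'‖ ^ 2 -
      ‖K + (1 / (B * M * (M : ℝ) ^ n)) •
        ∑ ℓ : Fin n → Fin M, roundGradient O m x i (fun j => ℓ j) -
        (1 - 1 / (M : ℝ)) • K'‖ ^ 2) := by
  have hM1 : (1 : ℝ) ≤ M := by exact_mod_cast hM
  have hM0 : (0 : ℝ) < M := by linarith
  have : Nonempty (Fin n → Fin M) := ⟨fun _ => ⟨0, hM⟩⟩
  have hup : ∀ (ℓ : Fin n → Fin M), ∀ y ∈ Γ.X i,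
      Function.update (pick x (fun j => (ℓ j : ℕ))) i y ∈ Γ.profiles := fun ℓ y hy j => by
    by_cases hj : j = i
    · subst hj; simpa using hy
    · simpa [hj, pick] using hx j (ℓ j) (by omega)
  have hpick : ∀ (ℓ : Fin n → Fin M), pick x (fun j => (ℓ j : ℕ)) ∈ Γ.profiles :=
    fun ℓ j => hx j (ℓ j) (by omega)
  set g : (Fin n → Fin M) → Vec (Γ.d i) := fun ℓ =>
    O.grad i (Function.update (pick x (fun j => (ℓ j : ℕ))) i (x i (ℓ i + 1)))
  set f : (Fin n → Fin M) → Fin (k i) → ℝ := fun ℓ => m i (x i (ℓ i))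
  have hg : ∀ ℓ, ‖g ℓ‖ ≤ 1 := fun ℓ => hO.grad_norm i _ (hup ℓ _ (hx i _ (by omega)))
  have hf : ∀ ℓ, ∑ j, f ℓ j ^ 2 ≤ B := fun ℓ => hmB _ (hx i _ (by omega))
  have hstep := gradient_step hM1 hB g hg f hf K ((1 - 1 / (M : ℝ)) • K')
  have hcard : (Fintype.card (Fin n → Fin M) : ℝ) = (M : ℝ) ^ n := by simp
  rw [hcard] at hstep
  set N : ℝ := (M : ℝ) ^ n
  have hN : 0 < N := by positivity
  have hterm : ∀ ℓ : Fin n → Fin M,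
      Γ.u i (Function.update (pick x (fun j => ℓ j)) i (φ (x i (ℓ i)))) -
        Γ.u i (pick x (fun j => ℓ j)) ≤ 1 / M -
        inner ℝ (g ℓ) (app K (f ℓ) - app ((1 - 1 / (M : ℝ)) • K') (f ℓ)) +
        (Γ.u i (Function.update (pick x (fun j => ℓ j)) i (x i (ℓ i + 1))) -
          Γ.u i (pick x (fun j => ℓ j))) := fun ℓ => by
    have hxm : x i (ℓ i) ∈ Γ.X i := hx i _ (by omega)
    have hx1 : x i (ℓ i + 1) ∈ Γ.X i := hx i _ (by omega)
    -- Concavity between `φ(x_l)` and `0`, with utilities in `[0, 1]`: shrinking the deviation by `1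
    -- - 1/M` loses at most `1/M`.
    have hconc := (Γ.concave_u i _ (hpick ℓ)).2 (hφ hxm) h0
      (show 0 ≤ 1 - 1 / (M : ℝ) by rw [sub_nonneg, div_le_one hM0]; exact hM1)
      (show 0 ≤ 1 / (M : ℝ) by positivity) (by ring)
    simp only [smul_zero, add_zero, smul_eq_mul] at hconc
    have hu1 := (Γ.u_mem i _ (hup ℓ _ (hφ hxm))).2
    have hu0 := (Γ.u_mem i _ (hup ℓ _ h0)).1
    have hmem : (1 - 1 / (M : ℝ)) • φ (x i (ℓ i)) ∈ Γ.X i := by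
      have := Γ.convex_X i (hφ hxm) h0 (a := 1 - 1 / (M : ℝ)) (b := 1 / M)
        (by rw [sub_nonneg, div_le_one hM0]; exact hM1) (by positivity) (by ring)
      simpa using this
    have hsup := hO.grad_super i _ (hup ℓ _ hx1) _ hmem
    rw [Function.update_idem, Function.update_self] at hsup
    have e1 : app K (f ℓ) = x i (ℓ i + 1) := (hK _ (ℓ i).2).symm
    have e2 : app ((1 - 1 / (M : ℝ)) • K') (f ℓ) = (1 - 1 / (M : ℝ)) • φ (x i (ℓ i)) := by
      rw [app_smul, hK' _ hxm]
    rw [e1, e2]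
    have e3 : inner ℝ (g ℓ) (x i (ℓ i + 1) - (1 - 1 / (M : ℝ)) • φ (x i (ℓ i))) =
        - inner ℝ (g ℓ) ((1 - 1 / (M : ℝ)) • φ (x i (ℓ i)) - x i (ℓ i + 1)) := by
      rw [← inner_neg_right, neg_sub]
    rw [e3]
    have h5 : 1 / (M : ℝ) * Γ.u i (Function.update (pick x fun j => ↑(ℓ j)) i (φ (x i (ℓ i)))) ≤
      1 / M := mul_le_of_le_one_right (by positivity) hu1
    have h6 : 0 ≤ 1 / (M : ℝ) * Γ.u i (Function.update (pick x fun j => ↑(ℓ j)) i 0) := by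
      positivity
    simp only [g] at *
    linarith
  have hsum := Finset.sum_le_sum fun ℓ (_ : ℓ ∈ Finset.univ) => hterm ℓ
  rw [Finset.sum_add_distrib (f := fun ℓ : Fin n → Fin M => 1 / (M : ℝ) - _),
    Finset.sum_sub_distrib (f := fun _ : Fin n → Fin M => 1 / (M : ℝ))] at hsum
  have htel := telescope Γ i x hx
  have htel' : ∑ ℓ : Fin n → Fin M,
      (Γ.u i (Function.update (pick x (fun j => ℓ j)) i (x i (ℓ i + 1))) -
        Γ.u i (pick x (fun j => ℓ j))) ≤ N / M := by
    rw [le_div_iff₀ hM0]; linarith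
  have hconst : ∑ _ℓ : Fin n → Fin M, 1 / (M : ℝ) = N / M := by
    simp [N, div_eq_mul_inv]
  rw [hconst] at hsum
  set A := ∑ ℓ, inner ℝ (g ℓ) (app K (f ℓ) - app ((1 - 1 / (M : ℝ)) • K') (f ℓ)) with hA
  have hG : (∑ ℓ : Fin n → Fin M, roundGradient O m x i (fun j => ℓ j)) =
    ∑ ℓ, outer (g ℓ) (f ℓ) := rfl
  rw [hG]
  set a₁ := ‖K + (1 / (B * M * N)) • ∑ τ, outer (g τ) (f τ) - (1 - 1 / (M : ℝ)) • K'‖ ^ 2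
  set a₀ := ‖K - (1 - 1 / (M : ℝ)) • K'‖ ^ 2
  -- The factor is chosen so that the linear term `A` appears with coefficient 1.
  have hmul := mul_le_mul_of_nonneg_left hstep (show 0 ≤ N * B * M / 2 by positivity)
  have e4 : N * B * M / 2 * (a₀ + 2 / (B * M * N) * A + 1 / (B * M ^ 2)) =
      N * B * M / 2 * a₀ + A + N / (2 * M) := by
    field_simp
  rw [e4] at hmul
  -- The three parts come from shrinking the comparator, from telescoping, and from the second-order
  -- term of the gradient step.
  have e5 : N * (5 / 2 / M) = N / M + N / M + N / (2 * M) := by field_simp; norm_num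
  rw [e5, mul_sub]
  linarith

end Game

/-! ### Memory layout -/

/-- The integer parameters of a run: the dimensions, the inverse precision `M`, and the bound `D`
on the features. -/
structure Dims (n : ℕ) where
  d : Fin n → ℕ
  k : Fin n → ℕ
  M : ℕ
  D : ℕ

namespace Dims

variable {n : ℕ} (p : Dims n)

/-- Length of an output block. -/
def S : ℕ := 1 + ∑ i, p.d i

/-- One plus the number of features. -/
def F : ℕ := 1 + ∑ i, p.k i

/-- Bound on the squared norms of the feature vectors. -/
def B : ℕ := p.F * p.D * p.D

/-- Number of rounds. -/
def T : ℕ := p.B * p.D * p.D * p.M * p.M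

/-- Number of points produced in a round. -/
def N : ℕ := p.M ^ n

/-- Length of a working area. -/
def H : ℕ := p.S * p.F * (p.M + 2)

/-- Start of the working areas, and end of the output. -/
def base : ℕ := p.T * p.N * p.S

/-- Cell `o` of working area `q`. Areas `3 i`, `3 i + 1`, `3 i + 2` hold the matrix, the trajectory
and the features of player `i`, area `3 n` holds answers of oracles and area `3 n + 1` a scalar. -/
def adr (q o : ℕ) : ℕ := p.base + q * p.H + o

/-- The parameters are stored in the memory. -/
structure Holds (s : Mem) : Prop where
  d : ∀ i : Fin n, s.nat i = p.d i
  k : ∀ i : Fin n, s.nat (n + i) = p.k i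
  M : s.nat (2 * n) = p.M
  D : s.nat (2 * n + 1) = p.D
  B : s.nat (2 * n + 2) = p.B
  T : s.nat (2 * n + 3) = p.T
  N : s.nat (2 * n + 4) = p.N
  S : s.nat (2 * n + 5) = p.S
  H : s.nat (2 * n + 6) = p.H
  base : s.nat (2 * n + 7) = p.base

variable {p}

theorem Holds.of_natEq {h : ℕ} (hh : 2 * n + 8 ≤ h) {s s' : Mem} (hs : p.Holds s)
    (he : NatEq h s s') : p.Holds s' where
  d i := (he _ (by omega)).trans (hs.d i)
  k i := (he _ (by omega)).trans (hs.k i)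
  M := (he _ (by omega)).trans hs.M
  D := (he _ (by omega)).trans hs.D
  B := (he _ (by omega)).trans hs.B
  T := (he _ (by omega)).trans hs.T
  N := (he _ (by omega)).trans hs.N
  S := (he _ (by omega)).trans hs.S
  H := (he _ (by omega)).trans hs.H
  base := (he _ (by omega)).trans hs.base

/-! ### Sizes and disjointness of the working areas -/

variable (p)

theorem d_lt_S (i : Fin n) : p.d i < p.S := by
  have := Finset.single_le_sum (f := p.d) (fun _ _ => Nat.zero_le _) (Finset.mem_univ i)
  unfold S; omega

theorem k_lt_F (i : Fin n) : p.k i < p.F := by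
  have := Finset.single_le_sum (f := p.k) (fun _ _ => Nat.zero_le _) (Finset.mem_univ i)
  unfold F; omega

theorem S_pos : 0 < p.S := by unfold S; omega

theorem F_pos : 0 < p.F := by unfold F; omega

theorem mul_le_H {a b : ℕ} (ha : a ≤ p.S) (hb : b ≤ p.M + 2) : b * a ≤ p.H := by
  calc b * a ≤ (p.M + 2) * p.S := Nat.mul_le_mul hb ha
    _ ≤ (p.M + 2) * p.S * p.F := Nat.le_mul_of_pos_right _ p.F_pos
    _ = p.H := by unfold H; ring

theorem mul_le_H' {a b : ℕ} (ha : a ≤ p.F) (hb : b ≤ p.M + 2) : b * a ≤ p.H := by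
  calc b * a ≤ (p.M + 2) * p.F := Nat.mul_le_mul hb ha
    _ ≤ (p.M + 2) * p.F * p.S := Nat.le_mul_of_pos_right _ p.S_pos
    _ = p.H := by unfold H; ring

theorem mat_le_H (i : Fin n) : p.d i * p.k i ≤ p.H := by
  calc p.d i * p.k i ≤ p.S * p.F := Nat.mul_le_mul (p.d_lt_S i).le (p.k_lt_F i).le
    _ ≤ p.S * p.F * (p.M + 2) := Nat.le_mul_of_pos_right _ (by omega)

theorem traj_le_H (i : Fin n) {l : ℕ} (hl : l ≤ p.M) : l * p.d i + p.d i ≤ p.H := by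
  have := p.mul_le_H (p.d_lt_S i).le (b := l + 1) (by omega)
  rwa [Nat.add_mul, Nat.one_mul] at this

theorem feat_le_H (i : Fin n) {l : ℕ} (hl : l ≤ p.M) : l * p.k i + p.k i ≤ p.H := by
  have := p.mul_le_H' (p.k_lt_F i).le (b := l + 1) (by omega)
  rwa [Nat.add_mul, Nat.one_mul] at this

theorem two_mul_S_le_H : 2 * p.S ≤ p.H := p.mul_le_H le_rfl (by omega)

theorem ans_lt_H (i : Fin n) : p.d i + 1 < p.H := by
  have := p.two_mul_S_le_H
  have := p.d_lt_S i
  omega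

theorem H_pos : 0 < p.H := by
  have := p.two_mul_S_le_H
  have := p.S_pos
  omega

theorem adr_add (q o c : ℕ) : p.adr q o + c = p.adr q (o + c) := by unfold adr; omega

theorem base_le_adr (q o : ℕ) : p.base ≤ p.adr q o := by unfold adr; omega

theorem adr_lt_adr {q q' o : ℕ} (h : q < q') (ho : o < p.H) (o' : ℕ) : p.adr q o < p.adr q' o' := by
  have : (q + 1) * p.H ≤ q' * p.H := Nat.mul_le_mul_right _ h
  rw [Nat.add_mul] at this
  unfold adr
  omega

theorem adr_ne {q q' o o' : ℕ} (h : q ≠ q') (ho : o < p.H) (ho' : o' < p.H) :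
    p.adr q o ≠ p.adr q' o' := by
  rcases Nat.lt_or_gt_of_ne h with h | h
  · exact (p.adr_lt_adr h ho o').ne
  · exact Ne.symm (p.adr_lt_adr h ho' o).ne

/-- Only the working areas in `A` have changed. -/
structure Frame (A : Set ℕ) (s s' : Mem) : Prop where
  out : ∀ a < p.base, s'.real a = s.real a
  area : ∀ q ∉ A, ∀ o < p.H, s'.real (p.adr q o) = s.real (p.adr q o)

variable {p}

theorem Frame.refl (A : Set ℕ) (s : Mem) : p.Frame A s s := ⟨fun _ _ => rfl, fun _ _ _ _ => rfl⟩

theorem Frame.trans {A : Set ℕ} {s s' s'' : Mem} (h₁ : p.Frame A s s') (h₂ : p.Frame A s' s'') :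
    p.Frame A s s'' :=
  ⟨fun a ha => (h₂.out a ha).trans (h₁.out a ha),
    fun q hq o ho => (h₂.area q hq o ho).trans (h₁.area q hq o ho)⟩

theorem Frame.mono {A A' : Set ℕ} {s s' : Mem} (h : p.Frame A s s') (hA : A ⊆ A') :
    p.Frame A' s s' :=
  ⟨h.out, fun q hq o ho => h.area q (fun h => hq (hA h)) o ho⟩

theorem Frame.of_real_eq {A : Set ℕ} {s s' : Mem} (h : s'.real = s.real) : p.Frame A s s' :=
  ⟨fun a _ => by rw [h], fun q _ o _ => by rw [h]⟩

theorem Frame.of_interval {q o w : ℕ} {s s' : Mem} (ho : o + w ≤ p.H)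
    (h : ∀ b, b < p.adr q o ∨ p.adr q o + w ≤ b → s'.real b = s.real b) : p.Frame {q} s s' := by
  refine ⟨fun a ha => h a (.inl (ha.trans_le (p.base_le_adr q o))), fun q' hq' o' ho' => ?_⟩
  rcases Nat.lt_or_gt_of_ne hq' with hq | hq
  · exact h _ (.inl (p.adr_lt_adr hq ho' o))
  · refine h _ ?_
    -- An empty interval has no last cell `o + w - 1` to compare with, so it is treated separately.
    rcases Nat.eq_zero_or_pos w with rfl | hw
    · rcases Nat.lt_or_ge (p.adr q' o') (p.adr q o) with h | h
      · exact .inl h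
      · exact .inr h
    · have := p.adr_lt_adr hq (o := o + w - 1) (by omega) o'
      rw [show o + w - 1 = o + (w - 1) by omega, ← adr_add] at this
      exact .inr (by omega)

variable (p)

/-- The matrix of player `i`. -/
noncomputable def matAt (s : Mem) (i : Fin n) : Mat (p.d i) (p.k i) :=
  WithLp.toLp 2 (fun q => s.real (p.adr (3 * i) (q.1 * p.k i + q.2)))

/-- Point `l` of the trajectory of player `i`. -/
noncomputable def trajAt (s : Mem) (i : Fin n) (l : ℕ) : Vec (p.d i) :=
  s.readVec (p.d i) (p.adr (3 * i + 1) (l * p.d i))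

/-- The features of point `l` of the trajectory of player `i`. -/
def featAt (s : Mem) (i : Fin n) (l : ℕ) : Fin (p.k i) → ℝ :=
  fun j => s.real (p.adr (3 * i + 2) (l * p.k i + j))

theorem mat_lt (i : Fin n) {c j : ℕ} (hc : c < p.d i) (hj : j < p.k i) :
    c * p.k i + j < p.d i * p.k i := by
  have : (c + 1) * p.k i ≤ p.d i * p.k i := Nat.mul_le_mul_right _ hc
  rw [Nat.add_mul] at this
  omega

variable {p}

theorem matAt_congr {s s' : Mem} {i : Fin n}
    (h : ∀ o < p.H, s'.real (p.adr (3 * i) o) = s.real (p.adr (3 * i) o)) :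
    p.matAt s' i = p.matAt s i := by
  ext q
  exact h _ ((p.mat_lt i q.1.2 q.2.2).trans_le (p.mat_le_H i))

theorem trajAt_congr {s s' : Mem} {i : Fin n} {l : ℕ}
    (h : ∀ o < l * p.d i + p.d i, s'.real (p.adr (3 * i + 1) o) = s.real (p.adr (3 * i + 1) o)) :
    p.trajAt s' i l = p.trajAt s i l := by
  ext c
  simp only [trajAt, Mem.readVec, adr_add]
  exact h _ (by omega)

theorem featAt_congr {s s' : Mem} {i : Fin n} {l : ℕ}
    (h : ∀ o < l * p.k i + p.k i, s'.real (p.adr (3 * i + 2) o) = s.real (p.adr (3 * i + 2) o)) :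
    p.featAt s' i l = p.featAt s i l := by
  funext j
  exact h _ (by omega)

end Dims

/-- The address of working area `q`. -/
def areaE (n q : ℕ) : NExp := .var (2 * n + 7) + .const q * .var (2 * n + 6)

@[simp] theorem cost_areaE (n q : ℕ) : (areaE n q).cost = 7 := rfl

theorem Dims.Holds.eval_areaE {n : ℕ} {p : Dims n} {s : Mem} (h : p.Holds s) (q : ℕ) :
    (areaE n q).eval s = p.adr q 0 := by
  simp [areaE, h.base, h.H, Dims.adr]

/-! ### Linear algebra programs

Cell `3 n + 11` holds the current position `l` in a trajectory; cells `3 n + 13` and `3 n + 14` are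
loop counters. -/

section Programs

variable {n : ℕ}

/-- `x_{l+1} := K m_l`. -/
def matVec (i : Fin n) : Prog n :=
  .forN (3 * n + 13) (.var i)
    (.seq (.rset (areaE n (3 * i + 1) + (.var (3 * n + 11) + .const 1) * .var i + .var (3 * n + 13))
        (.ofNat (.const 0)))
      (.forN (3 * n + 14) (.var (n + i))
        (.rset (areaE n (3 * i + 1) + (.var (3 * n + 11) + .const 1) * .var i + .var (3 * n + 13))
          (.mem (areaE n (3 * i + 1) + (.var (3 * n + 11) + .const 1) * .var i + .var (3 * n + 13)) +
            .mem (areaE n (3 * i) + .var (3 * n + 13) * .var (n + i) + .var (3 * n + 14)) *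
              .mem (areaE n (3 * i + 2) + .var (3 * n + 11) * .var (n + i) + .var (3 * n + 14))))))

theorem matVec_runs (i : Fin n) : ∃ f, IsPoly f ∧ ∀ (p : Dims n) (O : Oracles p.d p.k) (s : Mem)
    (W l : ℕ), p.Holds s → p.d i ≤ W → p.k i ≤ W → s.nat (3 * n + 11) = l → l < p.M →
    Runs O (matVec i) s (f W) (fun s' => NatEq (3 * n + 13) s s' ∧
      (∀ b, b < p.adr (3 * i + 1) ((l + 1) * p.d i) ∨
        p.adr (3 * i + 1) ((l + 1) * p.d i) + p.d i ≤ b → s'.real b = s.real b) ∧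
      p.trajAt s' i (l + 1) = app (p.matAt s i) (p.featAt s i l)) := by
  refine ⟨fun W => W * (W * 150 + 200) + 100,
    (IsPoly.id.mul ((IsPoly.id.mul (.const _)).add (.const _))).add (.const _), ?_⟩
  · intro p O s W l hs hd hk hl hlM
    have hlH := p.traj_le_H i (l := l + 1) (by omega)
    have hfH := p.feat_le_H i hlM.le
    have hdst : ∀ s', NatEq (3 * n + 13) s s' →
        (areaE n (3 * i + 1) + (.var (3 * n + 11) + .const 1) * .var i : NExp).eval s' =
          p.adr (3 * i + 1) ((l + 1) * p.d i) := fun s' h => by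
      have h' := hs.of_natEq (by omega) h
      simp [h'.eval_areaE, h _ (show 3 * n + 11 < 3 * n + 13 by omega), hl, h'.d, Dims.adr_add]
    have hsne : ∀ q ≠ 3 * (i : ℕ) + 1, ∀ o < p.H, ∀ c < p.d i,
        p.adr q o ≠ p.adr (3 * i + 1) ((l + 1) * p.d i) + c := fun q hq o ho c hc => by
      rw [p.adr_add]
      exact p.adr_ne hq ho (by omega)
    -- Each coordinate of the product is a block of one cell, first cleared and then used as
    -- accumulator.
    refine (Runs.forBlocks (B := p.d i) (w := 1) (a := p.adr (3 * i + 1) ((l + 1) * p.d i))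
      (f := fun c => ∑ j ∈ Finset.range (p.k i), s.real (p.adr (3 * i) (c * p.k i + j)) *
        s.real (p.adr (3 * i + 2) (l * p.k i + j)))
      (T := p.k i * 150 + 100) (fun s' h => ?_) (fun c hc s' h hv hr => ?_)).mono ?_ ?_
    · exact (hs.of_natEq (by omega) h).d i
    · have hs' := hs.of_natEq (by omega) h
      have hea : ∀ s'', NatEq (3 * n + 14) s' s'' →
          (areaE n (3 * i + 1) + (.var (3 * n + 11) + .const 1) * .var i +
            .var (3 * n + 13) : NExp).eval s'' = p.adr (3 * i + 1) ((l + 1) * p.d i) + c :=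
        fun s'' h'' => by
          rw [NExp.eval_add, hdst s'' (h.trans (h''.mono (by omega))), NExp.eval_var,
            h'' _ (by omega), hv]
      refine (Runs.seq (Runs.rset (Q := fun s'' =>
        s'' = s'.setReal (p.adr (3 * i + 1) ((l + 1) * p.d i) + c) 0) ?_)
        (T' := p.k i * 140 + 30) ?_).mono (by simp; omega) (fun _ h => h)
      · rw [hea s' (NatEq.refl _ _)]; simp
      · rintro _ rfl
        refine (Runs.forSum (B := p.k i) (a := p.adr (3 * i + 1) ((l + 1) * p.d i) + c)
          (f := fun j => s.real (p.adr (3 * i) (c * p.k i + j)) *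
            s.real (p.adr (3 * i + 2) (l * p.k i + j)))
          (fun s'' h'' => ?_) (fun s'' h'' => ?_) (fun j hj s'' h'' hv'' hr'' => ?_)).mono
          ?_ ?_
        · exact (hs'.of_natEq (h := 3 * n + 14) (by omega) h'').k i
        · exact hea s'' h''
        · have hs'' := hs'.of_natEq (h := 3 * n + 14) (by omega) h''
          have hmat := p.mat_lt i hc hj
          have hmH := p.mat_le_H i
          -- All reads of matrix and features are in areas other than the trajectory being written,
          -- so they still see the initial values.
          have key : ∀ q o, q ≠ 3 * (i : ℕ) + 1 → o < p.H →
              s''.real (p.adr q o) = s.real (p.adr q o) := fun q o hq ho => by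
            have h1 := hsne q hq o ho c hc
            rw [hr'' _ h1, Mem.setReal_real, if_neg h1]
            have h2 := hsne q hq o ho
            by_cases hcase : p.adr q o < p.adr (3 * i + 1) ((l + 1) * p.d i) ∨
              p.adr (3 * i + 1) ((l + 1) * p.d i) + c * 1 ≤ p.adr q o
            · exact hr _ hcase
            · exact absurd (show p.adr q o = _ + (p.adr q o -
                p.adr (3 * i + 1) ((l + 1) * p.d i)) by omega) (h2 _ (by omega))
          have hcc : s''.nat (3 * n + 13) = c := by rw [h'' _ (by omega)]; exact hv
          have hll : s''.nat (3 * n + 11) = l := by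
            rw [h'' _ (by omega)]; exact (h _ (by omega)).trans hl
          simp only [RExp.eval_mul, RExp.eval_mem, NExp.eval_add, hs''.eval_areaE, NExp.eval_mul,
            NExp.eval_var, hcc, hll, hv'', hs''.k, Dims.adr_add, Nat.zero_add]
          rw [key _ _ (by omega) (by omega), key _ _ (by omega) (by omega)]
        · simp; omega
        · rintro s'' ⟨g₁, g₂, g₃⟩
          refine ⟨g₁, ?_, ?_⟩
          · intro j hj
            obtain rfl : j = 0 := by omega
            simpa using g₂
          · intro b hb
            have hbne : b ≠ p.adr (3 * i + 1) ((l + 1) * p.d i) + c := by omega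
            rw [g₃ b hbne, Mem.setReal_real, if_neg hbne]
    · have := Nat.mul_le_mul hd (show p.k i * 150 + 100 + (NExp.var i).cost + 12 ≤ W * 150 + 200 by
        simp; omega)
      rw [Nat.add_assoc]
      exact Nat.add_le_add this (by simp)
    · rintro s' ⟨g₁, g₂, g₃⟩
      refine ⟨g₁, by simpa using g₃, ?_⟩
      ext c
      simp only [Dims.trajAt, Mem.readVec, app]
      rw [g₂ c (by omega), Finset.sum_range]
      rfl

/-- `K := K + r a m_lᵀ`, with `a` the latest answer and `r` the stored scalar. -/
def rankOne (i : Fin n) : Prog n :=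
  .forN (3 * n + 13) (.var i)
    (.forN (3 * n + 14) (.var (n + i))
      (.rset (areaE n (3 * i) + .var (3 * n + 13) * .var (n + i) + .var (3 * n + 14))
        (.mem (areaE n (3 * i) + .var (3 * n + 13) * .var (n + i) + .var (3 * n + 14)) +
          .mem (areaE n (3 * n + 1)) * .mem (areaE n (3 * n) + .var (3 * n + 13)) *
            .mem (areaE n (3 * i + 2) + .var (3 * n + 11) * .var (n + i) + .var (3 * n + 14)))))

theorem rankOne_runs (i : Fin n) : ∃ f, IsPoly f ∧ ∀ (p : Dims n) (O : Oracles p.d p.k) (s : Mem)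
    (W l : ℕ), p.Holds s → p.d i ≤ W → p.k i ≤ W → s.nat (3 * n + 11) = l → l < p.M →
    Runs O (rankOne i) s (f W) (fun s' => NatEq (3 * n + 13) s s' ∧ p.Frame {3 * (i : ℕ)} s s' ∧
      p.matAt s' i = p.matAt s i + s.real (p.adr (3 * n + 1) 0) •
        outer (s.readVec (p.d i) (p.adr (3 * n) 0)) (p.featAt s i l)) := by
  refine ⟨fun W => W * (W * 150 + 200) + 100,
    (IsPoly.id.mul ((IsPoly.id.mul (.const _)).add (.const _))).add (.const _), ?_⟩
  · intro p O s W l hs hd hk hl hlM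
    have hfH := p.feat_le_H i hlM.le
    have hmH := p.mat_le_H i
    have haH := p.ans_lt_H i
    have hne : ∀ q ≠ 3 * (i : ℕ), ∀ o < p.H, p.adr q o < p.adr (3 * i) 0 ∨
        p.adr (3 * i) 0 + p.d i * p.k i ≤ p.adr q o := fun q hq o ho => by
      by_contra hcon
      exact p.adr_ne hq ho (o' := p.adr q o - p.adr (3 * i) 0) (by omega) (by
        have := p.adr_add (3 * i) 0 (p.adr q o - p.adr (3 * i) 0)
        rw [Nat.zero_add] at this
        omega)
    -- The matrix is stored row by row: offset `o` has row `o / k` and column `o % k`.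
    refine (Runs.forBlocks (B := p.d i) (w := p.k i) (a := p.adr (3 * i) 0)
      (f := fun o => s.real (p.adr (3 * i) o) + s.real (p.adr (3 * n + 1) 0) *
        s.real (p.adr (3 * n) (o / p.k i)) * s.real (p.adr (3 * i + 2) (l * p.k i + o % p.k i)))
      (T := p.k i * 150 + 100) (fun s' h => ?_) (fun c hc s' h hv hr => ?_)).mono ?_ ?_
    · exact (hs.of_natEq (by omega) h).d i
    · have hs' := hs.of_natEq (by omega) h
      have hck : c * p.k i ≤ p.d i * p.k i := Nat.mul_le_mul_right _ hc.le
      have hck1 : (c + 1) * p.k i ≤ p.d i * p.k i := Nat.mul_le_mul_right _ hc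
      have hck2 : (c + 1) * p.k i = c * p.k i + p.k i := by ring
      refine (Runs.forStore (B := p.k i) (a := p.adr (3 * i) 0 + c * p.k i)
        (f := fun j => s.real (p.adr (3 * i) (c * p.k i + j)) + s.real (p.adr (3 * n + 1) 0) *
          s.real (p.adr (3 * n) c) * s.real (p.adr (3 * i + 2) (l * p.k i + j)))
        (fun s'' h'' => ?_) (fun s'' h'' => ?_) (fun j hj s'' h'' hv'' hr'' => ?_)).mono
          ?_ ?_
      · exact (hs'.of_natEq (h := 3 * n + 14) (by omega) h'').k i
      · have hs'' := hs'.of_natEq (h := 3 * n + 14) (by omega) h''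
        simp [hs''.eval_areaE, h'' _ (show 3 * n + 13 < 3 * n + 14 by omega), hv, hs''.k]
      · have hs'' := hs'.of_natEq (h := 3 * n + 14) (by omega) h''
        have hcc : s''.nat (3 * n + 13) = c := by rw [h'' _ (by omega)]; exact hv
        have hll : s''.nat (3 * n + 11) = l := by
          rw [h'' _ (by omega)]; exact (h _ (by omega)).trans hl
        have key : ∀ q o, q ≠ 3 * (i : ℕ) → o < p.H →
            s''.real (p.adr q o) = s.real (p.adr q o) := fun q o hq ho => by
          have := hne q hq o ho
          rw [hr'' _ (by omega), hr _ (by omega)]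
        simp only [RExp.eval_add, RExp.eval_mul, RExp.eval_mem, NExp.eval_add, hs''.eval_areaE,
          NExp.eval_mul, NExp.eval_var, hcc, hll, hv'', hs''.k, Dims.adr_add, Nat.zero_add]
        -- The update is in place. The matrix cell read here lies beyond those already overwritten,
        -- so it has its old value.
        rw [key (3 * n + 1) 0 (by omega) p.H_pos, key (3 * n) c (by omega) (by omega),
          key (3 * i + 2) _ (by omega) (by omega), hr'' _ (by rw [p.adr_add, Dims.adr, Dims.adr]; omega),
          hr _ (by rw [Dims.adr, Dims.adr]; omega)]
      · simp; omega
      · rintro s'' ⟨g₁, g₂, g₃⟩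
        refine ⟨g₁, ?_, ?_⟩
        · intro j hj
          rw [g₂ j hj]
          have hk0 : 0 < p.k i := by omega
          have e1 : (c * p.k i + j) / p.k i = c := by
            rw [Nat.mul_comm, Nat.mul_add_div hk0, Nat.div_eq_of_lt hj, Nat.add_zero]
          have e2 : (c * p.k i + j) % p.k i = j := by
            rw [Nat.mul_comm, Nat.mul_add_mod, Nat.mod_eq_of_lt hj]
          rw [e1, e2]
        · intro b hb
          exact g₃ b (by omega)
    · have := Nat.mul_le_mul hd (show p.k i * 150 + 100 + (NExp.var i).cost + 12 ≤ W * 150 + 200 by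
        simp; omega)
      rw [Nat.add_assoc]
      exact Nat.add_le_add this (by simp)
    · rintro s' ⟨g₁, g₂, g₃⟩
      refine ⟨g₁, Dims.Frame.of_interval (o := 0) (by omega) g₃, ?_⟩
      ext ⟨c, j⟩
      have hmat := p.mat_lt i c.2 j.2
      have hk0 : 0 < p.k i := j.pos
      have e1 : (c * p.k i + j) / p.k i = c := by
        rw [Nat.mul_comm, Nat.mul_add_div hk0, Nat.div_eq_of_lt j.2, Nat.add_zero]
      have e2 : (c * p.k i + j) % p.k i = j := by
        rw [Nat.mul_comm, Nat.mul_add_mod, Nat.mod_eq_of_lt j.2]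
      have := g₂ _ hmat
      rw [p.adr_add, Nat.zero_add, e1, e2] at this
      simp [Dims.matAt, this, outer, Mem.readVec, Dims.featAt, Dims.adr_add, mul_assoc]

/-- The stored scalar becomes the squared norm of the latest answer. -/
def sqNorm (i : Fin n) : Prog n :=
  .seq (.rset (areaE n (3 * n + 1)) (.ofNat (.const 0)))
    (.forN (3 * n + 13) (.var i) (.rset (areaE n (3 * n + 1)) (.mem (areaE n (3 * n + 1)) +
      .mem (areaE n (3 * n) + .var (3 * n + 13)) * .mem (areaE n (3 * n) + .var (3 * n + 13)))))

theorem sqNorm_runs (i : Fin n) : ∃ f, IsPoly f ∧ ∀ (p : Dims n) (O : Oracles p.d p.k) (s : Mem)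
    (W : ℕ), p.Holds s → p.d i ≤ W →
    Runs O (sqNorm i) s (f W) (fun s' => NatEq (3 * n + 13) s s' ∧ p.Frame {3 * n + 1} s s' ∧
      s'.real (p.adr (3 * n + 1) 0) = ‖s.readVec (p.d i) (p.adr (3 * n) 0)‖ ^ 2) := by
  refine ⟨fun W => W * 100 + 50, (IsPoly.id.mul (.const _)).add (.const _), ?_⟩
  intro p O s W hs hd
  have haH := p.ans_lt_H i
  refine (Runs.seq (Runs.rset (Q := fun s' => s' = s.setReal (p.adr (3 * n + 1) 0) 0) ?_)
    (T' := W * 100 + 20) ?_).mono (by simp; omega) (fun _ h => h)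
  · simp [hs.eval_areaE]
  · rintro _ rfl
    have hs' : p.Holds (s.setReal (p.adr (3 * n + 1) 0) 0) :=
      hs.of_natEq le_rfl ((NatEq.refl _ _).setReal)
    refine (Runs.forSum (B := p.d i) (a := p.adr (3 * n + 1) 0)
      (f := fun c => s.real (p.adr (3 * n) c) * s.real (p.adr (3 * n) c))
      (fun s'' h => ?_) (fun s'' h => ?_) (fun c hc s'' h hv hr => ?_)).mono ?_ ?_
    · exact (hs'.of_natEq (by omega) h).d i
    · exact (hs'.of_natEq (by omega) h).eval_areaE _
    · have h1 : p.adr (3 * n) c ≠ p.adr (3 * n + 1) 0 :=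
        p.adr_ne (by omega) (by omega) p.H_pos
      simp only [RExp.eval_mul, RExp.eval_mem, NExp.eval_add, NExp.eval_var,
        (hs'.of_natEq (by omega) h).eval_areaE, hv, Dims.adr_add, Nat.zero_add]
      rw [hr _ h1, Mem.setReal_real, if_neg h1]
    · simp only [NExp.cost_var, RExp.cost_mul, RExp.cost_mem, NExp.cost_add, cost_areaE]
      omega
    · rintro s'' ⟨g₁, g₂, g₃⟩
      refine ⟨g₁, Dims.Frame.of_interval (o := 0) (w := 1) (by omega) ?_, ?_⟩
      · intro b hb
        rw [g₃ b (by omega), Mem.setReal_real, if_neg (by omega)]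
      · rw [g₂, Mem.setReal_real, if_pos rfl, zero_add, Finset.sum_range,
          EuclideanSpace.norm_sq_eq]
        refine Finset.sum_congr rfl fun c _ => ?_
        simp [Mem.readVec, Dims.adr_add, sq]

/-- Copy point `e` of the trajectory of player `i` to the cells starting at `dst`. -/
def copyTraj (i : Fin n) (e dst : NExp) : Prog n :=
  .forN (3 * n + 13) (.var i) (.rset (dst + .var (3 * n + 13))
    (.mem (areaE n (3 * i + 1) + e * .var i + .var (3 * n + 13))))

theorem copyTraj_runs (i : Fin n) (e dst : NExp) : ∃ f, IsPoly f ∧ ∀ (p : Dims n)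
    (O : Oracles p.d p.k) (s : Mem) (W l a : ℕ), p.Holds s → p.d i ≤ W → l ≤ p.M →
    (∀ s', NatEq (3 * n + 13) s s' → e.eval s' = l) →
    (∀ s', NatEq (3 * n + 13) s s' → dst.eval s' = a) → a + p.d i ≤ p.base →
    Runs O (copyTraj i e dst) s (f W) (fun s' => NatEq (3 * n + 13) s s' ∧
      (∀ b, b < a ∨ a + p.d i ≤ b → s'.real b = s.real b) ∧
      s'.readVec (p.d i) a = p.trajAt s i l) := by
  refine ⟨fun W => W * (dst.cost + e.cost + 60) + 20, (IsPoly.id.mul (.const _)).add (.const _), ?_⟩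
  intro p O s W l a hs hd hl he hdst ha
  have hlH := p.traj_le_H i hl
  refine (Runs.forStore (B := p.d i) (a := a)
    (f := fun c => s.real (p.adr (3 * i + 1) (l * p.d i + c)))
    (fun s' h => ?_) hdst (fun c hc s' h hv hr => ?_)).mono ?_ ?_
  · exact (hs.of_natEq (by omega) h).d i
  · simp only [RExp.eval_mem, NExp.eval_add, NExp.eval_mul, NExp.eval_var, he s' h, hv,
      (hs.of_natEq (by omega) h).eval_areaE, (hs.of_natEq (by omega) h).d, Dims.adr_add,
      Nat.zero_add]
    -- The source is at or above `base` and the destination below it, so copying cannot overwrite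
    -- its own input.
    have := p.base_le_adr (3 * i + 1) (l * p.d i + c)
    exact hr _ (by omega)
  · have := Nat.mul_le_mul hd (show dst.cost + (RExp.mem (areaE n (3 * i + 1) + e * .var i +
      .var (3 * n + 13))).cost + (NExp.var i).cost + 20 ≤ dst.cost + e.cost + 60 by simp; omega)
    simp only [NExp.cost_var] at this ⊢
    omega
  · rintro s' ⟨g₁, g₂, g₃⟩
    refine ⟨g₁, g₃, ?_⟩
    ext c
    simp only [Mem.readVec, Dims.trajAt, Dims.adr_add]
    exact g₂ c c.2

end Programs

/-! ### Triples for oracle calls -/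

namespace Runs

variable {n : ℕ} {d k : Fin n → ℕ} {O : Oracles d k}

theorem feat {s : Mem} {i : Fin n} {src dst : NExp} {Q : Mem → Prop}
    (hQ : Q (s.writeVec (dst.eval s) (O.feat i (s.readVec (d i) (src.eval s))))) :
    Runs O (.feat i src dst) s (src.cost + dst.cost + (d i + k i) + 1) Q :=
  ⟨_, _, .feat s i src dst, le_rfl, hQ⟩

theorem sep {s : Mem} {i : Fin n} {src dst flag : NExp} {Q : Mem → Prop}
    (hQ : Q (s.writeSep (dst.eval s) (flag.eval s) (O.sep i (s.readVec (d i) (src.eval s))))) :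
    Runs O (.sep i src dst flag) s (src.cost + dst.cost + flag.cost + (2 * d i + 1) + 1) Q :=
  ⟨_, _, .sep s i src dst flag, le_rfl, hQ⟩

theorem grad {s : Mem} {i : Fin n} {src dst : NExp} {Q : Mem → Prop}
    (hQ : Q (s.writeVec (dst.eval s) (fun c => O.grad i (s.readProfile d (src.eval s)) c))) :
    Runs O (.grad i src dst) s (src.cost + dst.cost + (∑ j, d j + d i) + 1) Q :=
  ⟨_, _, .grad s i src dst, le_rfl, hQ⟩

end Runs

/-! ### Trajectories -/

section Trajectory

variable {n : ℕ}

/-- Extend the trajectory of player `i` by one point, or cut and restart if that point is outside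
the strategy set. Cell `3 n + 12` holds the answer of the separation oracle. -/
def trajStep (i : Fin n) : Prog n :=
  .seq (.feat i (areaE n (3 * i + 1) + .var (3 * n + 11) * .var i)
      (areaE n (3 * i + 2) + .var (3 * n + 11) * .var (n + i)))
    (.seq (matVec i)
      (.seq (.sep i (areaE n (3 * i + 1) + (.var (3 * n + 11) + .const 1) * .var i)
          (areaE n (3 * n)) (.const (3 * n + 12)))
        (.ite (.nlt (.const 0) (.var (3 * n + 12)))
          (.nset (.const (3 * n + 11)) (.var (3 * n + 11) + .const 1))
          (.seq (sqNorm i)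
            (.seq (.rset (areaE n (3 * n + 1)) (.ofNat (.const 0) - .mem (areaE n (3 * n) + .var i) /
                (.mem (areaE n (3 * n + 1)) * (.ofNat (.var (2 * n)) * .ofNat (.var (2 * n + 2))))))
              (.seq (rankOne i) (.nset (.const (3 * n + 11)) (.const 0))))))))

/-- Compute a trajectory of player `i` that stays inside the strategy set. -/
def traj (i : Fin n) : Prog n :=
  .seq (.nset (.const (3 * n + 11)) (.const 0))
    (.loop (.nlt (.var (3 * n + 11)) (.var (2 * n))) (trajStep i))

/-- The promises concerning the strategy set `X` and the feature map `m` of player `i`. -/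
structure PlayerCorrect (p : Dims n) (O : Oracles p.d p.k) (i : Fin n) (X : Set (Vec (p.d i)))
    (m : Vec (p.d i) → Fin (p.k i) → ℝ) : Prop where
  sep_mem : ∀ x ∈ X, O.sep i x = none
  sep_not_mem : ∀ x ∉ X, ∃ a b, O.sep i x = some (a, b) ∧ b < inner ℝ a x ∧
    ∀ z ∈ X, inner ℝ a z ≤ b
  feat_eq : ∀ x ∈ X, O.feat i x = m x
  ball : Metric.closedBall 0 1 ⊆ X
  feat_le : ∀ x ∈ X, ∑ j, m x j ^ 2 ≤ p.B
  one_le_M : 1 ≤ p.M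
  one_le_B : 1 ≤ p.B

/-- The working areas of player `i` and the shared ones. -/
def playerAreas (n i : ℕ) : Set ℕ := {3 * i, 3 * i + 1, 3 * i + 2, 3 * n, 3 * n + 1}

/-- The first `l` steps of the stored trajectory of player `i` are valid. -/
structure ValidTraj (p : Dims n) (i : Fin n) (X : Set (Vec (p.d i)))
    (m : Vec (p.d i) → Fin (p.k i) → ℝ) (s : Mem) (l : ℕ) : Prop where
  zero : p.trajAt s i 0 = 0
  mem : ∀ r < l, p.trajAt s i (r + 1) ∈ X
  step : ∀ r < l, p.trajAt s i (r + 1) = app (p.matAt s i) (m (p.trajAt s i r))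
  feat : ∀ r < l, p.featAt s i r = m (p.trajAt s i r)

/-- Invariant of the computation of a trajectory started in `s₀`. -/
structure TrajInv (p : Dims n) (i : Fin n) (X : Set (Vec (p.d i)))
    (m : Vec (p.d i) → Fin (p.k i) → ℝ) (s₀ s : Mem) : Prop where
  nat : NatEq (3 * n + 11) s₀ s
  frame : p.Frame (playerAreas n i) s₀ s
  le : s.nat (3 * n + 11) ≤ p.M
  valid : ValidTraj p i X m s (s.nat (3 * n + 11))
  pot : ∀ K' : Mat (p.d i) (p.k i), (∀ y ∈ X, app K' (m y) ∈ X) →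
    ‖p.matAt s i - (1 - 1 / (p.M : ℝ)) • K'‖ ^ 2 ≤ ‖p.matAt s₀ i - (1 - 1 / (p.M : ℝ)) • K'‖ ^ 2

/-- Bound on the number of remaining steps. -/
noncomputable def trajVariant (p : Dims n) (i : Fin n) (s : Mem) : ℕ :=
  ⌊‖p.matAt s i‖ ^ 2 * ((p.M : ℝ) ^ 2 * p.B)⌋₊ * (p.M + 1) + (p.M - s.nat (3 * n + 11))

theorem ValidTraj.mem_le {p : Dims n} {i : Fin n} {X : Set (Vec (p.d i))}
    {m : Vec (p.d i) → Fin (p.k i) → ℝ} {s : Mem} {l : ℕ} (h : ValidTraj p i X m s l)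
    (hX : Metric.closedBall 0 1 ⊆ X) {r : ℕ} (hr : r ≤ l) : p.trajAt s i r ∈ X := by
  rcases r with _ | r
  · rw [h.zero]; exact hX (by simp)
  · exact h.mem r hr

/-- The effect of evaluating the features of the current point and the next point. -/
theorem advance_runs (i : Fin n) : ∃ f, IsPoly f ∧ ∀ (p : Dims n) (O : Oracles p.d p.k) (s : Mem)
    (W l : ℕ), p.Holds s → p.d i ≤ W → p.k i ≤ W → s.nat (3 * n + 11) = l → l < p.M →
    ∀ (P : Prog n) (T : ℕ) (Q : Mem → Prop),
    (∀ s', NatEq (3 * n + 13) s s' → p.Frame {3 * (i : ℕ) + 1, 3 * (i : ℕ) + 2} s s' →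
      (∀ r ≤ l, p.trajAt s' i r = p.trajAt s i r) → (∀ r < l, p.featAt s' i r = p.featAt s i r) →
      p.featAt s' i l = O.feat i (p.trajAt s i l) →
      p.trajAt s' i (l + 1) = app (p.matAt s i) (O.feat i (p.trajAt s i l)) →
      Runs O P s' T Q) →
    Runs O (.seq (.feat i (areaE n (3 * i + 1) + .var (3 * n + 11) * .var i)
      (areaE n (3 * i + 2) + .var (3 * n + 11) * .var (n + i))) (.seq (matVec i) P)) s
      (f W + T) Q := by
  obtain ⟨f, hf, hmv⟩ := matVec_runs i
  refine ⟨fun W => (W * 2 + 30) + f W, ((IsPoly.id.mul (.const _)).add (.const _)).add hf, ?_⟩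
  intro p O s W l hs hd hk hl hlM P T Q hP
  have hfH := p.feat_le_H i hlM.le
  have htH := p.traj_le_H i (l := l + 1) (by omega)
  have hlt : l * p.d i + p.d i = (l + 1) * p.d i := by ring
  rw [Nat.add_assoc]
  refine Runs.seq ((Runs.feat (Q := fun s' => s' = s.writeVec (p.adr (3 * i + 2) (l * p.k i))
    (O.feat i (p.trajAt s i l))) ?_).mono ?_ (fun _ h => h)) ?_
  · simp [hs.eval_areaE, hl, hs.d, hs.k, Dims.trajAt, Dims.adr_add]
  · simp; omega
  rintro _ rfl
  set s₁ := s.writeVec (p.adr (3 * i + 2) (l * p.k i)) (O.feat i (p.trajAt s i l)) with hs₁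
  have hn₁ : s₁.nat = s.nat := rfl
  have hs1 : p.Holds s₁ := hs.of_natEq le_rfl (NatEq.refl _ _)
  have hr₁ : ∀ b, b < p.adr (3 * i + 2) (l * p.k i) ∨ p.adr (3 * i + 2) (l * p.k i) + p.k i ≤ b →
      s₁.real b = s.real b := fun b hb => Mem.writeVec_real_of_notMem _ _ _ hb
  have fr₁ : p.Frame {3 * (i : ℕ) + 2} s s₁ := Dims.Frame.of_interval hfH hr₁
  have ft₁ : p.featAt s₁ i l = O.feat i (p.trajAt s i l) := by
    funext j
    rw [Dims.featAt, ← Dims.adr_add]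
    exact Mem.writeVec_real_of_lt _ _ _ j
  refine Runs.seq (hmv p O s₁ W l hs1 hd hk hl hlM) ?_
  rintro s₂ ⟨g₁, g₂, g₃⟩
  have fr₂ : p.Frame {3 * (i : ℕ) + 1} s₁ s₂ := Dims.Frame.of_interval htH g₂
  have hmat : p.matAt s₁ i = p.matAt s i :=
    Dims.matAt_congr fun o ho => fr₁.area _ (by simp) o ho
  have hft : ∀ r ≤ l, p.featAt s₂ i r = p.featAt s₁ i r := fun r hr =>
    Dims.featAt_congr fun o ho => fr₂.area _ (by simp) o (by
      have := p.feat_le_H i (hr.trans hlM.le); omega)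
  refine hP s₂ (fun a ha => (g₁ a ha)) ((fr₁.mono (by simp)).trans (fr₂.mono (by simp)))
    (fun r hr => ?_) (fun r hr => ?_) ?_ ?_
  · have hrl : r * p.d i ≤ l * p.d i := Nat.mul_le_mul_right _ hr
    trans p.trajAt s₁ i r
    · refine Dims.trajAt_congr fun o ho => g₂ _ (.inl ?_)
      unfold Dims.adr; omega
    · exact Dims.trajAt_congr fun o ho => fr₁.area _ (by simp) o (by omega)
  · rw [hft r hr.le]
    refine Dims.featAt_congr fun o ho => hr₁ _ (.inl ?_)
    have hrl : (r + 1) * p.k i ≤ l * p.k i := Nat.mul_le_mul_right _ hr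
    rw [Nat.add_mul] at hrl
    unfold Dims.adr; omega
  · rw [hft l le_rfl, ft₁]
  · rw [g₃, hmat, ft₁]

/-- The variant encodes a lexicographic order. Extending the trajectory lowers its second component;
a cut resets that component, to at most `M`, but lowers the integer part of `‖K‖² M² B` by at least
1, which weighs `M + 1`. -/
theorem trajStep_runs (i : Fin n) : ∃ f, IsPoly f ∧ ∀ (p : Dims n) (O : Oracles p.d p.k)
    (X : Set (Vec (p.d i))) (m : Vec (p.d i) → Fin (p.k i) → ℝ) (s₀ s : Mem) (W : ℕ),
    PlayerCorrect p O i X m → p.Holds s₀ → p.d i ≤ W → p.k i ≤ W → TrajInv p i X m s₀ s →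
    s.nat (3 * n + 11) < p.M →
    Runs O (trajStep i) s (f W) (fun s' => TrajInv p i X m s₀ s' ∧
      trajVariant p i s' < trajVariant p i s) := by
  obtain ⟨f, hf, hadv⟩ := advance_runs i
  obtain ⟨fs, hfs, hsq⟩ := sqNorm_runs i
  obtain ⟨fr, hfr, hro⟩ := rankOne_runs i
  refine ⟨fun W => f W + ((W * 2 + 50) + (3 + 1 + (fs W + (50 + (fr W + 3))) + 1)),
    hf.add (((IsPoly.id.mul (.const _)).add (.const _)).add (((IsPoly.const _).add
      (hfs.add ((IsPoly.const _).add (hfr.add (.const _))))).add (.const _))), ?_⟩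
  intro p O X m s₀ s W hp hs₀ hd hk hI hlM
  have hs : p.Holds s := hs₀.of_natEq (by omega) hI.nat
  obtain ⟨l, hl⟩ : ∃ l, s.nat (3 * n + 11) = l := ⟨_, rfl⟩
  rw [hl] at hlM
  have hval := hI.valid
  rw [hl] at hval
  have hxl := hval.mem_le hp.ball le_rfl
  have htH := p.traj_le_H i (l := l + 1) (by omega)
  have haH := p.ans_lt_H i
  refine hadv p O s W l hs hd hk hl hlM _ _ _ ?_
  intro s₂ n₂ r₂ t₂ ft₂ fl₂ tl₂
  rw [hp.feat_eq _ hxl] at fl₂ tl₂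
  have hs₂ : p.Holds s₂ := hs.of_natEq (by omega) n₂
  have hm₂ : p.matAt s₂ i = p.matAt s i :=
    Dims.matAt_congr fun o ho => r₂.area _ (by simp) o ho
  have hl₂ : s₂.nat (3 * n + 11) = l := (n₂ _ (by omega)).trans hl
  have hA : ({3 * (i : ℕ) + 1, 3 * (i : ℕ) + 2} : Set ℕ) ⊆ playerAreas n i := by
    intro q; simp only [playerAreas, Set.mem_insert_iff, Set.mem_singleton_iff]; omega
  have fr₀₂ : p.Frame (playerAreas n i) s₀ s₂ := hI.frame.trans (r₂.mono hA)
  have n₀₂ : NatEq (3 * n + 11) s₀ s₂ := hI.nat.trans (n₂.mono (by omega))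
  have hsrc : (areaE n (3 * i + 1) + (.var (3 * n + 11) + .const 1) * .var i : NExp).eval s₂ =
      p.adr (3 * i + 1) ((l + 1) * p.d i) := by
    simp [hs₂.eval_areaE, hl₂, hs₂.d, Dims.adr_add]
  have hv₂ : ValidTraj p i X m s₂ l := by
    refine ⟨?_, fun r hr => ?_, fun r hr => ?_, fun r hr => ?_⟩
    · rw [t₂ 0 (Nat.zero_le _), hval.zero]
    · rw [t₂ _ hr]; exact hval.mem r hr
    · rw [t₂ _ hr, t₂ _ hr.le, hm₂]; exact hval.step r hr
    · rw [ft₂ _ hr, t₂ _ hr.le]; exact hval.feat r hr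
  rw [← t₂ l le_rfl] at fl₂ tl₂
  refine Runs.seq ((Runs.sep (Q := fun s' => s' = s₂.writeSep (p.adr (3 * n) 0) (3 * n + 12)
    (O.sep i (p.trajAt s₂ i (l + 1)))) ?_).mono ?_ (fun _ h => h)) ?_
  · rw [hsrc, hs₂.eval_areaE]; rfl
  · simp; omega
  rintro _ rfl
  by_cases hx : p.trajAt s₂ i (l + 1) ∈ X
  · rw [hp.sep_mem _ hx]
    refine Runs.mono (T := 3 + 1 + 6 + 1) (Runs.ite (fun _ => ?_) (fun hb => ?_)) (by omega)
      (fun _ h => h)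
    · refine Runs.nset ?_
      have e : (NExp.var (3 * n + 11) + NExp.const 1).eval
          (s₂.writeSep (d := p.d i) (p.adr (3 * n) 0) (3 * n + 12) none) = l + 1 := by
        simp [Mem.writeSep, hl₂]
      rw [e, NExp.eval_const]
      simp only [Mem.writeSep]
      set s₄ := (s₂.setNat (3 * n + 12) 1).setNat (3 * n + 11) (l + 1) with hs₄
      have hr₄ : s₄.real = s₂.real := rfl
      have hl₄ : s₄.nat (3 * n + 11) = l + 1 := by simp [hs₄]
      have ht₄ : ∀ r, p.trajAt s₄ i r = p.trajAt s₂ i r := fun r => rfl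
      have hm₄ : p.matAt s₄ i = p.matAt s i := hm₂
      refine ⟨⟨?_, ?_, ?_, ?_, ?_⟩, ?_⟩
      · exact (n₀₂.setNat (by omega)).setNat (by omega)
      · exact fr₀₂.trans (Dims.Frame.of_real_eq hr₄)
      · rw [hl₄]; exact hlM
      · rw [hl₄]
        refine ⟨hv₂.zero, fun r hr => ?_, fun r hr => ?_, fun r hr => ?_⟩
        · rcases Nat.lt_succ_iff_lt_or_eq.1 hr with h | rfl
          · exact hv₂.mem r h
          · exact hx
        · rcases Nat.lt_succ_iff_lt_or_eq.1 hr with h | rfl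
          · exact hv₂.step r h
          · rw [hm₄]; exact tl₂
        · rcases Nat.lt_succ_iff_lt_or_eq.1 hr with h | rfl
          · exact hv₂.feat r h
          · exact fl₂
      · rw [hm₄]; exact hI.pot
      · rw [trajVariant, trajVariant, hm₄, hl₄, hl]; omega
    · exact absurd (by simp [Mem.writeSep]) hb
  · obtain ⟨a, b, hab, hax, haX⟩ := hp.sep_not_mem _ hx
    rw [hab]
    set s₃ := s₂.writeSep (p.adr (3 * n) 0) (3 * n + 12) (some (a, b)) with hs₃
    have hr₃ : ∀ q, q < p.adr (3 * n) 0 ∨ p.adr (3 * n) 0 + (p.d i + 1) ≤ q →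
        s₃.real q = s₂.real q := fun q hq => by
      simp only [hs₃, Mem.writeSep, Mem.setReal_real]
      rw [if_neg (by omega), Mem.writeVec_real_of_notMem _ _ _ (by omega)]
      rfl
    have fr₃ : p.Frame {3 * n} s₂ s₃ := Dims.Frame.of_interval (by omega) hr₃
    have ha₃ : s₃.readVec (p.d i) (p.adr (3 * n) 0) = a := by
      ext c
      simp only [hs₃, Mem.readVec, Mem.writeSep, Mem.setReal_real]
      rw [if_neg (by omega)]
      exact Mem.writeVec_real_of_lt _ _ _ c
    have hb₃ : s₃.real (p.adr (3 * n) (p.d i)) = b := by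
      have : p.adr (3 * n) (p.d i) = p.adr (3 * n) 0 + p.d i := by rw [p.adr_add, Nat.zero_add]
      rw [this, hs₃]
      simp [Mem.writeSep]
    have n₃ : NatEq (3 * n + 12) s₂ s₃ := fun q hq => by
      have : s₃.nat q = (s₂.setNat (3 * n + 12) 0).nat q := rfl
      rw [this, Mem.setNat_nat, if_neg (by omega)]
    have hflag : s₃.nat (3 * n + 12) = 0 := by
      have : s₃.nat (3 * n + 12) = (s₂.setNat (3 * n + 12) 0).nat (3 * n + 12) := rfl
      rw [this]; simp
    have hs3 : p.Holds s₃ := hs₂.of_natEq (by omega) n₃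
    refine Runs.mono (T := 4 + (fs W + (50 + (fr W + 3))) + 1)
      (Runs.ite (fun hb => ?_) (fun _ => ?_)) (by omega) (fun _ h => h)
    · exact absurd hb (by simp [hflag])
    refine Runs.seq (hsq p O s₃ W hs3 hd) ?_
    rintro s₄ ⟨n₄, fr₄, e₄⟩
    rw [ha₃] at e₄
    have hs4 : p.Holds s₄ := hs3.of_natEq (by omega) n₄
    have hans : ∀ o < p.H, s₄.real (p.adr (3 * n) o) = s₃.real (p.adr (3 * n) o) := fun o ho =>
      fr₄.area _ (by simp) o ho
    -- The scalar cell holds `‖a‖²` and is overwritten by the coefficient of `cut_step`; the offset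
    -- `b` is stored right after the normal vector.
    refine Runs.seq ((Runs.rset (Q := fun s' => s' = s₄.setReal (p.adr (3 * n + 1) 0)
      (-(b / (‖a‖ ^ 2 * (p.M * p.B))))) ?_).mono (by simp) (fun _ h => h)) ?_
    · simp [hs4.eval_areaE, hs4.d, hs4.M, hs4.B, e₄, Dims.adr_add, hans _ (show p.d i < p.H by omega),
        hb₃]
    rintro _ rfl
    set s₅ := s₄.setReal (p.adr (3 * n + 1) 0) (-(b / (‖a‖ ^ 2 * (p.M * p.B)))) with hs₅
    have fr₅ : p.Frame {3 * n + 1} s₄ s₅ := by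
      refine Dims.Frame.of_interval (o := 0) (w := 1) (by omega) fun q hq => ?_
      rw [hs₅, Mem.setReal_real, if_neg (by omega)]
    have hs5 : p.Holds s₅ := hs4.of_natEq le_rfl (NatEq.refl _ _)
    have hl₅ : s₅.nat (3 * n + 11) = l := by
      have : s₅.nat = s₄.nat := rfl
      rw [this, n₄ _ (by omega), n₃ _ (by omega), hl₂]
    have fr₂₅ : p.Frame {3 * n, 3 * n + 1} s₂ s₅ :=
      ((fr₃.mono (by simp)).trans (fr₄.mono (by simp))).trans (fr₅.mono (by simp))
    have ha₅ : s₅.readVec (p.d i) (p.adr (3 * n) 0) = a := by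
      rw [← ha₃]
      ext c
      simp only [Mem.readVec, Dims.adr_add, Nat.zero_add]
      rw [fr₅.area _ (by simp) _ (by omega), hans _ (by omega)]
    have hc₅ : s₅.real (p.adr (3 * n + 1) 0) = -(b / (‖a‖ ^ 2 * (p.M * p.B))) := by
      simp [hs₅]
    have hm₅ : p.matAt s₅ i = p.matAt s i := by
      rw [← hm₂]
      exact Dims.matAt_congr fun o ho => fr₂₅.area _ (by simp; omega) o ho
    have hf₅ : p.featAt s₅ i l = m (p.trajAt s₂ i l) := by
      rw [← fl₂]
      exact Dims.featAt_congr fun o ho => fr₂₅.area _ (by simp; omega) o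
        (ho.trans_le (p.feat_le_H i hlM.le))
    refine Runs.seq (hro p O s₅ W l hs5 hd hk hl₅ hlM) ?_
    rintro s₆ ⟨n₆, fr₆, e₆⟩
    rw [ha₅, hc₅, hm₅, hf₅] at e₆
    refine Runs.nset ?_
    simp only [NExp.eval_const]
    set s₇ := s₆.setNat (3 * n + 11) 0 with hs₇
    have hl₇ : s₇.nat (3 * n + 11) = 0 := by simp [hs₇]
    have hm₇ : p.matAt s₇ i = p.matAt s₆ i := rfl
    have fr₂₇ : p.Frame {3 * (i : ℕ), 3 * n, 3 * n + 1} s₂ s₇ :=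
      ((fr₂₅.mono (by intro; simp; tauto)).trans (fr₆.mono (by simp))).trans
        (Dims.Frame.of_real_eq rfl)
    have hxX : p.trajAt s₂ i l ∈ X := hv₂.mem_le hp.ball le_rfl
    rw [tl₂] at hax
    have hM1 : (1 : ℝ) ≤ p.M := by exact_mod_cast hp.one_le_M
    have hB1 : (1 : ℝ) ≤ p.B := by exact_mod_cast hp.one_le_B
    -- The cut uses the features of the last point still in `X`: there the comparators are known to
    -- map into `X`, while `K` does not.
    have hcut : ∀ K' : Mat (p.d i) (p.k i), (∀ y ∈ X, app K' (m y) ∈ X) →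
        ‖p.matAt s₇ i - (1 - 1 / (p.M : ℝ)) • K'‖ ^ 2 ≤
        ‖p.matAt s i - (1 - 1 / (p.M : ℝ)) • K'‖ ^ 2 - 1 / ((p.M : ℝ) ^ 2 * p.B) := fun K' hK' => by
      rw [hm₇, e₆]
      exact cut_step hp.ball haX hax (hK' _ hxX) hM1 hB1 (hp.feat_le _ hxX)
    have hpos : 0 ≤ 1 / ((p.M : ℝ) ^ 2 * p.B) := by positivity
    refine ⟨⟨?_, ?_, ?_, ?_, ?_⟩, ?_⟩
    · refine NatEq.setNat ?_ le_rfl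
      exact ((n₀₂.trans (n₃.mono (by omega))).trans (n₄.mono (by omega))).trans
        (n₆.mono (by omega))
    · refine fr₀₂.trans (fr₂₇.mono ?_)
      intro q
      simp only [playerAreas, Set.mem_insert_iff, Set.mem_singleton_iff]; omega
    · rw [hl₇]; omega
    · rw [hl₇]
      refine ⟨?_, fun r hr => by omega, fun r hr => by omega, fun r hr => by omega⟩
      rw [← hv₂.zero]
      exact Dims.trajAt_congr fun o ho => fr₂₇.area _ (by simp; omega) o (by
        have := p.traj_le_H i (Nat.zero_le p.M); omega)
    · intro K' hK'
      exact ((hcut K' hK').trans (by linarith)).trans (hI.pot K' hK')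
    · have h0 := hcut 0 (fun y _ => by rw [app_zero]; exact hp.ball (by simp))
      rw [smul_zero, sub_zero, sub_zero] at h0
      have hc : (0 : ℝ) < (p.M : ℝ) ^ 2 * p.B := by positivity
      have h1 : ‖p.matAt s₇ i‖ ^ 2 * ((p.M : ℝ) ^ 2 * p.B) + 1 ≤
          ‖p.matAt s i‖ ^ 2 * ((p.M : ℝ) ^ 2 * p.B) := by
        have := mul_le_mul_of_nonneg_right h0 hc.le
        rw [sub_mul, one_div, inv_mul_cancel₀ hc.ne'] at this
        linarith
      have h2 := Nat.floor_le_floor h1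
      rw [Nat.floor_add_one (by positivity)] at h2
      have h3 := Nat.mul_le_mul_right (p.M + 1) h2
      rw [Nat.add_mul] at h3
      rw [trajVariant, trajVariant, hl₇]
      omega

/-- The hypothesis on `W` bounds the initial value of the variant, hence the number of steps
including restarts. Point 0 of the trajectory is never written, so it stays 0. -/
theorem traj_runs (i : Fin n) : ∃ f, IsPoly f ∧ ∀ (p : Dims n) (O : Oracles p.d p.k)
    (X : Set (Vec (p.d i))) (m : Vec (p.d i) → Fin (p.k i) → ℝ) (s : Mem) (W : ℕ),
    PlayerCorrect p O i X m → p.Holds s → p.d i ≤ W → p.k i ≤ W → p.trajAt s i 0 = 0 →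
    ⌊‖p.matAt s i‖ ^ 2 * ((p.M : ℝ) ^ 2 * p.B)⌋₊ * (p.M + 1) + p.M ≤ W →
    Runs O (traj i) s (f W) (fun s' => TrajInv p i X m s s' ∧ s'.nat (3 * n + 11) = p.M) := by
  obtain ⟨f, hf, hstep⟩ := trajStep_runs i
  refine ⟨fun W => 3 + (W * (f W + 5 + 1) + 5 + 1), (IsPoly.const _).add (((IsPoly.id.mul
    ((hf.add (.const _)).add (.const _))).add (.const _)).add (.const _)), ?_⟩
  intro p O X m s W hp hs hd hk h0 hW
  refine Runs.seq (Runs.nset (Q := fun s' => s' = s.setNat (3 * n + 11) 0) (by simp)) ?_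
  rintro _ rfl
  refine (Runs.loop (TrajInv p i X m s) (trajVariant p i) (f W) ?_ (s.setNat (3 * n + 11) 0)
    ⟨(NatEq.refl _ _).setNat le_rfl, Dims.Frame.of_real_eq rfl, by simp, ?_, fun K' _ => le_rfl⟩).mono
    ?_ ?_
  · intro s' hI hlt
    simp only [BExp.holds_nlt, NExp.eval_var, (hs.of_natEq (by omega) hI.nat).M] at hlt
    exact hstep p O X m s s' W hp hs hd hk hI hlt
  · rw [Mem.setNat_nat, if_pos rfl]
    exact ⟨h0, fun r hr => by omega, fun r hr => by omega, fun r hr => by omega⟩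
  · have h1 : trajVariant p i (s.setNat (3 * n + 11) 0) ≤ W := by
      have e : p.matAt (s.setNat (3 * n + 11) 0) i = p.matAt s i := rfl
      rw [trajVariant, e]; simpa using hW
    have := Nat.mul_le_mul_right (f W + 5 + 1) h1
    have e : (BExp.nlt (.var (3 * n + 11)) (.var (2 * n))).cost = 5 := rfl
    rw [e]
    omega
  · rintro s' ⟨hI, hn⟩
    simp only [BExp.holds_nlt, NExp.eval_var, (hs.of_natEq (by omega) hI.nat).M] at hn
    exact ⟨hI, by have := hI.le; omega⟩

end Trajectory

/-! ### Digits -/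

section Digits

variable {n : ℕ}

/-- Split the content of cell `3 n + 10` into quotient and remainder modulo `M`. The remainder is
stored in cell `2 n + 10 + i`. -/
def divMod (i : Fin n) : Prog n :=
  .seq (.nset (.const (2 * n + 10 + i)) (.var (3 * n + 10)))
    (.seq (.nset (.const (3 * n + 10)) (.const 0))
      (.loop (.not (.nlt (.var (2 * n + 10 + i)) (.var (2 * n))))
        (.seq (.nset (.const (2 * n + 10 + i)) (.sub (.var (2 * n + 10 + i)) (.var (2 * n))))
          (.nset (.const (3 * n + 10)) (.var (3 * n + 10) + .const 1)))))

/-- The machine does not divide natural numbers, so the quotient is found by repeated subtraction.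
Since `M ≥ 1`, this takes at most `v` passes. -/
theorem divMod_runs {p : Dims n} {O : Oracles p.d p.k} (i : Fin n) {s : Mem} (hs : p.Holds s)
    (hM : 1 ≤ p.M) {v W : ℕ} (hv : s.nat (3 * n + 10) = v) (hW : v ≤ W) :
    Runs O (divMod i) s (W * 30 + 30) (fun s' => s'.real = s.real ∧
      s'.nat (3 * n + 10) = v / p.M ∧ s'.nat (2 * n + 10 + i) = v % p.M ∧
      ∀ a, a ≠ 3 * n + 10 → a ≠ 2 * n + 10 + i → s'.nat a = s.nat a) := by
  refine (Runs.seq (T := 10) (T' := 10 + (W * 30 + 9)) ((Runs.nset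
    (Q := fun s' => s' = s.setNat (2 * n + 10 + i) v) (by simp [hv])).mono (by simp)
    (fun _ h => h)) ?_).mono (by omega) (fun _ h => h)
  rintro _ rfl
  refine Runs.seq ((Runs.nset (Q := fun s' => s' = (s.setNat (2 * n + 10 + i) v).setNat
    (3 * n + 10) 0) (by simp)).mono (by simp) (fun _ h => h)) ?_
  rintro _ rfl
  refine (Runs.loop (fun s' => s'.real = s.real ∧
    s'.nat (3 * n + 10) * p.M + s'.nat (2 * n + 10 + i) = v ∧
      ∀ a, a ≠ 3 * n + 10 → a ≠ 2 * n + 10 + i → s'.nat a = s.nat a)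
    (fun s' => s'.nat (2 * n + 10 + i)) (7 + 6) ?_ _ ?_).mono ?_ ?_
  · rintro s' ⟨h₁, h₂, h₃⟩ hb
    have hM' : s'.nat (2 * n) = p.M := (h₃ _ (by omega) (by omega)).trans hs.M
    simp only [BExp.holds, NExp.eval_var, hM', not_lt] at hb
    refine Runs.seq ((Runs.nset (Q := fun s'' => s'' = s'.setNat (2 * n + 10 + i)
      (s'.nat (2 * n + 10 + i) - p.M)) (by simp [hM'])).mono (by simp) (fun _ h => h)) ?_
    rintro _ rfl
    refine Runs.nset ?_
    have hne : 2 * n + 10 + (i : ℕ) ≠ 3 * n + 10 := by omega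
    simp only [NExp.eval_const, NExp.eval_add, NExp.eval_var, Mem.setNat_nat, Mem.setNat_real,
      if_neg hne, if_neg hne.symm, if_true]
    refine ⟨⟨h₁, ?_, fun a h h' => ?_⟩, by omega⟩
    · rw [Nat.add_mul]; omega
    · rw [if_neg h, if_neg h', h₃ a h h']
  · have hne : 2 * n + 10 + (i : ℕ) ≠ 3 * n + 10 := by omega
    refine ⟨rfl, ?_, fun a h h' => ?_⟩
    · simp [hne]
    · simp [h, h']
  · have hne : 2 * n + 10 + (i : ℕ) ≠ 3 * n + 10 := by omega
    have e : (BExp.not (.nlt (.var (2 * n + 10 + i)) (.var (2 * n)))).cost = 6 := rfl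
    simp only [e, Mem.setNat_nat, if_neg hne, if_true]
    omega
  · rintro s' ⟨⟨h₁, h₂, h₃⟩, hb⟩
    have hM' : s'.nat (2 * n) = p.M := (h₃ _ (by omega) (by omega)).trans hs.M
    simp only [BExp.holds, NExp.eval_var, hM', not_lt, not_le] at hb
    refine ⟨h₁, ?_, ?_, h₃⟩
    · rw [← h₂, Nat.mul_comm _ p.M, Nat.mul_add_div (by omega), Nat.div_eq_of_lt hb]
      rfl
    · rw [← h₂, Nat.mul_comm _ p.M, Nat.mul_add_mod, Nat.mod_eq_of_lt hb]

/-- The base-`M` digits of `τ`. -/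
def digit (M τ i : ℕ) : ℕ := τ / M ^ i % M

/-- Write the digits of the content of cell `2 n + 9` to the cells `2 n + 10 + i`. -/
def digits (n : ℕ) : Prog n :=
  .seq (.nset (.const (3 * n + 10)) (.var (2 * n + 9))) (Prog.seqs ((List.finRange n).map divMod))

/-- Used with `Runs.seqs`: after the players before `i`, exactly `i` digits have been split off. -/
theorem length_of_finRange_eq {l₁ l₂ : List (Fin n)} {i : Fin n}
    (h : List.finRange n = l₁ ++ i :: l₂) : l₁.length = i := by
  have h1 : (List.finRange n)[l₁.length]? = some i := by rw [h]; simp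
  rw [List.getElem?_eq_some_iff] at h1
  obtain ⟨h2, h3⟩ := h1
  rw [List.getElem_finRange] at h3
  rw [← h3]; rfl

theorem digits_runs {p : Dims n} {O : Oracles p.d p.k} {s : Mem} (hs : p.Holds s)
    (hM : 1 ≤ p.M) {τ W : ℕ} (hτ : s.nat (2 * n + 9) = τ) (hW : τ ≤ W) :
    Runs O (digits n) s (n * (W * 30 + 30) + 10) (fun s' => s'.real = s.real ∧
      NatEq (2 * n + 10) s s' ∧ ∀ i : Fin n, s'.nat (2 * n + 10 + i) = digit p.M τ i) := by
  refine (Runs.seq (T := 5) (T' := n * (W * 30 + 30) + 1) ((Runs.nset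
    (Q := fun s' => s' = s.setNat (3 * n + 10) τ) (by simp [hτ])).mono (by simp)
    (fun _ h => h)) ?_).mono (by omega) (fun _ h => h)
  rintro _ rfl
  refine (Runs.seqs (W * 30 + 30) divMod (List.finRange n) (fun l s' => s'.real = s.real ∧
    NatEq (2 * n + 10) s s' ∧ s'.nat (3 * n + 10) = τ / p.M ^ l.length ∧
      ∀ i : Fin n, (i : ℕ) < l.length → s'.nat (2 * n + 10 + i) = digit p.M τ i) ?_ _ ?_).mono ?_ ?_
  · rintro l₁ i l₂ hl s' ⟨h₁, h₂, h₃, h₄⟩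
    have hi := length_of_finRange_eq hl
    refine (divMod_runs i (hs.of_natEq (by omega) h₂) hM h₃
      ((Nat.div_le_self _ _).trans hW)).mono le_rfl ?_
    rintro s'' ⟨g₁, g₂, g₃, g₄⟩
    refine ⟨g₁.trans h₁, fun a ha => (g₄ a (by omega) (by omega)).trans (h₂ a ha), ?_, ?_⟩
    · rw [g₂, Nat.div_div_eq_div_mul, List.length_append, List.length_singleton, pow_succ]
    · intro j hj
      rw [List.length_append, List.length_singleton] at hj
      rcases Nat.lt_or_ge j l₁.length with hj' | hj'
      · rw [g₄ _ (by omega) (by omega), h₄ j hj']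
      · obtain rfl : j = i := Fin.ext (by omega)
        rw [g₃, digit, hi]
  · exact ⟨rfl, (NatEq.refl _ _).setNat (by omega), by simp, fun i hi => by simp at hi⟩
  · simp
  · rintro s' ⟨h₁, h₂, -, h₄⟩
    exact ⟨h₁, h₂, fun i => h₄ i (by simp)⟩

end Digits

/-! ### Profiles in memory -/

section Profiles

variable {n : ℕ}

theorem offset_add_le_offset {d : Fin n → ℕ} {i j : Fin n} (h : i < j) :
    Mem.offset d i + d i ≤ Mem.offset d j := by
  have h1 : insert i (Finset.Iio i) ⊆ Finset.Iio j := by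
    intro a
    simp only [Finset.mem_insert, Finset.mem_Iio]
    rintro (rfl | ha)
    · exact h
    · exact ha.trans h
  have h2 := Finset.sum_le_sum_of_subset (f := d) h1
  rw [Finset.sum_insert (by simp)] at h2
  unfold Mem.offset
  omega

theorem offset_add_le_sum (d : Fin n → ℕ) (i : Fin n) : Mem.offset d i + d i ≤ ∑ j, d j := by
  have h2 := Finset.sum_le_sum_of_subset (f := d) (Finset.subset_univ (insert i (Finset.Iio i)))
  rw [Finset.sum_insert (by simp)] at h2
  unfold Mem.offset
  omega

/-- Only block `i` of the profile at address `a` has changed. -/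
theorem readProfile_update {d : Fin n → ℕ} {s s' : Mem} {a : ℕ} (i : Fin n)
    (h : ∀ b, b < a + Mem.offset d i ∨ a + Mem.offset d i + d i ≤ b → s'.real b = s.real b) :
    s'.readProfile d a =
      Function.update (s.readProfile d a) i (s'.readVec (d i) (a + Mem.offset d i)) := by
  funext j
  by_cases hj : j = i
  · subst hj; simp [Mem.readProfile]
  · rw [Function.update_of_ne hj]
    ext c
    simp only [Mem.readProfile, Mem.readVec]
    apply h
    rcases lt_or_gt_of_ne hj with hlt | hlt
    · have := offset_add_le_offset (d := d) hlt; omega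
    · have := offset_add_le_offset (d := d) hlt; omega

/-- The start of block `i` of a profile. -/
def offE (i : Fin n) : NExp :=
  .sum ((List.finRange n).map (fun j => if j < i then .var j else .const 0))

theorem Dims.Holds.eval_offE {p : Dims n} {s : Mem} (h : p.Holds s) (i : Fin n) :
    (offE i).eval s = Mem.offset p.d i := by
  rw [offE, NExp.eval_sum, List.map_map, ← List.ofFn_eq_map, List.sum_ofFn, Mem.offset]
  have : ∀ j : Fin n, (NExp.eval s ∘ fun j : Fin n => if j < i then NExp.var j else .const 0) j =
      if j < i then p.d j else 0 := fun j => by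
    by_cases hj : j < i <;> simp [hj, h.d]
  simp only [this]
  rw [← Finset.sum_filter]
  congr 1
  ext j
  simp

/-- The address of the current output block, for the point number `t N + τ`. -/
def outE (n : ℕ) : NExp :=
  (.var (2 * n + 8) * .var (2 * n + 4) + .var (2 * n + 9)) * .var (2 * n + 5)

theorem Dims.Holds.eval_outE {p : Dims n} {s : Mem} (h : p.Holds s) {t τ : ℕ}
    (ht : s.nat (2 * n + 8) = t) (hτ : s.nat (2 * n + 9) = τ) :
    (outE n).eval s = (t * p.N + τ) * p.S := by
  simp [outE, h.N, h.S, ht, hτ]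

end Profiles

/-! ### The points of a round -/

section Emit

variable {n : ℕ}

/-- The trajectories `x` and their features `F` are stored in memory. -/
structure Stored (p : Dims n) (x : (i : Fin n) → ℕ → Vec (p.d i))
    (F : (i : Fin n) → ℕ → Fin (p.k i) → ℝ) (s : Mem) : Prop where
  traj : ∀ i, ∀ l ≤ p.M, p.trajAt s i l = x i l
  feat : ∀ i, ∀ l < p.M, p.featAt s i l = F i l

/-- The areas of the matrices and the shared areas. -/
def emitAreas (n : ℕ) : Set ℕ := {q | q % 3 = 0 ∨ q = 3 * n + 1}

theorem Stored.of_frame {p : Dims n} {x : (i : Fin n) → ℕ → Vec (p.d i)}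
    {F : (i : Fin n) → ℕ → Fin (p.k i) → ℝ} {s s' : Mem} (h : Stored p x F s)
    (hf : ∀ q ∉ emitAreas n, ∀ o < p.H, s'.real (p.adr q o) = s.real (p.adr q o)) :
    Stored p x F s' := by
  refine ⟨fun i l hl => ?_, fun i l hl => ?_⟩
  · rw [← h.traj i l hl]
    exact Dims.trajAt_congr fun o ho => hf _ (by simp [emitAreas]; omega) o
      (ho.trans_le (p.traj_le_H i hl))
  · rw [← h.feat i l hl]
    exact Dims.featAt_congr fun o ho => hf _ (by simp [emitAreas]; omega) o
      (ho.trans_le (p.feat_le_H i hl.le))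

/-- The memory is at point `τ` of round `t`. -/
structure AtPoint (p : Dims n) (t τ : ℕ) (s : Mem) : Prop where
  holds : p.Holds s
  round : s.nat (2 * n + 8) = t
  point : s.nat (2 * n + 9) = τ
  dig : ∀ i : Fin n, s.nat (2 * n + 10 + i) = digit p.M τ i

theorem AtPoint.of_natEq {p : Dims n} {t τ : ℕ} {s s' : Mem} (h : AtPoint p t τ s)
    (he : NatEq (3 * n + 11) s s') : AtPoint p t τ s' :=
  ⟨h.holds.of_natEq (by omega) he, (he _ (by omega)).trans h.round,
    (he _ (by omega)).trans h.point, fun i => (he _ (by omega)).trans (h.dig i)⟩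

/-- The contribution of the point picked by `ℓ` to the gradient of player `i`. -/
noncomputable def gradTerm {p : Dims n} (O : Oracles p.d p.k) (x : (i : Fin n) → ℕ → Vec (p.d i))
    (F : (i : Fin n) → ℕ → Fin (p.k i) → ℝ) (i : Fin n) (ℓ : Fin n → ℕ) : Mat (p.d i) (p.k i) :=
  outer (O.grad i (Function.update (pick x ℓ) i (x i (ℓ i + 1)))) (F i (ℓ i))

/-- The step size. -/
noncomputable def Dims.step (p : Dims n) : ℝ := 1 / ((p.B : ℝ) * p.M * p.N)

/-- Add the contribution of the current point to the matrix of player `i`. -/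
def gradStep (i : Fin n) : Prog n :=
  .seq (copyTraj i (.var (2 * n + 10 + i) + .const 1) (outE n + .const 1 + offE i))
    (.seq (.grad i (outE n + .const 1) (areaE n (3 * n)))
      (.seq (.rset (areaE n (3 * n + 1)) (.ofNat (.const 1) / (.ofNat (.var (2 * n + 2)) *
          .ofNat (.var (2 * n)) * .ofNat (.var (2 * n + 4)))))
        (.seq (.nset (.const (3 * n + 11)) (.var (2 * n + 10 + i)))
          (.seq (rankOne i) (copyTraj i (.var (2 * n + 10 + i)) (outE n + .const 1 + offE i))))))

theorem digit_lt {M : ℕ} (hM : 1 ≤ M) (τ i : ℕ) : digit M τ i < M := Nat.mod_lt _ hM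

theorem Dims.out_add_S_le {p : Dims n} {t τ : ℕ} (ht : t < p.T) (hτ : τ < p.N) :
    (t * p.N + τ) * p.S + p.S ≤ p.base := by
  have h1 : t * p.N + τ + 1 ≤ p.T * p.N := by
    have : (t + 1) * p.N ≤ p.T * p.N := Nat.mul_le_mul_right _ ht
    rw [Nat.add_mul] at this; omega
  have := Nat.mul_le_mul_right p.S h1
  rw [Nat.add_mul _ 1, Nat.one_mul] at this
  exact this

/-- The oracle is queried at a modified profile. Block `i` of the output point is temporarily
replaced by the next trajectory point and restored afterwards, so the output is unchanged in the
end. -/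
theorem gradStep_runs (i : Fin n) : ∃ f, IsPoly f ∧ ∀ (p : Dims n) (O : Oracles p.d p.k)
    (x : (i : Fin n) → ℕ → Vec (p.d i)) (F : (i : Fin n) → ℕ → Fin (p.k i) → ℝ) (s : Mem)
    (W t τ : ℕ), AtPoint p t τ s → Stored p x F s → 1 ≤ p.M → p.S ≤ W → p.k i ≤ W → t < p.T →
    τ < p.N → s.readProfile p.d ((t * p.N + τ) * p.S + 1) = pick x (fun j => digit p.M τ j) →
    Runs O (gradStep i) s (f W) (fun s' => NatEq (3 * n + 11) s s' ∧
      p.Frame {3 * (i : ℕ), 3 * n, 3 * n + 1} s s' ∧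
      p.matAt s' i = p.matAt s i + p.step • gradTerm O x F i (fun j => digit p.M τ j)) := by
  obtain ⟨f₁, hf₁, hc₁⟩ := copyTraj_runs i (.var (2 * n + 10 + i) + .const 1)
    (outE n + .const 1 + offE i)
  obtain ⟨f₂, hf₂, hc₂⟩ := copyTraj_runs i (.var (2 * n + 10 + i)) (outE n + .const 1 + offE i)
  obtain ⟨fr, hfr, hro⟩ := rankOne_runs i
  refine ⟨fun W => f₁ W + ((W * 2 + 50) + (50 + (50 + (fr W + f₂ W)))),
    hf₁.add (((IsPoly.id.mul (.const _)).add (.const _)).add ((IsPoly.const _).add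
      ((IsPoly.const _).add (hfr.add hf₂)))), ?_⟩
  intro p O x F s W t τ hs hst hM hS hk ht hτ hprof
  have hd : p.d i ≤ W := (p.d_lt_S i).le.trans hS
  have hdig := digit_lt hM τ i
  have haH := p.ans_lt_H i
  obtain ⟨E, hE⟩ : ∃ E, (t * p.N + τ) * p.S = E := ⟨_, rfl⟩
  have hES : E + p.S ≤ p.base := hE ▸ Dims.out_add_S_le ht hτ
  have hSsum : p.S = 1 + ∑ j, p.d j := rfl
  have hoff := offset_add_le_sum p.d i
  rw [hE] at hprof
  have hdst : ∀ s', NatEq (3 * n + 11) s s' →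
      (outE n + .const 1 + offE i : NExp).eval s' = E + 1 + Mem.offset p.d i := fun s' h => by
    have h' := hs.of_natEq h
    simp [h'.holds.eval_outE h'.round h'.point, h'.holds.eval_offE, hE]
  refine Runs.seq (hc₁ p O s W (digit p.M τ i + 1) (E + 1 + Mem.offset p.d i) hs.holds hd hdig
    (fun s' h => ?_) (fun s' h => hdst s' (h.mono (by omega))) (by omega)) ?_
  · simp [h _ (show 2 * n + 10 + (i : ℕ) < 3 * n + 13 by omega), hs.dig]
  rintro s₁ ⟨n₁, r₁, e₁⟩
  rw [hst.traj i _ hdig] at e₁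
  have hs₁ := hs.of_natEq (n₁.mono (by omega))
  have hprof₁ : s₁.readProfile p.d (E + 1) =
      Function.update (pick x (fun j => digit p.M τ j)) i (x i (digit p.M τ i + 1)) := by
    rw [readProfile_update i r₁, hprof, e₁]
  refine Runs.seq ((Runs.grad (Q := fun s' => s' = s₁.writeVec (p.adr (3 * n) 0)
    (fun c => O.grad i (Function.update (pick x (fun j => digit p.M τ j)) i
      (x i (digit p.M τ i + 1))) c)) ?_).mono ?_ (fun _ h => h)) ?_
  · have e : (outE n + .const 1 : NExp).eval s₁ = E + 1 := by
      simp [hs₁.holds.eval_outE hs₁.round hs₁.point, hE]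
    rw [e, hs₁.holds.eval_areaE, hprof₁]
  · simp [outE]; omega
  rintro _ rfl
  set g := O.grad i (Function.update (pick x (fun j => digit p.M τ j)) i (x i (digit p.M τ i + 1)))
    with hg
  set s₂ := s₁.writeVec (p.adr (3 * n) 0) (fun c => g c) with hs2
  have hs₂ : AtPoint p t τ s₂ := hs₁.of_natEq (NatEq.refl _ _)
  have fr₂ : p.Frame {3 * n} s₁ s₂ := Dims.Frame.of_interval (o := 0) (w := p.d i) (by omega)
    fun b hb => Mem.writeVec_real_of_notMem _ _ _ hb
  have hg₂ : s₂.readVec (p.d i) (p.adr (3 * n) 0) = g := by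
    ext c
    exact Mem.writeVec_real_of_lt _ _ _ c
  refine Runs.seq ((Runs.rset (Q := fun s' => s' = s₂.setReal (p.adr (3 * n + 1) 0) p.step)
    ?_).mono (by simp) (fun _ h => h)) ?_
  · simp [hs₂.holds.eval_areaE, hs₂.holds.B, hs₂.holds.M, hs₂.holds.N, Dims.step]
  rintro _ rfl
  set s₃ := s₂.setReal (p.adr (3 * n + 1) 0) p.step with hs3
  have hs₃ : AtPoint p t τ s₃ := hs₂.of_natEq (NatEq.refl _ _)
  have fr₃ : p.Frame {3 * n + 1} s₂ s₃ := by
    refine Dims.Frame.of_interval (o := 0) (w := 1) (by omega) fun q hq => ?_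
    rw [hs3, Mem.setReal_real, if_neg (by omega)]
  have hg₃ : s₃.readVec (p.d i) (p.adr (3 * n) 0) = g := by
    rw [← hg₂]
    ext c
    simp only [Mem.readVec, Dims.adr_add, Nat.zero_add]
    exact fr₃.area _ (by simp) _ (by omega)
  have hc₃ : s₃.real (p.adr (3 * n + 1) 0) = p.step := by simp [hs3]
  -- `rankOne` takes the index of the feature vector from this cell.
  refine Runs.seq ((Runs.nset (Q := fun s' => s' = s₃.setNat (3 * n + 11) (digit p.M τ i))
    ?_).mono (by simp) (fun _ h => h)) ?_
  · simp [hs₃.dig]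
  rintro _ rfl
  set s₄ := s₃.setNat (3 * n + 11) (digit p.M τ i) with hs4
  have n₄ : NatEq (3 * n + 11) s₃ s₄ := (NatEq.refl _ _).setNat le_rfl
  have hs₄ := hs₃.of_natEq n₄
  have a₁ : ∀ q o, s₁.real (p.adr q o) = s.real (p.adr q o) := fun q o => r₁ _ (by
    have := p.base_le_adr q o; omega)
  have a₄ : ∀ q ≠ 3 * n, q ≠ 3 * n + 1 → ∀ o < p.H, s₄.real (p.adr q o) = s.real (p.adr q o) :=
    fun q h h' o ho => by
      rw [← a₁, ← fr₂.area q (by simpa using h) o ho]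
      exact fr₃.area q (by simpa using h') o ho
  have o₄ : ∀ b < p.base, s₄.real b = s₁.real b := fun b hb => by
    rw [← fr₂.out b hb]; exact fr₃.out b hb
  refine Runs.seq (hro p O s₄ W (digit p.M τ i) hs₄.holds hd hk (by simp [hs4]) hdig) ?_
  rintro s₅ ⟨n₅, fr₅, e₅⟩
  have hm₄ : p.matAt s₄ i = p.matAt s i :=
    Dims.matAt_congr fun o ho => a₄ _ (by omega) (by omega) o ho
  have hf₄ : p.featAt s₄ i (digit p.M τ i) = F i (digit p.M τ i) := by
    rw [← hst.feat i _ hdig]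
    exact Dims.featAt_congr fun o ho => a₄ _ (by omega) (by omega) o
      (ho.trans_le (p.feat_le_H i hdig.le))
  have hg₄ : s₄.readVec (p.d i) (p.adr (3 * n) 0) = g := hg₃
  have hc₄ : s₄.real (p.adr (3 * n + 1) 0) = p.step := hc₃
  rw [hm₄, hf₄, hg₄, hc₄] at e₅
  have n₀₅ : NatEq (3 * n + 11) s s₅ :=
    ((n₁.mono (by omega)).trans n₄).trans (n₅.mono (by omega))
  have hs₅ := hs.of_natEq n₀₅
  have a₅ : ∀ q ≠ 3 * (i : ℕ), q ≠ 3 * n → q ≠ 3 * n + 1 → ∀ o < p.H,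
      s₅.real (p.adr q o) = s.real (p.adr q o) := fun q h₁ h₂ h₃ o ho => by
    rw [fr₅.area q (by simpa using h₁) o ho, a₄ q h₂ h₃ o ho]
  refine (hc₂ p O s₅ W (digit p.M τ i) (E + 1 + Mem.offset p.d i) hs₅.holds hd hdig.le
    (fun s' h => ?_) (fun s' h => hdst s' (n₀₅.trans (h.mono (by omega)))) (by omega)).mono
    le_rfl ?_
  · simp [h _ (show 2 * n + 10 + (i : ℕ) < 3 * n + 13 by omega), hs₅.dig]
  rintro s₆ ⟨n₆, r₆, e₆⟩
  have a₆ : ∀ q o, s₆.real (p.adr q o) = s₅.real (p.adr q o) := fun q o => r₆ _ (by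
    have := p.base_le_adr q o; omega)
  refine ⟨n₀₅.trans (n₆.mono (by omega)), ⟨fun b hb => ?_, fun q hq o ho => ?_⟩, ?_⟩
  · by_cases hbi : b < E + 1 + Mem.offset p.d i ∨ E + 1 + Mem.offset p.d i + p.d i ≤ b
    · rw [r₆ b hbi, fr₅.out b hb, o₄ b hb, r₁ b hbi]
    · have h5 : p.trajAt s₅ i (digit p.M τ i) = x i (digit p.M τ i) := by
        rw [← hst.traj i _ hdig.le]
        exact Dims.trajAt_congr fun o ho => a₅ _ (by omega) (by omega) (by omega) o
          (ho.trans_le (p.traj_le_H i hdig.le))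
      have h6 := congrFun (congrArg WithLp.ofLp e₆)
        ⟨b - (E + 1 + Mem.offset p.d i), by omega⟩
      have h7 := congrFun (congrArg WithLp.ofLp (congrFun hprof i))
        ⟨b - (E + 1 + Mem.offset p.d i), by omega⟩
      rw [h5] at h6
      simp only [Mem.readVec, Mem.readProfile, pick] at h6 h7
      rw [show E + 1 + Mem.offset p.d i + (b - (E + 1 + Mem.offset p.d i)) = b by omega] at h6 h7
      rw [h6, h7]
  · simp only [Set.mem_insert_iff, Set.mem_singleton_iff, not_or] at hq
    rw [a₆, a₅ q hq.1 hq.2.1 hq.2.2 o ho]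
  · rw [show p.matAt s₆ i = p.matAt s₅ i from Dims.matAt_congr fun o _ => a₆ _ o, e₅]
    rfl

end Emit

/-! ### Writing out the points and accumulating the gradients -/

section Emit

variable {n : ℕ}

/-- A common polynomial bound for finitely many programs. -/
theorem exists_isPoly_forall {n : ℕ} {R : Fin n → ℕ → ℕ → Prop}
    (hR : ∀ i W T T', T ≤ T' → R i W T → R i W T')
    (h : ∀ i, ∃ f, IsPoly f ∧ ∀ W, R i W (f W)) : ∃ f, IsPoly f ∧ ∀ i W, R i W (f W) := by
  choose g hg hgR using h
  refine ⟨fun W => ∑ i, g i W, ?_, fun i W => hR i W _ _ ?_ (hgR i W)⟩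
  · have : ∀ S : Finset (Fin n), IsPoly (fun W => ∑ i ∈ S, g i W) := fun S => by
      induction S using Finset.induction_on with
      | empty => simpa using IsPoly.const 0
      | insert i S hi ih =>
        simp only [Finset.sum_insert hi]
        exact (hg i).add ih
    exact this _
  · exact Finset.single_le_sum (f := fun i => g i W) (fun _ _ => Nat.zero_le _) (Finset.mem_univ i)

theorem notMem_of_finRange_eq {l₁ l₂ : List (Fin n)} {i : Fin n}
    (h : List.finRange n = l₁ ++ i :: l₂) : i ∉ l₁ := by
  have := List.nodup_finRange n
  rw [h, List.nodup_append] at this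
  exact fun hi => this.2.2 i hi i (by simp) rfl

/-- Output the current point and add its contributions to all matrices. -/
def emitPoint (n : ℕ) : Prog n :=
  .seq (digits n)
    (.seq (.rset (outE n) (.ofNat (.const 1) / (.ofNat (.var (2 * n + 3)) *
        .ofNat (.var (2 * n + 4)))))
      (.seq (Prog.seqs ((List.finRange n).map fun i =>
          copyTraj i (.var (2 * n + 10 + i)) (outE n + .const 1 + offE i)))
        (Prog.seqs ((List.finRange n).map gradStep))))

/-- The effect of writing out point `τ` of round `t`. -/
structure Emitted (p : Dims n) (O : Oracles p.d p.k) (x : (i : Fin n) → ℕ → Vec (p.d i))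
    (F : (i : Fin n) → ℕ → Fin (p.k i) → ℝ) (t τ : ℕ) (s s' : Mem) : Prop where
  nat : NatEq (2 * n + 10) s s'
  area : ∀ q ∉ emitAreas n, ∀ o < p.H, s'.real (p.adr q o) = s.real (p.adr q o)
  out : ∀ b < p.base, b < (t * p.N + τ) * p.S ∨ (t * p.N + τ) * p.S + p.S ≤ b →
    s'.real b = s.real b
  weight : s'.real ((t * p.N + τ) * p.S) = 1 / ((p.T : ℝ) * p.N)
  profile : s'.readProfile p.d ((t * p.N + τ) * p.S + 1) = pick x (fun j => digit p.M τ j)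
  mat : ∀ i, p.matAt s' i = p.matAt s i + p.step • gradTerm O x F i (fun j => digit p.M τ j)

/-- The matrices change while points are written, but every gradient contribution is computed from
the stored trajectories and features, which do not. The updates of a round thus add up to a single
gradient step. -/
theorem emitPoint_runs (n : ℕ) : ∃ f, IsPoly f ∧ ∀ (p : Dims n) (O : Oracles p.d p.k)
    (x : (i : Fin n) → ℕ → Vec (p.d i)) (F : (i : Fin n) → ℕ → Fin (p.k i) → ℝ) (s : Mem)
    (W t τ : ℕ), p.Holds s → s.nat (2 * n + 8) = t → s.nat (2 * n + 9) = τ → Stored p x F s →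
    1 ≤ p.M → p.S ≤ W → p.F ≤ W → p.N ≤ W → t < p.T → τ < p.N →
    Runs O (emitPoint n) s (f W) (Emitted p O x F t τ s) := by
  -- `Runs.seqs` needs one time bound for all players, which `exists_isPoly_forall` supplies by
  -- summing the individual ones.
  have hcopy : ∃ f, IsPoly f ∧ ∀ (i : Fin n) (W : ℕ), ∀ (p : Dims n)
      (O : Oracles p.d p.k) (s : Mem) (l a : ℕ), p.Holds s → p.d i ≤ W → l ≤ p.M →
      (∀ s', NatEq (3 * n + 13) s s' → (NExp.var (2 * n + 10 + i)).eval s' = l) →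
      (∀ s', NatEq (3 * n + 13) s s' → (outE n + .const 1 + offE i).eval s' = a) →
      a + p.d i ≤ p.base →
      Runs O (copyTraj i (.var (2 * n + 10 + i)) (outE n + .const 1 + offE i)) s (f W)
        (fun s' => NatEq (3 * n + 13) s s' ∧
        (∀ b, b < a ∨ a + p.d i ≤ b → s'.real b = s.real b) ∧
        s'.readVec (p.d i) a = p.trajAt s i l) := by
    refine exists_isPoly_forall (R := fun i W T => ∀ (p : Dims n)
      (O : Oracles p.d p.k) (s : Mem) (l a : ℕ), p.Holds s → p.d i ≤ W → l ≤ p.M →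
      (∀ s', NatEq (3 * n + 13) s s' → (NExp.var (2 * n + 10 + i)).eval s' = l) →
      (∀ s', NatEq (3 * n + 13) s s' → (outE n + .const 1 + offE i).eval s' = a) →
      a + p.d i ≤ p.base →
      Runs O (copyTraj i (.var (2 * n + 10 + i)) (outE n + .const 1 + offE i)) s T
        (fun s' => NatEq (3 * n + 13) s s' ∧
        (∀ b, b < a ∨ a + p.d i ≤ b → s'.real b = s.real b) ∧
        s'.readVec (p.d i) a = p.trajAt s i l)) ?_ ?_
    · intro i W T T' hT h p O s l a h₁ h₂ h₃ h₄ h₅ h₆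
      exact (h p O s l a h₁ h₂ h₃ h₄ h₅ h₆).mono hT (fun _ h => h)
    · intro i
      obtain ⟨f, hf, h⟩ := copyTraj_runs i (.var (2 * n + 10 + i)) (outE n + .const 1 + offE i)
      exact ⟨f, hf, fun W p O s l a => h p O s W l a⟩
  have hgrad : ∃ f, IsPoly f ∧ ∀ (i : Fin n) (W : ℕ), ∀ (p : Dims n) (O : Oracles p.d p.k)
      (x : (i : Fin n) → ℕ → Vec (p.d i)) (F : (i : Fin n) → ℕ → Fin (p.k i) → ℝ) (s : Mem)
      (t τ : ℕ), AtPoint p t τ s → Stored p x F s → 1 ≤ p.M → p.S ≤ W → p.k i ≤ W → t < p.T →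
      τ < p.N → s.readProfile p.d ((t * p.N + τ) * p.S + 1) = pick x (fun j => digit p.M τ j) →
      Runs O (gradStep i) s (f W) (fun s' => NatEq (3 * n + 11) s s' ∧
        p.Frame {3 * (i : ℕ), 3 * n, 3 * n + 1} s s' ∧
        p.matAt s' i = p.matAt s i + p.step • gradTerm O x F i (fun j => digit p.M τ j)) := by
    refine exists_isPoly_forall (R := fun i W T => ∀ (p : Dims n) (O : Oracles p.d p.k)
      (x : (i : Fin n) → ℕ → Vec (p.d i)) (F : (i : Fin n) → ℕ → Fin (p.k i) → ℝ) (s : Mem)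
      (t τ : ℕ), AtPoint p t τ s → Stored p x F s → 1 ≤ p.M → p.S ≤ W → p.k i ≤ W → t < p.T →
      τ < p.N → s.readProfile p.d ((t * p.N + τ) * p.S + 1) = pick x (fun j => digit p.M τ j) →
      Runs O (gradStep i) s T (fun s' => NatEq (3 * n + 11) s s' ∧
        p.Frame {3 * (i : ℕ), 3 * n, 3 * n + 1} s s' ∧
        p.matAt s' i = p.matAt s i + p.step • gradTerm O x F i (fun j => digit p.M τ j))) ?_ ?_
    · intro i W T T' hT h p O x F s t τ h₁ h₂ h₃ h₄ h₅ h₆ h₇ h₈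
      exact (h p O x F s t τ h₁ h₂ h₃ h₄ h₅ h₆ h₇ h₈).mono hT (fun _ h => h)
    · intro i
      obtain ⟨f, hf, h⟩ := gradStep_runs i
      exact ⟨f, hf, fun W p O x F s t τ => h p O x F s W t τ⟩
  obtain ⟨fc, hfc, hcopy⟩ := hcopy
  obtain ⟨fg, hfg, hgrad⟩ := hgrad
  refine ⟨fun W => (n * (W * 30 + 30) + 10) + (50 + ((n * fc W + 1) + (n * fg W + 1))),
    (((IsPoly.const _).mul ((IsPoly.id.mul (.const _)).add (.const _))).add (.const _)).add
      ((IsPoly.const _).add ((((IsPoly.const _).mul hfc).add (.const _)).add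
        (((IsPoly.const _).mul hfg).add (.const _)))), ?_⟩
  intro p O x F s W t τ hs ht hτ hst hM hS hF hN htT hτN
  obtain ⟨E, hE⟩ : ∃ E, (t * p.N + τ) * p.S = E := ⟨_, rfl⟩
  have hES : E + p.S ≤ p.base := hE ▸ Dims.out_add_S_le htT hτN
  have hSsum : p.S = 1 + ∑ j, p.d j := rfl
  refine Runs.seq (digits_runs hs hM hτ (hτN.le.trans hN)) ?_
  rintro s₁ ⟨r₁, n₁, d₁⟩
  have hs₁ : AtPoint p t τ s₁ := ⟨hs.of_natEq (by omega) n₁, (n₁ _ (by omega)).trans ht,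
    (n₁ _ (by omega)).trans hτ, d₁⟩
  refine Runs.seq ((Runs.rset (Q := fun s' => s' = s₁.setReal E (1 / ((p.T : ℝ) * p.N)))
    ?_).mono (by simp [outE]) (fun _ h => h)) ?_
  · simp [hs₁.holds.eval_outE hs₁.round hs₁.point, hE, hs₁.holds.T, hs₁.holds.N]
  rintro _ rfl
  set s₂ := s₁.setReal E (1 / ((p.T : ℝ) * p.N)) with hs2
  have hs₂ : AtPoint p t τ s₂ := hs₁.of_natEq (NatEq.refl _ _)
  have hr₂ : ∀ b ≠ E, s₂.real b = s.real b := fun b hb => by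
    rw [hs2, Mem.setReal_real, if_neg hb, r₁]
  have hst₂ : Stored p x F s₂ := hst.of_frame fun q _ o _ => hr₂ _ (by
    have := p.base_le_adr q o; have := p.S_pos; omega)
  have hoff := fun i => offset_add_le_sum p.d i
  have hlen : (List.finRange n).length = n := by simp
  have H₁ := Runs.seqs (O := O) (fc W) (fun i : Fin n =>
      copyTraj i (.var (2 * n + 10 + i)) (outE n + .const 1 + offE i)) (List.finRange n)
    (fun l s' => NatEq (3 * n + 11) s₂ s' ∧ (∀ b, b < E + 1 ∨ E + p.S ≤ b → s'.real b = s₂.real b) ∧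
      ∀ i ∈ l, s'.readVec (p.d i) (E + 1 + Mem.offset p.d i) = x i (digit p.M τ i)) (by
    rintro l₁ i l₂ hl s' ⟨h₁, h₂, h₃⟩
    have hi := notMem_of_finRange_eq hl
    have hs' := hs₂.of_natEq h₁
    have hst' : Stored p x F s' := hst₂.of_frame fun q _ o _ => h₂ _ (by
      have := p.base_le_adr q o; omega)
    refine (hcopy i W p O s' (digit p.M τ i) (E + 1 + Mem.offset p.d i) hs'.holds
      ((p.d_lt_S i).le.trans hS) (digit_lt hM τ i).le (fun s'' h => ?_) (fun s'' h => ?_)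
      (by have := hoff i; omega)).mono le_rfl ?_
    · have := hs'.of_natEq (h.mono (by omega))
      exact this.dig i
    · have := hs'.of_natEq (h.mono (by omega))
      simp [this.holds.eval_outE this.round this.point, this.holds.eval_offE, hE]
    · rintro s'' ⟨g₁, g₂, g₃⟩
      refine ⟨h₁.trans (g₁.mono (by omega)), fun b hb => ?_, fun j hj => ?_⟩
      · have := hoff i
        rw [g₂ b (by omega), h₂ b hb]
      · by_cases hji : j = i
        · subst hji
          rw [g₃, hst'.traj j _ (digit_lt hM τ j).le]
        · have hj' : j ∈ l₁ := by simpa [hji] using hj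
          rw [← h₃ j hj']
          ext c
          simp only [Mem.readVec]
          apply g₂
          rcases lt_or_gt_of_ne hji with hlt | hlt
          · have := offset_add_le_offset (d := p.d) hlt; omega
          · have := offset_add_le_offset (d := p.d) hlt; omega) s₂
    ⟨NatEq.refl _ _, fun _ _ => rfl, fun i hi => by simp at hi⟩
  rw [hlen] at H₁
  refine Runs.seq H₁ ?_
  rintro s₃ ⟨n₃, r₃, e₃⟩
  have hs₃ := hs₂.of_natEq n₃
  have hp₃ : s₃.readProfile p.d (E + 1) = pick x (fun j => digit p.M τ j) := by
    funext i
    exact e₃ i (by simp)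
  have hst₃ : Stored p x F s₃ := hst₂.of_frame fun q _ o _ => r₃ _ (by
    have := p.base_le_adr q o; omega)
  have H₂ := Runs.seqs (O := O) (fg W) gradStep (List.finRange n)
    (fun l s' => NatEq (3 * n + 11) s₃ s' ∧ p.Frame (emitAreas n) s₃ s' ∧
      (∀ i ∈ l, p.matAt s' i = p.matAt s₃ i + p.step • gradTerm O x F i (fun j => digit p.M τ j)) ∧
      ∀ i ∉ l, p.matAt s' i = p.matAt s₃ i) (by
    rintro l₁ i l₂ hl s' ⟨h₁, h₂, h₃, h₄⟩
    have hi := notMem_of_finRange_eq hl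
    have hs' := hs₃.of_natEq h₁
    have hst' : Stored p x F s' := hst₃.of_frame h₂.area
    have hp' : s'.readProfile p.d (E + 1) = pick x (fun j => digit p.M τ j) := by
      rw [← hp₃]
      funext j
      ext c
      exact h₂.out _ (by have := hoff j; omega)
    refine (hgrad i W p O x F s' t τ hs' hst' hM hS ((p.k_lt_F i).le.trans hF) htT hτN
      (by rw [hE]; exact hp')).mono le_rfl ?_
    rintro s'' ⟨g₁, g₂, g₃⟩
    have hother : ∀ j ≠ i, p.matAt s'' j = p.matAt s' j := fun j hj =>
      Dims.matAt_congr fun o ho => g₂.area _ (by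
        have : (j : ℕ) ≠ i := fun h => hj (Fin.ext h)
        simp only [Set.mem_insert_iff, Set.mem_singleton_iff]; omega) o ho
    refine ⟨h₁.trans g₁, h₂.trans (g₂.mono ?_), fun j hj => ?_, fun j hj => ?_⟩
    · intro q
      simp only [Set.mem_insert_iff, Set.mem_singleton_iff, emitAreas, Set.mem_ofPred_eq]
      omega
    · by_cases hji : j = i
      · subst hji
        rw [g₃, h₄ j hi]
      · rw [hother j hji, h₃ j (by simpa [hji] using hj)]
    · simp only [List.mem_append, List.mem_singleton, not_or] at hj
      rw [hother j hj.2, h₄ j hj.1]) s₃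
    ⟨NatEq.refl _ _, Dims.Frame.refl _ _, fun i hi => by simp at hi, fun i _ => rfl⟩
  rw [hlen] at H₂
  refine H₂.mono le_rfl ?_
  rintro s₄ ⟨n₄, fr₄, m₄, -⟩
  refine ⟨?_, fun q hq o ho => ?_, fun b hb hbE => ?_, ?_, ?_, fun i => ?_⟩
  · exact (n₁.trans (n₃.mono (by omega))).trans (n₄.mono (by omega))
  · have := p.base_le_adr q o
    have := p.S_pos
    rw [fr₄.area q hq o ho, r₃ _ (by omega), hr₂ _ (by omega)]
  · rw [hE] at hbE
    have := p.S_pos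
    rw [fr₄.out b hb, r₃ b (by omega), hr₂ b (by omega)]
  · have := p.S_pos
    rw [hE, fr₄.out _ (by omega), r₃ _ (by omega), hs2]
    simp
  · rw [hE, ← hp₃]
    funext j
    ext c
    exact fr₄.out _ (by have := hoff j; omega)
  · rw [m₄ i (by simp)]
    congr 1
    refine Dims.matAt_congr fun o ho => ?_
    have := p.base_le_adr (3 * i) o
    have := p.S_pos
    rw [r₃ _ (by omega), hr₂ _ (by omega)]

/-- Output all points of a round and add their contributions to the matrices. -/
def emit (n : ℕ) : Prog n := .forN (2 * n + 9) (.var (2 * n + 4)) (emitPoint n)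

theorem emit_runs (n : ℕ) : ∃ f, IsPoly f ∧ ∀ (p : Dims n) (O : Oracles p.d p.k)
    (x : (i : Fin n) → ℕ → Vec (p.d i)) (F : (i : Fin n) → ℕ → Fin (p.k i) → ℝ) (s : Mem)
    (W t : ℕ), p.Holds s → s.nat (2 * n + 8) = t → Stored p x F s →
    1 ≤ p.M → p.S ≤ W → p.F ≤ W → p.N ≤ W → t < p.T →
    Runs O (emit n) s (f W) (fun s' => NatEq (2 * n + 9) s s' ∧
      (∀ q ∉ emitAreas n, ∀ o < p.H, s'.real (p.adr q o) = s.real (p.adr q o)) ∧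
      (∀ b < t * p.N * p.S, s'.real b = s.real b) ∧
      (∀ τ < p.N, s'.real ((t * p.N + τ) * p.S) = 1 / ((p.T : ℝ) * p.N) ∧
        s'.readProfile p.d ((t * p.N + τ) * p.S + 1) = pick x (fun j => digit p.M τ j)) ∧
      ∀ i, p.matAt s' i = p.matAt s i +
        p.step • ∑ τ ∈ Finset.range p.N, gradTerm O x F i (fun j => digit p.M τ j)) := by
  obtain ⟨f, hf, hpt⟩ := emitPoint_runs n
  refine ⟨fun W => W * (f W + 2 + 12) + 2 + 12, ((IsPoly.id.mul ((hf.add (.const _)).add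
    (.const _))).add (.const _)).add (.const _), ?_⟩
  intro p O x F s W t hs ht hst hM hS hF hN htT
  refine (Runs.forN (O := O) p.N (f W) (fun r s' => NatEq (2 * n + 9) s s' ∧
      (∀ q ∉ emitAreas n, ∀ o < p.H, s'.real (p.adr q o) = s.real (p.adr q o)) ∧
      (∀ b < t * p.N * p.S, s'.real b = s.real b) ∧
      (∀ τ < r, s'.real ((t * p.N + τ) * p.S) = 1 / ((p.T : ℝ) * p.N) ∧
        s'.readProfile p.d ((t * p.N + τ) * p.S + 1) = pick x (fun j => digit p.M τ j)) ∧
      ∀ i, p.matAt s' i = p.matAt s i +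
        p.step • ∑ τ ∈ Finset.range r, gradTerm O x F i (fun j => digit p.M τ j)) ?_ ?_ ?_).mono
    ?_ (fun _ h => h)
  · exact ⟨(NatEq.refl _ _).setNat le_rfl, fun _ _ _ _ => rfl, fun _ _ => rfl,
      fun τ hτ => absurd hτ (by omega), fun i => by
        simp only [Finset.range_zero, Finset.sum_empty, smul_zero, add_zero]; rfl⟩
  · rintro j s' ⟨h, -⟩
    exact (hs.of_natEq (by omega) h).N
  · rintro r hr s' ⟨h₁, h₂, h₃, h₄, h₅⟩ hv
    refine (hpt p O x F s' W t r (hs.of_natEq (by omega) h₁) ((h₁ _ (by omega)).trans ht) hv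
      (hst.of_frame h₂) hM hS hF hN htT hr).mono le_rfl ?_
    intro s'' h
    have hES := Dims.out_add_S_le htT hr
    -- Blocks written earlier end before the current one starts, so they are preserved.
    have hblock : ∀ τ < r, (t * p.N + τ) * p.S + p.S ≤ (t * p.N + r) * p.S := fun τ hτ => by
      have := Nat.mul_le_mul_right p.S (show t * p.N + τ + 1 ≤ t * p.N + r by omega)
      rwa [Nat.add_mul _ 1, Nat.one_mul] at this
    have hSsum : p.S = 1 + ∑ j, p.d j := rfl
    refine ⟨(h.nat _ (by omega)).trans hv, ?_, fun q hq o ho => ?_, fun b hb => ?_,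
      fun τ hτ => ?_, fun i => ?_⟩
    · exact (h₁.trans (h.nat.mono (by omega))).setNat le_rfl
    · exact (h.area q hq o ho).trans (h₂ q hq o ho)
    · have h6 : t * p.N * p.S ≤ (t * p.N + r) * p.S := Nat.mul_le_mul_right _ (by omega)
      exact (h.out b (by omega) (by omega)).trans (h₃ b hb)
    · rcases Nat.lt_succ_iff_lt_or_eq.1 hτ with hlt | rfl
      · have hb := hblock τ hlt
        have hS0 := p.S_pos
        refine ⟨(h.out _ (by omega) (by omega)).trans (h₄ τ hlt).1, ?_⟩
        rw [← (h₄ τ hlt).2]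
        funext j
        ext c
        have := offset_add_le_sum p.d j
        exact h.out _ (by omega) (by omega)
      · exact ⟨h.weight, h.profile⟩
    · rw [show p.matAt (s''.setNat (2 * n + 9) (r + 1)) i = p.matAt s'' i from rfl, h.mat i, h₅ i,
        Finset.sum_range_succ, smul_add, add_assoc]
  · have := Nat.mul_le_mul_right (f W + 2 + 12) hN
    simp only [NExp.cost_var]
    omega

end Emit

/-! ### Rounds -/

section Round

variable {n : ℕ}

/-- Base-`M` expansion is a bijection between numbers below `M ^ n` and tuples of times. It links
the single counter `τ` of the program to the product grid of the analysis. -/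
theorem sum_digits {β : Type*} [AddCommMonoid β] (M : ℕ) (G : (Fin n → ℕ) → β) :
    ∑ τ ∈ Finset.range (M ^ n), G (fun j => digit M τ j) =
      ∑ ℓ : Fin n → Fin M, G (fun j => ℓ j) := by
  rw [Finset.sum_range]
  exact Fintype.sum_equiv finFunctionFinEquiv.symm _ _ fun τ => rfl

/-- Compute the trajectories of all players. -/
def trajs (n : ℕ) : Prog n := Prog.seqs ((List.finRange n).map traj)

/-- One round. -/
def round (n : ℕ) : Prog n := .seq (trajs n) (emit n)

theorem ValidTraj.congr {p : Dims n} {i : Fin n} {X : Set (Vec (p.d i))}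
    {m : Vec (p.d i) → Fin (p.k i) → ℝ} {s s' : Mem} {l : ℕ} (h : ValidTraj p i X m s l)
    (hl : l ≤ p.M) (hm : p.matAt s' i = p.matAt s i)
    (ht : ∀ r ≤ p.M, p.trajAt s' i r = p.trajAt s i r)
    (hf : ∀ r < p.M, p.featAt s' i r = p.featAt s i r) : ValidTraj p i X m s' l := by
  refine ⟨?_, fun r hr => ?_, fun r hr => ?_, fun r hr => ?_⟩
  · rw [ht 0 (Nat.zero_le _)]; exact h.zero
  · rw [ht _ (by omega)]; exact h.mem r hr
  · rw [ht _ (by omega), ht _ (by omega), hm]; exact h.step r hr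
  · rw [hf _ (by omega), ht _ (by omega)]; exact h.feat r hr

theorem trajs_runs (n : ℕ) : ∃ f, IsPoly f ∧ ∀ (p : Dims n) (O : Oracles p.d p.k)
    (X : (i : Fin n) → Set (Vec (p.d i))) (m : (i : Fin n) → Vec (p.d i) → Fin (p.k i) → ℝ)
    (s : Mem) (W : ℕ), (∀ i, PlayerCorrect p O i (X i) (m i)) → p.Holds s → p.S ≤ W → p.F ≤ W →
    (∀ i, p.trajAt s i 0 = 0) →
    (∀ i, ⌊‖p.matAt s i‖ ^ 2 * ((p.M : ℝ) ^ 2 * p.B)⌋₊ * (p.M + 1) + p.M ≤ W) →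
    Runs O (trajs n) s (f W) (fun s' => NatEq (3 * n + 10) s s' ∧
      (∀ a < p.base, s'.real a = s.real a) ∧ ∀ i, ValidTraj p i (X i) (m i) s' p.M ∧
        ∀ K' : Mat (p.d i) (p.k i), (∀ y ∈ X i, app K' (m i y) ∈ X i) →
          ‖p.matAt s' i - (1 - 1 / (p.M : ℝ)) • K'‖ ^ 2 ≤
            ‖p.matAt s i - (1 - 1 / (p.M : ℝ)) • K'‖ ^ 2) := by
  have htraj : ∃ f, IsPoly f ∧ ∀ (i : Fin n) (W : ℕ), ∀ (p : Dims n) (O : Oracles p.d p.k)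
      (X : Set (Vec (p.d i))) (m : Vec (p.d i) → Fin (p.k i) → ℝ) (s : Mem),
      PlayerCorrect p O i X m → p.Holds s → p.d i ≤ W → p.k i ≤ W → p.trajAt s i 0 = 0 →
      ⌊‖p.matAt s i‖ ^ 2 * ((p.M : ℝ) ^ 2 * p.B)⌋₊ * (p.M + 1) + p.M ≤ W →
      Runs O (traj i) s (f W) (fun s' => TrajInv p i X m s s' ∧ s'.nat (3 * n + 11) = p.M) := by
    refine exists_isPoly_forall (R := fun i W T => ∀ (p : Dims n) (O : Oracles p.d p.k)
      (X : Set (Vec (p.d i))) (m : Vec (p.d i) → Fin (p.k i) → ℝ) (s : Mem),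
      PlayerCorrect p O i X m → p.Holds s → p.d i ≤ W → p.k i ≤ W → p.trajAt s i 0 = 0 →
      ⌊‖p.matAt s i‖ ^ 2 * ((p.M : ℝ) ^ 2 * p.B)⌋₊ * (p.M + 1) + p.M ≤ W →
      Runs O (traj i) s T (fun s' => TrajInv p i X m s s' ∧ s'.nat (3 * n + 11) = p.M)) ?_ ?_
    · intro i W T T' hT h p O X m s h₁ h₂ h₃ h₄ h₅ h₆
      exact (h p O X m s h₁ h₂ h₃ h₄ h₅ h₆).mono hT (fun _ h => h)
    · intro i
      obtain ⟨f, hf, h⟩ := traj_runs i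
      exact ⟨f, hf, fun W p O X m s => h p O X m s W⟩
  obtain ⟨f, hf, htraj⟩ := htraj
  refine ⟨fun W => n * f W + 1, ((IsPoly.const _).mul hf).add (.const _), ?_⟩
  intro p O X m s W hp hs hS hF h0 hW
  have H := Runs.seqs (O := O) (f W) traj (List.finRange n) (fun l s' => NatEq (3 * n + 10) s s' ∧
      (∀ a < p.base, s'.real a = s.real a) ∧
      (∀ i ∈ l, ValidTraj p i (X i) (m i) s' p.M ∧
        ∀ K' : Mat (p.d i) (p.k i), (∀ y ∈ X i, app K' (m i y) ∈ X i) →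
          ‖p.matAt s' i - (1 - 1 / (p.M : ℝ)) • K'‖ ^ 2 ≤
            ‖p.matAt s i - (1 - 1 / (p.M : ℝ)) • K'‖ ^ 2) ∧
      ∀ i ∉ l, p.matAt s' i = p.matAt s i ∧ p.trajAt s' i 0 = 0) (by
    rintro l₁ i l₂ hl s' ⟨h₁, h₂, h₃, h₄⟩
    have hi := notMem_of_finRange_eq hl
    obtain ⟨hmi, hti⟩ := h₄ i hi
    refine (htraj i W p O (X i) (m i) s' (hp i) (hs.of_natEq (by omega) h₁)
      ((p.d_lt_S i).le.trans hS) ((p.k_lt_F i).le.trans hF) hti (by rw [hmi]; exact hW i)).mono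
      le_rfl ?_
    rintro s'' ⟨hI, hl'⟩
    -- Besides the shared scratch areas, computing one trajectory touches only that player's own
    -- areas, so those of the others survive.
    have hne : ∀ j ≠ i, ∀ q, q = 3 * (j : ℕ) ∨ q = 3 * (j : ℕ) + 1 ∨ q = 3 * (j : ℕ) + 2 →
        ∀ o < p.H, s''.real (p.adr q o) = s'.real (p.adr q o) := fun j hj q hq o ho => by
      refine hI.frame.area q ?_ o ho
      have : (j : ℕ) ≠ i := fun h => hj (Fin.ext h)
      have := j.2
      simp only [playerAreas, Set.mem_insert_iff, Set.mem_singleton_iff]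
      omega
    have hmat : ∀ j ≠ i, p.matAt s'' j = p.matAt s' j := fun j hj =>
      Dims.matAt_congr fun o ho => hne j hj _ (by omega) o ho
    have htr : ∀ j ≠ i, ∀ r ≤ p.M, p.trajAt s'' j r = p.trajAt s' j r := fun j hj r hr =>
      Dims.trajAt_congr fun o ho => hne j hj _ (by omega) o (ho.trans_le (p.traj_le_H j hr))
    have hft : ∀ j ≠ i, ∀ r < p.M, p.featAt s'' j r = p.featAt s' j r := fun j hj r hr =>
      Dims.featAt_congr fun o ho => hne j hj _ (by omega) o (ho.trans_le (p.feat_le_H j hr.le))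
    refine ⟨h₁.trans (hI.nat.mono (by omega)), fun a ha => (hI.frame.out a ha).trans (h₂ a ha),
      fun j hj => ?_, fun j hj => ?_⟩
    · by_cases hji : j = i
      · subst hji
        refine ⟨hl' ▸ hI.valid, fun K' hK' => ?_⟩
        rw [← hmi]
        exact hI.pot K' hK'
      · have hj' := h₃ j (by simpa [hji] using hj)
        exact ⟨hj'.1.congr le_rfl (hmat j hji) (htr j hji) (hft j hji), by
          rw [hmat j hji]; exact hj'.2⟩
    · simp only [List.mem_append, List.mem_singleton, not_or] at hj
      rw [hmat j hj.2, htr j hj.2 0 (Nat.zero_le _)]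
      exact h₄ j hj.1) s ⟨NatEq.refl _ _, fun _ _ => rfl, fun i hi => by simp at hi,
        fun i _ => ⟨rfl, h0 i⟩⟩
  rw [List.length_finRange] at H
  refine H.mono le_rfl ?_
  rintro s' ⟨h₁, h₂, h₃, -⟩
  exact ⟨h₁, h₂, fun i => h₃ i (by simp)⟩

end Round

/-! ### The main loop -/

section Main

variable {n : ℕ} (Γ : ConcaveGame n) (k : Fin n → ℕ) (M D : ℕ)

/-- The parameters of a run on the game `Γ`. -/
abbrev gameDims : Dims n := ⟨Γ.d, k, M, D⟩

/-- The gain of player `i` from the deviation `φ`. -/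
def gain {n : ℕ} (Γ : ConcaveGame n) (i : Fin n) (φ : Vec (Γ.d i) → Vec (Γ.d i))
    (x : Profile Γ.d) : ℝ :=
  Γ.u i (Function.update x i (φ (x i))) - Γ.u i x

variable {k}

/-- State of the memory after `t` rounds. -/
structure MainInv (m : (i : Fin n) → Vec (Γ.d i) → Fin (k i) → ℝ) (R : ℝ) (s₀ : Mem) (t : ℕ)
    (s : Mem) : Prop where
  nat : NatEq (2 * n + 8) s₀ s
  zero : ∀ i, (gameDims Γ k M D).trajAt s i 0 = 0
  norm : ∀ i, ‖(gameDims Γ k M D).matAt s i‖ ^ 2 ≤ t * (2 * R + 1)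
  weight : ∀ r < t * (gameDims Γ k M D).N, s.real (r * (gameDims Γ k M D).S) =
    1 / (((gameDims Γ k M D).T : ℝ) * (gameDims Γ k M D).N)
  mem : ∀ r < t * (gameDims Γ k M D).N,
    s.readProfile Γ.d (r * (gameDims Γ k M D).S + 1) ∈ Γ.profiles
  regret : ∀ i, ∀ φ : Vec (Γ.d i) → Vec (Γ.d i), Set.MapsTo φ (Γ.X i) (Γ.X i) →
    ∀ K' : Mat (Γ.d i) (k i), (∀ y ∈ Γ.X i, φ y = app K' (m i y)) →
    ∑ r ∈ Finset.range (t * (gameDims Γ k M D).N),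
      gain Γ i φ (s.readProfile Γ.d (r * (gameDims Γ k M D).S + 1)) ≤
    t * ((M : ℝ) ^ n * (5 / 2 / M)) + (M : ℝ) ^ n * (gameDims Γ k M D).B * M / 2 *
      (‖(1 - 1 / (M : ℝ)) • K'‖ ^ 2 -
        ‖(gameDims Γ k M D).matAt s i - (1 - 1 / (M : ℝ)) • K'‖ ^ 2)

/-- Both potentials in `MainInv` behave additively over rounds. Cuts do not increase the distance to
a shrunk comparator, and the gradient step changes it as in `round_regret`; likewise `‖K‖²` grows by
at most `2R + 1`. -/
theorem round_runs (n : ℕ) : ∃ f, IsPoly f ∧ ∀ (Γ : ConcaveGame n) (k : Fin n → ℕ)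
    (m : (i : Fin n) → Vec (Γ.d i) → Fin (k i) → ℝ) (O : Oracles Γ.d k) (M D : ℕ) (R : ℝ)
    (s₀ s : Mem) (t W : ℕ), O.Correct Γ m →
    (∀ i, PlayerCorrect (gameDims Γ k M D) O i (Γ.X i) (m i)) →
    (∀ i, Γ.X i ⊆ Metric.closedBall 0 R) → 0 < R → 1 ≤ M → 1 ≤ (gameDims Γ k M D).B →
    (gameDims Γ k M D).Holds s₀ → (gameDims Γ k M D).S ≤ W → (gameDims Γ k M D).F ≤ W →
    (gameDims Γ k M D).N ≤ W → t < (gameDims Γ k M D).T →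
    ⌊(gameDims Γ k M D).T * (2 * R + 1) * ((M : ℝ) ^ 2 * (gameDims Γ k M D).B)⌋₊ * (M + 1) + M ≤ W →
    MainInv Γ M D m R s₀ t s → s.nat (2 * n + 8) = t →
    Runs O (round n) s (f W) (fun s' => s'.nat (2 * n + 8) = t ∧
      MainInv Γ M D m R s₀ (t + 1) (s'.setNat (2 * n + 8) (t + 1))) := by
  obtain ⟨f₁, hf₁, htr⟩ := trajs_runs n
  obtain ⟨f₂, hf₂, hem⟩ := emit_runs n
  refine ⟨fun W => f₁ W + f₂ W, hf₁.add hf₂, ?_⟩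
  intro Γ k m O M D R s₀ s t W hO hp hXR hR hM hB hs₀ hS hF hN htT hW hI ht
  set p := gameDims Γ k M D with hpdef
  have hs : p.Holds s := hs₀.of_natEq le_rfl hI.nat
  have hM1 : (1 : ℝ) ≤ M := by exact_mod_cast hM
  have hB1 : (1 : ℝ) ≤ p.B := by exact_mod_cast hB
  have hNM : p.N = M ^ n := rfl
  refine Runs.seq (htr p O Γ.X m s W hp hs hS hF hI.zero (fun i => ?_)) ?_
  · refine le_trans ?_ hW
    -- Replacing `t` by `T` gives a bound on the number of cuts that is the same for all rounds.
    have h1 : ‖p.matAt s i‖ ^ 2 ≤ p.T * (2 * R + 1) := (hI.norm i).trans (by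
      have : (t : ℝ) ≤ p.T := by exact_mod_cast htT.le
      gcongr)
    have h2 : ⌊‖p.matAt s i‖ ^ 2 * ((p.M : ℝ) ^ 2 * p.B)⌋₊ ≤
        ⌊(p.T : ℝ) * (2 * R + 1) * ((M : ℝ) ^ 2 * p.B)⌋₊ :=
      Nat.floor_le_floor (mul_le_mul_of_nonneg_right h1 (by positivity))
    have h3 := Nat.mul_le_mul_right (M + 1) h2
    have h4 : p.M = M := rfl
    rw [h4] at h3 ⊢
    omega
  rintro s₁ ⟨n₁, o₁, v₁⟩
  have hs₁ := hs.of_natEq (by omega) n₁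
  set x : (i : Fin n) → ℕ → Vec (Γ.d i) := fun i l => p.trajAt s₁ i l with hx
  have hxX : ∀ i, ∀ l ≤ M, x i l ∈ Γ.X i := fun i l hl => (v₁ i).1.mem_le (hp i).ball hl
  have hxK : ∀ i, ∀ l < M, x i (l + 1) = app (p.matAt s₁ i) (m i (x i l)) := fun i l hl =>
    (v₁ i).1.step l hl
  refine (hem p O x (fun i l => p.featAt s₁ i l) s₁ W t hs₁ ((n₁ _ (by omega)).trans ht)
    ⟨fun _ _ _ => rfl, fun _ _ _ => rfl⟩ hM hS hF hN htT).mono le_rfl ?_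
  rintro s₂ ⟨n₂, a₂, o₂, w₂, e₂⟩
  have hbase : p.base = p.T * p.N * p.S := rfl
  have htN : t * p.N * p.S ≤ p.base :=
    Nat.mul_le_mul_right _ (Nat.mul_le_mul_right _ htT.le)
  have hr₂ : ∀ b < t * p.N * p.S, s₂.real b = s.real b := fun b hb => by
    rw [o₂ b hb, o₁ b (by omega)]
  have hSsum : p.S = 1 + ∑ j, Γ.d j := rfl
  have hblock : ∀ r < t * p.N, r * p.S + p.S ≤ t * p.N * p.S := fun r hr => by
    have := Nat.mul_le_mul_right p.S (show r + 1 ≤ t * p.N by omega)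
    rwa [Nat.add_mul, Nat.one_mul] at this
  have hprof : ∀ r < t * p.N,
      s₂.readProfile Γ.d (r * p.S + 1) = s.readProfile Γ.d (r * p.S + 1) := fun r hr => by
    funext j
    ext c
    have := hblock r hr
    have := offset_add_le_sum Γ.d j
    exact hr₂ _ (by omega)
  have hsplit : (t + 1) * p.N = t * p.N + p.N := by ring
  -- The accumulated terms use stored features, which `ValidTraj.feat` identifies with the values of
  -- `m`.
  have hG : ∀ i, ∑ τ ∈ Finset.range p.N,
      gradTerm (p := p) O x (fun i l => p.featAt s₁ i l) i (fun j => digit p.M τ j) =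
      ∑ ℓ : Fin n → Fin M, roundGradient O m x i (fun j => ℓ j) := fun i => by
    rw [hNM]
    change ∑ τ ∈ Finset.range (M ^ n),
      gradTerm (p := p) O x (fun i l => p.featAt s₁ i l) i (fun j => digit M τ j) = _
    rw [sum_digits M]
    refine Finset.sum_congr rfl fun ℓ _ => ?_
    rw [gradTerm, roundGradient, (v₁ i).1.feat _ (ℓ i).2]
  have hstep : p.step = 1 / ((p.B : ℝ) * M * (M : ℝ) ^ n) := by
    rw [Dims.step, hNM]; push_cast; rfl
  have hK₂ : ∀ i, p.matAt s₂ i = p.matAt s₁ i + (1 / ((p.B : ℝ) * M * (M : ℝ) ^ n)) •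
      ∑ ℓ : Fin n → Fin M, roundGradient O m x i (fun j => ℓ j) := fun i => by
    rw [e₂ i, hG i, hstep]
  refine ⟨?_, ⟨?_, fun i => ?_, fun i => ?_, fun r hr => ?_, fun r hr => ?_, ?_⟩⟩
  · rw [n₂ _ (by omega), n₁ _ (by omega), ht]
  · exact ((hI.nat.trans (n₁.mono (by omega))).trans (n₂.mono (by omega))).setNat le_rfl
  · rw [← (v₁ i).1.zero]
    exact Dims.trajAt_congr fun o ho => a₂ _ (by simp [emitAreas]; omega) o
      (ho.trans_le (p.traj_le_H i (Nat.zero_le _)))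
  · have hne : Nonempty (Fin n → Fin M) := ⟨fun _ => ⟨0, hM⟩⟩
    have h1 : ‖p.matAt s₁ i‖ ^ 2 ≤ t * (2 * R + 1) := by
      have := (v₁ i).2 0 (fun y _ => by rw [app_zero]; exact (hp i).ball (by simp))
      rw [smul_zero, sub_zero, sub_zero] at this
      exact this.trans (hI.norm i)
    have h2 := norm_gradient_step_sq_le hM1 hB1
      (fun ℓ : Fin n → Fin M => O.grad i (Function.update (pick x (fun j => (ℓ j : ℕ))) i
        (x i (ℓ i + 1))))
      (fun ℓ => hO.grad_norm i _ (fun j => by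
        by_cases hj : j = i
        · subst hj; simpa using hxX j _ (ℓ j).2
        · simpa [hj, pick] using hxX j (ℓ j) (ℓ j).2.le))
      (fun ℓ => m i (x i (ℓ i))) (fun ℓ => (hp i).feat_le _ (hxX i _ (ℓ i).2.le))
      (p.matAt s₁ i) (R := R) (fun ℓ => by
        rw [← hxK i _ (ℓ i).2]
        simpa using hXR i (hxX i _ (ℓ i).2))
    rw [show (Fintype.card (Fin n → Fin M) : ℝ) = (M : ℝ) ^ n by simp] at h2
    have h3 : ‖p.matAt s₂ i‖ ^ 2 ≤ ‖p.matAt s₁ i‖ ^ 2 + (2 * R + 1) := by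
      rw [hK₂ i]; exact h2
    push_cast
    have h4 : p.matAt (s₂.setNat (2 * n + 8) (t + 1)) i = p.matAt s₂ i := rfl
    rw [h4]
    linarith
  · rw [← hpdef] at hr ⊢
    rw [Mem.setNat_real]
    rcases Nat.lt_or_ge r (t * p.N) with h | h
    · have := hblock r h
      have := p.S_pos
      rw [hr₂ _ (by omega)]
      exact hI.weight r h
    · have := (w₂ (r - t * p.N) (by omega)).1
      rwa [show t * p.N + (r - t * p.N) = r by omega] at this
  · change s₂.readProfile Γ.d (r * p.S + 1) ∈ Γ.profiles
    rw [← hpdef] at hr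
    rcases Nat.lt_or_ge r (t * p.N) with h | h
    · rw [hprof r h]
      exact hI.mem r h
    · have := (w₂ (r - t * p.N) (by omega)).2
      rw [show t * p.N + (r - t * p.N) = r by omega] at this
      rw [this]
      exact fun j => hxX j _ (digit_lt hM _ _).le
  · intro i φ hφ K' hK'
    change ∑ r ∈ Finset.range ((t + 1) * p.N), gain Γ i φ (s₂.readProfile Γ.d (r * p.S + 1)) ≤
      ((t + 1 : ℕ) : ℝ) * _ + _ * (_ - ‖p.matAt s₂ i - _‖ ^ 2)
    have h1 := round_regret hO hM hB1 i ((hp i).ball (by simp)) (hp i).feat_le x hxX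
      (p.matAt s₁ i) K' (hxK i) hφ hK'
    have h2 := hI.regret i φ hφ K' hK'
    -- The regret of earlier rounds is stated with the matrix before the cuts and that of this round
    -- with the matrix after them; monotonicity of the potential joins the two.
    have h3 := (v₁ i).2 K' (fun y hy => by rw [← hK' y hy]; exact hφ hy)
    rw [hsplit, Finset.sum_range_add]
    have h4 : ∑ r ∈ Finset.range (t * p.N), gain Γ i φ (s₂.readProfile Γ.d (r * p.S + 1)) =
        ∑ r ∈ Finset.range (t * p.N), gain Γ i φ (s.readProfile Γ.d (r * p.S + 1)) :=
      Finset.sum_congr rfl fun r hr => by rw [hprof r (Finset.mem_range.1 hr)]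
    have h5 : ∑ τ ∈ Finset.range p.N, gain Γ i φ (s₂.readProfile Γ.d ((t * p.N + τ) * p.S + 1)) =
        ∑ ℓ : Fin n → Fin M, gain Γ i φ (pick x (fun j => ℓ j)) := by
      rw [← sum_digits M (fun ℓ => gain Γ i φ (pick x ℓ))]
      exact Finset.sum_congr rfl fun τ hτ => by rw [(w₂ τ (Finset.mem_range.1 hτ)).2]
    rw [h4, h5]
    rw [← hK₂ i] at h1
    have h6 : 0 ≤ (M : ℝ) ^ n * p.B * M / 2 := by positivity
    have h7 := mul_le_mul_of_nonneg_left h3 h6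
    simp only [gain, pick] at h1 h2 ⊢
    push_cast
    have h8 : (p.M : ℝ) = M := rfl
    rw [h8] at h7
    rw [mul_sub] at h1 h2 ⊢
    linarith

end Main

/-! ### Computation of the parameters -/

section Setup

variable {n : ℕ} {d k : Fin n → ℕ} {O : Oracles d k}

/-- Store in cell `v` the first number from `c` on that violates the test `b`. -/
def count (n v c : ℕ) (b : BExp) : Prog n :=
  .seq (.nset (.const v) (.const c)) (.loop b (.nset (.const v) (.var v + .const 1)))

/-- Counting up replaces rounding of reals, which the machine lacks. The upper bound is `c + u`
because the start `c` may already exceed `u`. -/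
theorem count_runs {v c u : ℕ} {b : BExp} {s : Mem} (A : ℕ → Prop)
    (hb : ∀ s', s'.real = s.real → (b.holds s' ↔ A (s'.nat v))) (hu : ∀ r, u ≤ r → ¬ A r) :
    Runs O (count n v c b) s (u * (b.cost + 10) + b.cost + 10) (fun s' => ∃ r, c ≤ r ∧ r ≤ c + u ∧
      ¬ A r ∧ s' = s.setNat v r) := by
  refine (Runs.seq (T := 3) (T' := u * (b.cost + 10) + b.cost + 1) ((Runs.nset
    (Q := fun s' => s' = s.setNat v c) (by simp)).mono (by simp) (fun _ h => h)) ?_).mono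
    (by omega) (fun _ h => h)
  rintro _ rfl
  refine (Runs.loop (fun s' => ∃ r, c ≤ r ∧ r ≤ c + u ∧ s' = s.setNat v r)
    (fun s' => u - s'.nat v) 6 ?_ _ ⟨c, le_rfl, by omega, rfl⟩).mono ?_ ?_
  · rintro _ ⟨r, h₁, h₂, rfl⟩ hbs
    rw [hb (s.setNat v r) rfl, Mem.setNat_nat, if_pos rfl] at hbs
    have hru : r < u := by
      by_contra h
      exact hu r (by omega) hbs
    refine Runs.nset ⟨⟨r + 1, by omega, by omega, ?_⟩, ?_⟩
    · simp [Mem.setNat]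
    · simp; omega
  · rw [Mem.setNat_nat, if_pos rfl]
    have : (u - c) * (6 + b.cost + 1) ≤ u * (b.cost + 10) := Nat.mul_le_mul (by omega) (by omega)
    omega
  · rintro _ ⟨⟨r, h₁, h₂, rfl⟩, hn⟩
    rw [hb (s.setNat v r) rfl, Mem.setNat_nat, if_pos rfl] at hn
    exact ⟨r, h₁, h₂, hn, rfl⟩

/-- One plus the number of features. -/
def featsE (n : ℕ) : NExp := .const 1 + .sum ((List.finRange n).map (fun i : Fin n => .var (n + i)))

/-- One plus the total dimension. -/
def sizeE (n : ℕ) : NExp := .const 1 + .sum ((List.finRange n).map (fun i : Fin n => .var i))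

/-- Computation of the derived parameters from the dimensions, `M` and `D`. -/
def derive (n : ℕ) : Prog n :=
  Prog.seqs
    [.nset (.const (2 * n + 2)) (featsE n * .var (2 * n + 1) * .var (2 * n + 1)),
      .nset (.const (2 * n + 3)) (.var (2 * n + 2) * .var (2 * n + 1) * .var (2 * n + 1) *
        .var (2 * n) * .var (2 * n)),
      .nset (.const (2 * n + 4)) (.pow (.var (2 * n)) n),
      .nset (.const (2 * n + 5)) (sizeE n),
      .nset (.const (2 * n + 6)) (.var (2 * n + 5) * featsE n * (.var (2 * n) + .const 2)),
      .nset (.const (2 * n + 7)) (.var (2 * n + 3) * .var (2 * n + 4) * .var (2 * n + 5))]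

theorem eval_featsE {s : Mem} (h : ∀ i : Fin n, s.nat (n + i) = k i) :
    (featsE n).eval s = 1 + ∑ i, k i := by
  rw [featsE, NExp.eval_add, NExp.eval_sum, List.map_map, ← List.ofFn_eq_map, List.sum_ofFn]
  simp [h]

theorem eval_sizeE {s : Mem} (h : ∀ i : Fin n, s.nat i = d i) :
    (sizeE n).eval s = 1 + ∑ i, d i := by
  rw [sizeE, NExp.eval_add, NExp.eval_sum, List.map_map, ← List.ofFn_eq_map, List.sum_ofFn]
  simp [h]

/-- The code is loop-free and its expressions depend only on `n`, so the time is a constant. -/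
theorem derive_runs (n : ℕ) : ∃ T, ∀ (p : Dims n) (O : Oracles p.d p.k) (s : Mem),
    (∀ i : Fin n, s.nat i = p.d i) → (∀ i : Fin n, s.nat (n + i) = p.k i) →
    s.nat (2 * n) = p.M → s.nat (2 * n + 1) = p.D →
    Runs O (derive n) s T (fun s' => p.Holds s' ∧ s'.real = s.real) := by
  have H : ∀ (p : Dims n) (O : Oracles p.d p.k) (a e : NExp) (l : List (Prog n)) (T : ℕ)
      (Q : Mem → Prop) (s : Mem), Runs O (Prog.seqs l) (s.setNat (a.eval s) (e.eval s)) T Q →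
      Runs O (Prog.seqs (.nset a e :: l)) s (a.cost + e.cost + 1 + T) Q := by
    intro p O a e l T Q s h
    exact Runs.seq (Runs.nset (Q := fun s' => s' = s.setNat (a.eval s) (e.eval s)) rfl)
      (by rintro _ rfl; exact h)
  refine ⟨2 * (featsE n).cost + (sizeE n).cost + (NExp.pow (.var (2 * n)) n).cost + 60,
    fun p O s hd hk hM hD => ?_⟩
  refine (H p O _ _ _ _ _ _ (H p O _ _ _ _ _ _ (H p O _ _ _ _ _ _ (H p O _ _ _ _ _ _
    (H p O _ _ _ _ _ _ (H p O _ _ _ _ _ _ (Runs.skip ⟨?_, rfl⟩))))))).mono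
    (by simp; omega) (fun _ h => h)
  have hf : ∀ s' : Mem, (∀ i : Fin n, s'.nat (n + i) = p.k i) → (featsE n).eval s' = p.F :=
    fun s' h => eval_featsE h
  have hz : ∀ s' : Mem, (∀ i : Fin n, s'.nat i = p.d i) → (sizeE n).eval s' = p.S :=
    fun s' h => eval_sizeE h
  obtain ⟨s₁, e₁⟩ : ∃ s₁, s₁ = s.setNat (2 * n + 2) p.B := ⟨_, rfl⟩
  obtain ⟨s₂, e₂⟩ : ∃ s₂, s₂ = s₁.setNat (2 * n + 3) p.T := ⟨_, rfl⟩
  obtain ⟨s₃, e₃⟩ : ∃ s₃, s₃ = s₂.setNat (2 * n + 4) p.N := ⟨_, rfl⟩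
  obtain ⟨s₄, e₄⟩ : ∃ s₄, s₄ = s₃.setNat (2 * n + 5) p.S := ⟨_, rfl⟩
  obtain ⟨s₅, e₅⟩ : ∃ s₅, s₅ = s₄.setNat (2 * n + 6) p.H := ⟨_, rfl⟩
  obtain ⟨s₆, e₆⟩ : ∃ s₆, s₆ = s₅.setNat (2 * n + 7) p.base := ⟨_, rfl⟩
  have n₁ : NatEq (2 * n + 2) s s₁ := e₁ ▸ (NatEq.refl _ _).setNat le_rfl
  have n₂ : NatEq (2 * n + 3) s₁ s₂ := e₂ ▸ (NatEq.refl _ _).setNat le_rfl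
  have n₃ : NatEq (2 * n + 4) s₂ s₃ := e₃ ▸ (NatEq.refl _ _).setNat le_rfl
  have n₄ : NatEq (2 * n + 5) s₃ s₄ := e₄ ▸ (NatEq.refl _ _).setNat le_rfl
  have n₅ : NatEq (2 * n + 6) s₄ s₅ := e₅ ▸ (NatEq.refl _ _).setNat le_rfl
  have n₆ : NatEq (2 * n + 7) s₅ s₆ := e₆ ▸ (NatEq.refl _ _).setNat le_rfl
  have m₂ : NatEq (2 * n + 2) s s₂ := n₁.trans (n₂.mono (by omega))
  have m₃ : NatEq (2 * n + 2) s s₃ := m₂.trans (n₃.mono (by omega))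
  have m₄ : NatEq (2 * n + 2) s s₄ := m₃.trans (n₄.mono (by omega))
  have m₅ : NatEq (2 * n + 2) s s₅ := m₄.trans (n₅.mono (by omega))
  have m₆ : NatEq (2 * n + 2) s s₆ := m₅.trans (n₆.mono (by omega))
  have vB : s₁.nat (2 * n + 2) = p.B := by simp [e₁]
  have vT : s₂.nat (2 * n + 3) = p.T := by simp [e₂]
  have vN : s₃.nat (2 * n + 4) = p.N := by simp [e₃]
  have vS : s₄.nat (2 * n + 5) = p.S := by simp [e₄]
  have vH : s₅.nat (2 * n + 6) = p.H := by simp [e₅]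
  have vb : s₆.nat (2 * n + 7) = p.base := by simp [e₆]
  have vT₅ : s₅.nat (2 * n + 3) = p.T := by
    rw [n₅ _ (by omega), n₄ _ (by omega), n₃ _ (by omega), vT]
  have vN₅ : s₅.nat (2 * n + 4) = p.N := by rw [n₅ _ (by omega), n₄ _ (by omega), vN]
  have vS₅ : s₅.nat (2 * n + 5) = p.S := by rw [n₅ _ (by omega), vS]
  have hs₆ : p.Holds s₆ := by
    refine ⟨fun i => ?_, fun i => ?_, ?_, ?_, ?_, ?_, ?_, ?_, ?_, vb⟩
    · rw [m₆ _ (by omega), hd]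
    · rw [m₆ _ (by omega), hk]
    · rw [m₆ _ (by omega), hM]
    · rw [m₆ _ (by omega), hD]
    · rw [n₆ _ (by omega), n₅ _ (by omega), n₄ _ (by omega), n₃ _ (by omega), n₂ _ (by omega), vB]
    · rw [n₆ _ (by omega), vT₅]
    · rw [n₆ _ (by omega), vN₅]
    · rw [n₆ _ (by omega), vS₅]
    · rw [n₆ _ (by omega), vH]
  have q₁ : (featsE n * .var (2 * n + 1) * .var (2 * n + 1) : NExp).eval s = p.B := by
    simp [hf s hk, hD, Dims.B]
  have q₂ : (.var (2 * n + 2) * .var (2 * n + 1) * .var (2 * n + 1) *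
        .var (2 * n) * .var (2 * n) : NExp).eval s₁ = p.T := by
    simp [vB, n₁ _ (show 2 * n + 1 < 2 * n + 2 by omega), n₁ _ (show 2 * n < 2 * n + 2 by omega),
      hD, hM, Dims.T]
  have q₃ : (NExp.pow (.var (2 * n)) n).eval s₂ = p.N := by
    simp [m₂ _ (show 2 * n < 2 * n + 2 by omega), hM, Dims.N]
  have q₄ : (sizeE n).eval s₃ = p.S := hz s₃ fun i => by rw [m₃ _ (by omega), hd]
  have q₅ : (.var (2 * n + 5) * featsE n * (.var (2 * n) + .const 2) : NExp).eval s₄ = p.H := by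
    simp [vS, hf s₄ fun i => by rw [m₄ _ (by omega), hk], m₄ _ (show 2 * n < 2 * n + 2 by omega),
      hM, Dims.H]
  have q₆ : (.var (2 * n + 3) * .var (2 * n + 4) * .var (2 * n + 5) : NExp).eval s₅ = p.base := by
    simp [vT₅, vN₅, vS₅, Dims.base]
  simp only [NExp.eval_const]
  rw [q₁, ← e₁, q₂, ← e₂, q₃, ← e₃, q₄, ← e₄, q₅, ← e₅, q₆, ← e₆]
  exact hs₆

/-- Computation of all parameters: `M ≥ 3 / ε` and `D` rounded up. -/
def setup (n : ℕ) : Prog n :=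
  .seq (count n (2 * n) 3 (.rlt (.ofNat (.var (2 * n)) * .mem (.const 0)) (.ofNat (.const 3))))
    (.seq (count n (2 * n + 1) 1 (.rlt (.ofNat (.var (2 * n + 1))) (.mem (.const 2)))) (derive n))

theorem setup_runs (n : ℕ) : ∃ f, IsPoly f ∧ ∀ (d k : Fin n → ℕ) (O : Oracles d k) (ε R D : ℝ)
    (W : ℕ), 0 < ε → ⌈3 / ε⌉₊ ≤ W → ⌈D⌉₊ ≤ W →
    Runs O (setup n) (initMem d k ε R D) (f W) (fun s => ∃ M D' : ℕ, 3 ≤ M ∧ M ≤ 3 + ⌈3 / ε⌉₊ ∧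
      1 ≤ D' ∧ D' ≤ 1 + ⌈D⌉₊ ∧ 3 ≤ M * ε ∧ D ≤ D' ∧ (⟨d, k, M, D'⟩ : Dims n).Holds s ∧
      s.real = (initMem d k ε R D).real) := by
  obtain ⟨T, hT⟩ := derive_runs n
  refine ⟨fun W => (W * 30 + 30) + ((W * 30 + 30) + T), ((IsPoly.id.mul (.const _)).add
    (.const _)).add (((IsPoly.id.mul (.const _)).add (.const _)).add (.const _)), ?_⟩
  intro d k O ε R D W hε h₁ h₂
  have c₁ : (BExp.rlt (.ofNat (.var (2 * n)) * .mem (.const 0)) (.ofNat (.const 3))).cost = 9 := rfl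
  have c₂ : (BExp.rlt (.ofNat (.var (2 * n + 1))) (.mem (.const 2))).cost = 6 := rfl
  refine Runs.seq ((count_runs (fun r => (r : ℝ) * ε < 3) (u := ⌈3 / ε⌉₊) ?_ ?_).mono ?_
    (fun _ h => h)) ?_
  · intro s' hs'
    simp [hs', initMem]
  · intro r hr
    rw [not_lt, ← div_le_iff₀ hε]
    exact (Nat.le_ceil _).trans (by exact_mod_cast hr)
  · rw [c₁]; omega
  rintro _ ⟨M, hM₁, hM₂, hM₃, rfl⟩
  refine Runs.seq ((count_runs (fun r => (r : ℝ) < D) (u := ⌈D⌉₊) ?_ ?_).mono ?_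
    (fun _ h => h)) ?_
  · intro s' hs'
    simp [hs', initMem]
  · intro r hr
    rw [not_lt]
    exact (Nat.le_ceil _).trans (by exact_mod_cast hr)
  · rw [c₂]; omega
  rintro _ ⟨D', hD₁, hD₂, hD₃, rfl⟩
  refine (hT ⟨d, k, M, D'⟩ O _ (fun i => ?_) (fun i => ?_) ?_ ?_).mono le_rfl ?_
  · have h1 : (i : ℕ) ≠ 2 * n := by omega
    have h2 : (i : ℕ) ≠ 2 * n + 1 := by omega
    simp [h1, h2, initMem]
  · have h1 : n + (i : ℕ) ≠ 2 * n := by omega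
    have h2 : n + (i : ℕ) ≠ 2 * n + 1 := by omega
    simp [h1, h2, initMem]
  · simp
  · simp
  · rintro s ⟨hs, hr⟩
    exact ⟨M, D', hM₁, hM₂, hD₁, hD₂, not_lt.1 hM₃, not_lt.1 hD₃, hs, hr⟩

end Setup

/-! ### The algorithm -/

section Algorithm

/-- The complete algorithm. -/
def algorithm (n : ℕ) : Prog n :=
  .seq (setup n) (.seq (.forN (2 * n + 8) (.var (2 * n + 3)) (round n))
    (.nset (.const 0) (.var (2 * n + 3) * .var (2 * n + 4))))

variable {n : ℕ}

/-- The main loop, started with parameters in place and cleared working areas. -/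
theorem main_runs (n : ℕ) : ∃ f, IsPoly f ∧ ∀ (Γ : ConcaveGame n) (k : Fin n → ℕ)
    (m : (i : Fin n) → Vec (Γ.d i) → Fin (k i) → ℝ) (O : Oracles Γ.d k) (M D : ℕ) (R : ℝ)
    (s : Mem) (W : ℕ), O.Correct Γ m →
    (∀ i, PlayerCorrect (gameDims Γ k M D) O i (Γ.X i) (m i)) →
    (∀ i, Γ.X i ⊆ Metric.closedBall 0 R) → 0 < R → 1 ≤ M → 1 ≤ (gameDims Γ k M D).B →
    (gameDims Γ k M D).Holds s → (gameDims Γ k M D).S ≤ W → (gameDims Γ k M D).F ≤ W →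
    (gameDims Γ k M D).N ≤ W → (gameDims Γ k M D).T ≤ W →
    ⌊(gameDims Γ k M D).T * (2 * R + 1) * ((M : ℝ) ^ 2 * (gameDims Γ k M D).B)⌋₊ * (M + 1) + M ≤ W →
    (∀ a, (gameDims Γ k M D).base ≤ a → s.real a = 0) →
    Runs O (.seq (.forN (2 * n + 8) (.var (2 * n + 3)) (round n))
      (.nset (.const 0) (.var (2 * n + 3) * .var (2 * n + 4)))) s (f W) (fun s' =>
      s'.nat 0 = (gameDims Γ k M D).T * (gameDims Γ k M D).N ∧
      ∃ s₁, s'.real = s₁.real ∧ MainInv Γ M D m R s (gameDims Γ k M D).T s₁) := by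
  obtain ⟨f, hf, hround⟩ := round_runs n
  refine ⟨fun W => (W * (f W + 2 + 12) + 2 + 12) + 7, (((IsPoly.id.mul ((hf.add (.const _)).add
    (.const _))).add (.const _)).add (.const _)).add (.const _), ?_⟩
  intro Γ k m O M D R s W hO hp hXR hR hM hB hs hS hF hN hT hW h0
  set p := gameDims Γ k M D with hpdef
  -- The matrices live at or above `base`, where memory is still zero, so gradient ascent starts at
  -- `K = 0`.
  have hmat : ∀ i, p.matAt s i = 0 := fun i => by
    ext q
    exact h0 _ (p.base_le_adr _ _)
  refine Runs.seq ((Runs.forN (O := O) p.T (f W) (MainInv Γ M D m R s) ?_ ?_ ?_).mono ?_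
    (fun _ h => h)) ?_
  · refine ⟨(NatEq.refl _ _).setNat le_rfl, fun i => ?_, fun i => ?_, fun r hr => ?_, fun r hr => ?_,
      fun i φ hφ K' hK' => ?_⟩
    · ext c
      simp only [Dims.trajAt, Mem.readVec, Dims.adr_add]
      exact h0 _ (p.base_le_adr _ _)
    · have : (gameDims Γ k M D).matAt (s.setNat (2 * n + 8) 0) i = 0 := hmat i
      rw [this]; simp
    · simp at hr
    · simp at hr
    · have : (gameDims Γ k M D).matAt (s.setNat (2 * n + 8) 0) i = 0 := hmat i
      rw [this]; simp
  · intro j s' h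
    exact (hs.of_natEq le_rfl h.nat).T
  · intro t ht s' h hv
    exact hround Γ k m O M D R s s' t W hO hp hXR hR hM hB hs hS hF hN ht hW h hv
  · have := Nat.mul_le_mul_right (f W + 2 + 12) hT
    simp only [NExp.cost_var]
    omega
  · intro s₁ h
    -- Cell 0 has been a parameter cell so far; it is overwritten by the number of points only now.
    refine (Runs.nset ?_).mono (by simp) (fun _ h => h)
    have hs₁ := hs.of_natEq le_rfl h.nat
    refine ⟨?_, s₁, rfl, h⟩
    simp [hs₁.T, hs₁.N]

/-- The distribution computed by the main loop is an approximate equilibrium. -/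
theorem MainInv.exists_equilibrium {Γ : ConcaveGame n} {k : Fin n → ℕ}
    {m : (i : Fin n) → Vec (Γ.d i) → Fin (k i) → ℝ} {M D : ℕ} {R D₀ ε : ℝ} {s₀ s s' : Mem}
    (h : MainInv Γ M D m R s₀ (gameDims Γ k M D).T s) (hM : 1 ≤ M) (hD : 1 ≤ D)
    (hMε : 3 ≤ M * ε) (hD₀ : 0 ≤ D₀) (hDD : D₀ ≤ D) (hm : ∀ i, FeatureBound (Γ.X i) (m i) D₀)
    (hs' : s'.real = s.real)
    (hs0 : s'.nat 0 = (gameDims Γ k M D).T * (gameDims Γ k M D).N) :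
    ∃ μ : FinDist (Profile Γ.d), Outputs s' μ ∧
      IsApproxEquilibrium Γ (fun i => phiSet (Γ.X i) (m i)) ε μ := by
  set p := gameDims Γ k M D with hpdef
  have hB0 : 0 < p.B := Nat.mul_pos (Nat.mul_pos p.F_pos hD) hD
  have hT0 : 0 < p.T :=
    Nat.mul_pos (Nat.mul_pos (Nat.mul_pos (Nat.mul_pos hB0 hD) hD) hM) hM
  have hN0 : 0 < p.N := Nat.pow_pos hM
  have hTN : (0 : ℝ) < (p.T : ℝ) * p.N := by positivity
  refine ⟨⟨p.T * p.N, fun _ => 1 / ((p.T : ℝ) * p.N),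
    fun j => s.readProfile Γ.d (j * p.S + 1), fun _ => by positivity, ?_⟩, ⟨hs0, fun j => ?_⟩,
    fun j => h.mem j j.2, fun i φ hφ => ?_⟩
  · rw [Finset.sum_const, Finset.card_univ, Fintype.card_fin, nsmul_eq_mul]
    push_cast
    field_simp
  · refine ⟨?_, ?_⟩
    · rw [hs']; exact h.weight j j.2
    · funext i
      ext c
      exact congrFun hs' _
  · obtain ⟨K, hK, hKD⟩ := (hm i).2 φ hφ
    set K' : Mat (Γ.d i) (k i) := WithLp.toLp 2 (fun q => K q.1 q.2) with hK'
    have hrep : ∀ y ∈ Γ.X i, φ y = app K' (m i y) := fun y hy => by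
      ext c
      rw [hK y hy c]
      rfl
    have hnorm : ‖(1 - 1 / (M : ℝ)) • K'‖ ^ 2 ≤ (D : ℝ) ^ 2 := by
      have h1 : ‖K'‖ ^ 2 = ∑ c, ∑ j, K c j ^ 2 := by
        rw [EuclideanSpace.norm_sq_eq, Fintype.sum_prod_type]
        simp [hK']
      have hM1 : (1 : ℝ) ≤ M := by exact_mod_cast hM
      have h2 : |1 - 1 / (M : ℝ)| ≤ 1 := by
        have h3 : 0 ≤ 1 / (M : ℝ) := by positivity
        have h4 : 1 / (M : ℝ) ≤ 1 := by rw [div_le_one (by positivity)]; exact hM1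
        rw [abs_le]; constructor <;> linarith
      have h3 : |1 - 1 / (M : ℝ)| ^ 2 ≤ 1 := pow_le_one₀ (abs_nonneg _) h2
      rw [norm_smul, mul_pow, Real.norm_eq_abs]
      calc |1 - 1 / (M : ℝ)| ^ 2 * ‖K'‖ ^ 2 ≤ ‖K'‖ ^ 2 :=
            mul_le_of_le_one_left (by positivity) h3
        _ ≤ D₀ ^ 2 := h1 ▸ hKD
        _ ≤ (D : ℝ) ^ 2 := by gcongr
    have hreg := h.regret i φ hφ.1 K' hrep
    have hM0 : (0 : ℝ) < M := by exact_mod_cast hM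
    have hNM : (p.N : ℝ) = (M : ℝ) ^ n := by
      have : p.N = M ^ n := rfl
      rw [this]; push_cast; rfl
    have hTB : (p.T : ℝ) = p.B * D * D * M * M := by
      have : p.T = p.B * D * D * M * M := rfl
      rw [this]; push_cast; rfl
    have hc : 0 ≤ (M : ℝ) ^ n * p.B * M / 2 := by positivity
    have hsum : ∑ r ∈ Finset.range (p.T * p.N), gain Γ i φ (s.readProfile Γ.d (r * p.S + 1)) ≤
        ε * ((p.T : ℝ) * p.N) := by
      refine hreg.trans ?_
      -- The final potential is dropped; the initial one is at most `D²` by the choice of the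
      -- representing matrix.
      have h1 : (M : ℝ) ^ n * p.B * M / 2 * (‖(1 - 1 / (M : ℝ)) • K'‖ ^ 2 -
          ‖p.matAt s i - (1 - 1 / (M : ℝ)) • K'‖ ^ 2) ≤ (M : ℝ) ^ n * p.B * M / 2 * (D : ℝ) ^ 2 := by
        refine mul_le_mul_of_nonneg_left ?_ hc
        have := sq_nonneg ‖p.matAt s i - (1 - 1 / (M : ℝ)) • K'‖
        linarith
      -- This fixes `T = B D² M²`: the initial potential then contributes `1/(2M)` per point, and
      -- together with `5/(2M)` from the rounds the total is `3/M`.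
      have h2 : (M : ℝ) ^ n * p.B * M / 2 * (D : ℝ) ^ 2 = (p.T : ℝ) * p.N * (1 / 2 / M) := by
        rw [hNM, hTB]; field_simp
      have h3 : (p.T : ℝ) * ((M : ℝ) ^ n * (5 / 2 / M)) = (p.T : ℝ) * p.N * (5 / 2 / M) := by
        rw [hNM]; ring
      have h4 : 3 / (M : ℝ) ≤ ε := by rw [div_le_iff₀ hM0]; linarith
      have h5 : (p.T : ℝ) * p.N * (3 / M) ≤ (p.T : ℝ) * p.N * ε :=
        mul_le_mul_of_nonneg_left h4 hTN.le
      have h6 : (p.T : ℝ) * p.N * (5 / 2 / M) + (p.T : ℝ) * p.N * (1 / 2 / M) =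
          (p.T : ℝ) * p.N * (3 / M) := by ring
      linarith
    rw [Finset.sum_range] at hsum
    have : FinDist.expect ⟨p.T * p.N, fun _ => 1 / ((p.T : ℝ) * p.N),
        fun j => s.readProfile Γ.d (j * p.S + 1), fun _ => by positivity, by
          rw [Finset.sum_const, Finset.card_univ, Fintype.card_fin, nsmul_eq_mul]
          push_cast
          field_simp⟩ (gain Γ i φ) =
        (1 / ((p.T : ℝ) * p.N)) *
          ∑ j : Fin (p.T * p.N), gain Γ i φ (s.readProfile Γ.d (j * p.S + 1)) := by
      simp only [FinDist.expect, Finset.mul_sum]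
    refine (this.le).trans ?_
    rw [one_div, inv_mul_le_iff₀ hTN]
    exact hsum.trans_eq (mul_comm _ _)

end Algorithm

/-- All quantities governing the running time are polynomially bounded. -/
theorem size_le {n : ℕ} (p : Dims n) {R D ε : ℝ} (hR : 0 < R) (hD : 0 ≤ D) (hε : 0 < ε)
    (hM : p.M ≤ 3 + ⌈3 / ε⌉₊) (hD' : p.D ≤ 1 + ⌈D⌉₊) :
    ((⌈3 / ε⌉₊ + ⌈D⌉₊ + p.S + p.F + p.N + p.T +
      (⌊(p.T : ℝ) * (2 * R + 1) * ((p.M : ℝ) ^ 2 * p.B)⌋₊ * (p.M + 1) + p.M) + 1 : ℕ) : ℝ) ≤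
      (4000000 + 7 ^ n) *
        (1 + ∑ i, (p.d i : ℝ) + ∑ i, (p.k i : ℝ) + R + D + 1 / ε) ^ (14 + n) := by
  obtain ⟨Z, hZ⟩ : ∃ Z : ℝ, 1 + ∑ i, (p.d i : ℝ) + ∑ i, (p.k i : ℝ) + R + D + 1 / ε = Z :=
    ⟨_, rfl⟩
  rw [hZ]
  have hd0 : 0 ≤ ∑ i, (p.d i : ℝ) := Finset.sum_nonneg fun _ _ => Nat.cast_nonneg _
  have hk0 : 0 ≤ ∑ i, (p.k i : ℝ) := Finset.sum_nonneg fun _ _ => Nat.cast_nonneg _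
  have hε0 : 0 < 1 / ε := by positivity
  have hZ1 : 1 ≤ Z := by linarith
  have hS : (p.S : ℝ) ≤ Z := by
    rw [Dims.S]; push_cast; linarith
  have hF : (p.F : ℝ) ≤ Z := by
    rw [Dims.F]; push_cast; linarith
  have hu₁ : (⌈3 / ε⌉₊ : ℝ) ≤ 4 * Z := by
    have h1 := (Nat.ceil_lt_add_one (show 0 ≤ 3 / ε by positivity)).le
    have h2 : 3 / ε = 3 * (1 / ε) := by ring
    linarith
  have hu₂ : (⌈D⌉₊ : ℝ) ≤ Z := by
    have h1 := (Nat.ceil_lt_add_one hD).le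
    linarith
  have hM' : (p.M : ℝ) ≤ 7 * Z := by
    have : (p.M : ℝ) ≤ 3 + ⌈3 / ε⌉₊ := by exact_mod_cast hM
    linarith
  have hDZ : (p.D : ℝ) ≤ 2 * Z := by
    have : (p.D : ℝ) ≤ 1 + ⌈D⌉₊ := by exact_mod_cast hD'
    linarith
  have hB : (p.B : ℝ) ≤ 4 * Z ^ 3 := by
    rw [Dims.B]; push_cast
    calc (p.F : ℝ) * p.D * p.D ≤ Z * (2 * Z) * (2 * Z) := by gcongr
      _ = 4 * Z ^ 3 := by ring
  have hT : (p.T : ℝ) ≤ 784 * Z ^ 7 := by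
    rw [Dims.T]; push_cast
    calc (p.B : ℝ) * p.D * p.D * p.M * p.M ≤
        (4 * Z ^ 3) * (2 * Z) * (2 * Z) * (7 * Z) * (7 * Z) := by gcongr
      _ = 784 * Z ^ 7 := by ring
  have hN : (p.N : ℝ) ≤ 7 ^ n * Z ^ n := by
    rw [Dims.N, ← mul_pow]; push_cast
    gcongr
  -- The bound on the number of cuts in a trajectory has degree `7 + 1 + 2 + 3` in `Z`; the factor
  -- `M + 1` for its steps makes this the dominant term, of degree 14.
  have hfl : (⌊(p.T : ℝ) * (2 * R + 1) * ((p.M : ℝ) ^ 2 * p.B)⌋₊ : ℝ) ≤ 460992 * Z ^ 13 := by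
    refine (Nat.floor_le (by positivity)).trans ?_
    have hR' : 2 * R + 1 ≤ 3 * Z := by linarith
    calc (p.T : ℝ) * (2 * R + 1) * ((p.M : ℝ) ^ 2 * p.B) ≤
        (784 * Z ^ 7) * (3 * Z) * ((7 * Z) ^ 2 * (4 * Z ^ 3)) := by gcongr
      _ = 460992 * Z ^ 13 := by ring
  have hM1 : (p.M : ℝ) + 1 ≤ 8 * Z := by linarith
  have hprod : (⌊(p.T : ℝ) * (2 * R + 1) * ((p.M : ℝ) ^ 2 * p.B)⌋₊ : ℝ) * (p.M + 1) ≤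
      3687936 * Z ^ 14 := by
    calc _ ≤ (460992 * Z ^ 13) * (8 * Z) := by gcongr
      _ = 3687936 * Z ^ 14 := by ring
  have e1 : Z ≤ Z ^ (14 + n) := le_self_pow₀ hZ1 (by omega)
  have e2 : Z ^ 7 ≤ Z ^ (14 + n) := pow_le_pow_right₀ hZ1 (by omega)
  have e3 : Z ^ 14 ≤ Z ^ (14 + n) := pow_le_pow_right₀ hZ1 (by omega)
  have e4 : Z ^ n ≤ Z ^ (14 + n) := pow_le_pow_right₀ hZ1 (by omega)
  have e5 : (7 : ℝ) ^ n * Z ^ n ≤ 7 ^ n * Z ^ (14 + n) := by gcongr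
  push_cast
  linarith

end PhiEq

/-! ### Assembly -/

theorem mainTheorem4 (n : ℕ) :
    ∃ (P : PhiEq.Prog n) (C e : ℕ),
      ∀ (Γ : PhiEq.ConcaveGame n) (k : Fin n → ℕ)
        (m : (i : Fin n) → PhiEq.Vec (Γ.d i) → Fin (k i) → ℝ)
        (O : PhiEq.Oracles Γ.d k) (R D ε : ℝ),
        O.Correct Γ m →
        0 < R →
        0 ≤ D →
        0 < ε →
        (∀ i, Metric.closedBall 0 1 ⊆ Γ.X i ∧ Γ.X i ⊆ Metric.closedBall 0 R) →
        (∀ i, PhiEq.FeatureBound (Γ.X i) (m i) D) →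
        ∃ (t : ℕ) (s : PhiEq.Mem) (μ : PhiEq.FinDist (PhiEq.Profile Γ.d)),
          PhiEq.Exec O P (PhiEq.initMem Γ.d k ε R D) t s ∧
          (t : ℝ) ≤ C * (1 + ∑ i, (Γ.d i : ℝ) + ∑ i, (k i : ℝ) + R + D + 1 / ε) ^ e ∧
          PhiEq.Outputs s μ ∧
          PhiEq.IsApproxEquilibrium Γ (fun i => PhiEq.phiSet (Γ.X i) (m i)) ε μ := by
  obtain ⟨f₁, hf₁, hsetup⟩ := PhiEq.setup_runs n
  obtain ⟨f₂, hf₂, hmain⟩ := PhiEq.main_runs n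
  obtain ⟨c₁, e₁, hb₁⟩ := hf₁
  obtain ⟨c₂, e₂, hb₂⟩ := hf₂
  refine ⟨PhiEq.algorithm n, c₁ * (4000000 + 7 ^ n) ^ e₁ + c₂ * (4000000 + 7 ^ n) ^ e₂,
    (14 + n) * (e₁ + e₂), ?_⟩
  intro Γ k m O R D ε hO hR hD hε hX hm
  -- The setup has its own size parameter, since `M` and `D'` are known only after it; the final `1`
  -- makes the polynomial bound applicable.
  set W₁ : ℕ := ⌈3 / ε⌉₊ + ⌈D⌉₊ + 1 with hW₁
  obtain ⟨t₁, s₁, x₁, ht₁, M, D', hM, hMle, hD', hD'le, hMε, hDD, hs₁, hr₁⟩ :=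
    hsetup Γ.d k O ε R D W₁ hε (by omega) (by omega)
  set p := PhiEq.gameDims Γ k M D' with hp
  have hF0 := p.F_pos
  have hB0 : 0 < p.B := Nat.mul_pos (Nat.mul_pos hF0 hD') hD'
  have hsize := PhiEq.size_le p hR hD hε hMle hD'le
  set W : ℕ := ⌈3 / ε⌉₊ + ⌈D⌉₊ + p.S + p.F + p.N + p.T +
      (⌊(p.T : ℝ) * (2 * R + 1) * ((p.M : ℝ) ^ 2 * p.B)⌋₊ * (p.M + 1) + p.M) + 1 with hW
  have hplayer : ∀ i, PhiEq.PlayerCorrect p O i (Γ.X i) (m i) := fun i => by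
    refine ⟨hO.sep_mem i, hO.sep_not_mem i, hO.feat_eq i, (hX i).1, fun y hy => ?_, ?_, hB0⟩
    · have h1 : ∀ j, m i y j ^ 2 ≤ (D' : ℝ) ^ 2 := fun j => by
        rw [← sq_abs]
        have := (hm i).1 y hy j
        gcongr
        exact this.trans hDD
      calc ∑ j, m i y j ^ 2 ≤ ∑ _j : Fin (k i), (D' : ℝ) ^ 2 := Finset.sum_le_sum fun j _ => h1 j
        _ = (k i : ℝ) * (D' : ℝ) ^ 2 := by simp
        _ ≤ (p.F : ℝ) * (D' : ℝ) ^ 2 := by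
            have : (k i : ℝ) ≤ p.F := by exact_mod_cast (p.k_lt_F i).le
            gcongr
        _ = (p.B : ℝ) := by
            have : p.B = p.F * D' * D' := rfl
            rw [this]; push_cast; ring
    · exact (show 1 ≤ 3 by norm_num).trans hM
  -- The counter for `M` starts at 3 for this reason: the working areas then begin beyond the three
  -- input cells and are initially zero.
  have hbase : 3 ≤ p.base := by
    have hT : p.T = p.B * D' * D' * M * M := rfl
    have hN0 : 0 < p.N := Nat.pow_pos (by omega : 0 < M)
    have h1 : 1 ≤ p.B * D' * D' * M :=
      Nat.mul_pos (Nat.mul_pos (Nat.mul_pos hB0 hD') hD') (by omega)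
    have h2 : 3 ≤ p.T := by
      rw [hT]
      calc 3 ≤ 1 * M := by omega
        _ ≤ _ := Nat.mul_le_mul_right _ h1
    calc 3 ≤ p.T := h2
      _ ≤ p.T * p.N := Nat.le_mul_of_pos_right _ hN0
      _ ≤ p.T * p.N * p.S := Nat.le_mul_of_pos_right _ p.S_pos
  have hWS : p.S ≤ W := by omega
  have hWF : p.F ≤ W := by omega
  have hWN : p.N ≤ W := by omega
  have hWT : p.T ≤ W := by omega
  have hWfl : ⌊(p.T : ℝ) * (2 * R + 1) * ((p.M : ℝ) ^ 2 * p.B)⌋₊ * (p.M + 1) + p.M ≤ W := by omega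
  obtain ⟨t₂, s₂, x₂, ht₂, hs₂, s', hr', hinv⟩ := hmain Γ k m O M D' R s₁ W hO hplayer
    (fun i => (hX i).2) hR (by omega) hB0 hs₁ hWS hWF hWN hWT
    hWfl (fun a ha => by
      rw [hr₁]
      have h3 : 3 ≤ a := hbase.trans ha
      simp only [PhiEq.initMem]
      rw [if_neg (by omega), if_neg (by omega), if_neg (by omega)])
  obtain ⟨μ, hμ₁, hμ₂⟩ := hinv.exists_equilibrium (s' := s₂) (by omega) hD' hMε hD hDD hm hr' hs₂
  refine ⟨t₁ + t₂, s₂, μ, .seq x₁ x₂, ?_, hμ₁, hμ₂⟩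
  have hpd : p.d = Γ.d := rfl
  have hpk : p.k = k := rfl
  rw [hpd, hpk] at hsize
  set Z : ℝ := 1 + ∑ i, (Γ.d i : ℝ) + ∑ i, (k i : ℝ) + R + D + 1 / ε with hZ
  have hZ1 : 1 ≤ Z := by
    have hd0 : 0 ≤ ∑ i, (Γ.d i : ℝ) := Finset.sum_nonneg fun _ _ => Nat.cast_nonneg _
    have hk0 : 0 ≤ ∑ i, (k i : ℝ) := Finset.sum_nonneg fun _ _ => Nat.cast_nonneg _
    have hε0 : 0 < 1 / ε := by positivity
    linarith
  -- Both phases are brought to the common exponent `(14 + n) (e₁ + e₂)`, possible because `Z ≥ 1`.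
  have hbound : ∀ (c e e' V t : ℕ), t ≤ c * V ^ e → V ≤ W → e ≤ e' →
      (t : ℝ) ≤ c * (4000000 + 7 ^ n) ^ e * Z ^ ((14 + n) * e') := by
    intro c e e' V t ht hV he
    have h1 : (t : ℝ) ≤ c * (V : ℝ) ^ e := by exact_mod_cast ht
    have h2 : (V : ℝ) ≤ W := by exact_mod_cast hV
    calc (t : ℝ) ≤ c * (V : ℝ) ^ e := h1
      _ ≤ c * ((4000000 + 7 ^ n) * Z ^ (14 + n)) ^ e := by
          gcongr
          exact h2.trans hsize
      _ = c * (4000000 + 7 ^ n) ^ e * Z ^ ((14 + n) * e) := by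
          rw [mul_pow, ← pow_mul, mul_assoc]
      _ ≤ _ := by
          gcongr
  have b₁ := hbound c₁ e₁ (e₁ + e₂) W₁ t₁ (ht₁.trans (hb₁ W₁ (by omega))) (by omega) (by omega)
  have b₂ := hbound c₂ e₂ (e₁ + e₂) W t₂ (ht₂.trans (hb₂ W (by omega))) le_rfl (by omega)
  push_cast
  rw [add_mul]
  exact add_le_add b₁ b₂
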